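/- Let $\alpha>-1/2$ and let $\eta_1,\eta_2,\ldots$ be independent identically distributed real random variables with $\mathbb{E}\eta_1=0$ and $\sigma_1^2:=\mathbb{E}\eta_1^2\in(0,\infty)$. Then, almost surely, the series $$\sum_{k\ge 2}\frac{(\log k)^\alpha}{k^{1/2+s}}\,\eta_k:=\lim_{N\to\infty}\sum_{k=2}^N\frac{(\log k)^\alpha}{k^{1/2+s}}\,\eta_k$$ converges for all $s>0$ simultaneously, $$\limsup_{s\to 0+}\Big(\frac{s^{1+2\alpha}}{\log\log (1/s)}\Big)^{1/2}\sum_{k\ge 2}\frac{(\log k)^\alpha}{k^{1/2+s}}\,\eta_k=\Big(\frac{\sigma_1^2\,\Gamma(1+2\alpha)}{2^{2\alpha}}\Big)^{1/2}\quad\text{a.s.}$$ and $$\liminf_{s\to 0+}\Big(\frac{s^{1+2\alpha}}{\log\log (1/s)}\Big)^{1/2}\sum_{k\ge 2}\frac{(\log k)^\alpha}{k^{1/2+s}}\,\eta_k=-\Big(\frac{\sigma_1^2\,\Gamma(1+2\alpha)}{2^{2\alpha}}\Big)^{1/2}\quad\text{a.s.}$$ In particular, almost surely, the set of limit points, as $s\to0+$,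 of the family $$\Big(\frac{2^{2\alpha}}{\sigma_1^2\,\Gamma(1+2\alpha)}\,\frac{s^{1+2\alpha}}{\log\log (1/s)}\Big)^{1/2}\sum_{k\ge 2}\frac{(\log k)^\alpha}{k^{1/2+s}}\,\eta_k,\qquad s\in(0,1/\mathrm{e}),$$ equals $[-1,1]$. -/

import Mathlib

open MeasureTheory ProbabilityTheory Filter Topology

/-- The `N`-th partial sum `∑_{k=2}^N (log k)^α x_k / k^z` (real `z`). -/
noncomputable def dirichletPartialSum (α : ℝ) (x : ℕ → ℝ) (z : ℝ) (N : ℕ) : ℝ :=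
  ∑ k ∈ Finset.Icc 2 N, Real.log (k : ℝ) ^ α / (k : ℝ) ^ z * x k

/-- The Dirichlet series `D(α; z) = ∑_{k ≥ 2} (log k)^α x_k / k^z` at a real point `z`, as the limit
of its partial sums. (The series need not converge absolutely, so `tsum` would not be appropriate.)
It is only meaningful where the partial sums converge. -/
noncomputable def dirichletSeries (α : ℝ) (x : ℕ → ℝ) (z : ℝ) : ℝ :=
  limUnder atTop (dirichletPartialSum α x z)

/-! The variance of the series at `1/2 + s` is `σ₁² ∑ (log k)^(2α) / k^(1+2s)`. Comparison with `∫
y^(2α) e^(-2sy) dy` shows that it is asymptotic to `c s^(-(1+2α))` with `c = σ₁² Γ(1+2α) / 2^(1+2α)`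
(`exists_abs_tsum_dirichletWeight_sub_le`). The series at two points decorrelates once their ratio
is large, so `log (1/s)` plays the part of a discrete time, and a Gaussian process with these
variances would have iterated-logarithm constant `√(2c)`.

The Gaussian behaviour is needed only for moment generating functions. Truncating the `k`-th
variable at `√k` makes every tilted summand uniformly small (`eventually_sqrt_mul_rpow_le`, where `α
> -1/2` enters), so the moment generating function is sandwiched between Gaussian ones with factors
close to 1. Truncation is harmless because a finite second moment makes the removed parts summable
against `1/√k` (`ae_summable_abs_sub_truncatedNoise`).

Upper half: a Chernoff bound along `s_n = exp(-n^p)`, with `p < 1` close to 1, is summable in `n`.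
Between grid points the series is controlled through exponential moments of its derivative
(`exists_ae_eventually_oscillation_le`).

Lower half: on a geometric grid, the indices with `s_n log k` in `(1/R, R]` carry almost all the
variance and form disjoint blocks. The block sums are independent and have a sharp lower deviation
bound (`eventually_le_measureReal_logBlock`), so the second Borel–Cantelli lemma applies; the
off-block part has small variance and is bounded by Chernoff.

The lower limit comes from negating the noise, and the cluster set from continuity and the
intermediate value theorem. -/

/-! ### Weights and the asymptotics of their sums -/

/-- The coefficient `(log k)^α / k^z` for `k ≥ 2`, extended by zero. -/
noncomputable def dirichletWeight (α z : ℝ) (k : ℕ) : ℝ :=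
  if 2 ≤ k then Real.log (k : ℝ) ^ α / (k : ℝ) ^ z else 0

lemma dirichletWeight_nonneg (α z : ℝ) (k : ℕ) : 0 ≤ dirichletWeight α z k := by
  unfold dirichletWeight
  split_ifs with h
  · have : 0 ≤ Real.log (k : ℝ) := Real.log_natCast_nonneg k
    positivity
  · rfl

lemma dirichletPartialSum_eq_sum_range (α : ℝ) (x : ℕ → ℝ) (z : ℝ) (N : ℕ) :
    dirichletPartialSum α x z N = ∑ k ∈ Finset.range (N + 1), dirichletWeight α z k * x k := by
  unfold dirichletPartialSum dirichletWeight
  simp only [ite_mul, zero_mul]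
  rw [← Finset.sum_filter]
  apply Finset.sum_congr _ (fun _ _ => rfl)
  ext k
  simp only [Finset.mem_Icc, Finset.mem_filter, Finset.mem_range]
  omega

lemma log_pos_of_two_le {x : ℝ} (hx : 2 ≤ x) : 0 < Real.log x := Real.log_pos (by linarith)

lemma two_le_natCast {k : ℕ} (hk : 2 ≤ k) : (2 : ℝ) ≤ k := by exact_mod_cast hk

lemma dirichletWeight_mul_dirichletWeight (α β y z : ℝ) (k : ℕ) :
    dirichletWeight α y k * dirichletWeight β z k = dirichletWeight (α + β) (y + z) k := by
  unfold dirichletWeight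
  split_ifs with h
  · have h2 := two_le_natCast h
    have hl := log_pos_of_two_le h2
    rw [Real.rpow_add hl, Real.rpow_add (by linarith)]
    field_simp
  · simp

lemma dirichletWeight_sq (α z : ℝ) (k : ℕ) :
    dirichletWeight α z k ^ 2 = dirichletWeight (2 * α) (2 * z) k := by
  rw [sq, dirichletWeight_mul_dirichletWeight]
  ring_nf

lemma exists_rpow_le_mul_exp {γ : ℝ} (hγ : 0 ≤ γ) :
    ∃ C : ℝ, 0 < C ∧ ∀ z : ℝ, 0 ≤ z → z ^ γ ≤ C * Real.exp z := by
  rcases hγ.eq_or_lt with rfl | h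
  · refine ⟨1, one_pos, fun z hz => ?_⟩
    simpa using hz
  · refine ⟨γ ^ γ, by positivity, fun z hz => ?_⟩
    have h1 : z ≤ γ * Real.exp (z / γ) := by
      have := Real.add_one_le_exp (z / γ)
      have h2 : z / γ ≤ Real.exp (z / γ) := by linarith
      rw [div_le_iff₀ h] at h2
      linarith
    calc z ^ γ ≤ (γ * Real.exp (z / γ)) ^ γ := Real.rpow_le_rpow hz h1 hγ
      _ = γ ^ γ * Real.exp z := by
        rw [Real.mul_rpow h.le (Real.exp_pos _).le, ← Real.exp_mul]
        congr 2
        field_simp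

/-- Negative powers of the logarithm are bounded by their value at 2; positive ones are absorbed by
`z^γ ≤ C e^z` at `z = s log x`. The point is that `C` is independent of `s`: the explicit blow-up
`s^(-max β 0)` drives the later smallness estimates. -/
lemma exists_log_rpow_le (β : ℝ) : ∃ C : ℝ, 0 < C ∧ ∀ s : ℝ, 0 < s → ∀ x : ℝ, 2 ≤ x →
    Real.log x ^ β ≤ C * s ^ (-max β 0) * x ^ s := by
  obtain ⟨C, hC, h⟩ := exists_rpow_le_mul_exp (le_max_right β 0)
  have hl2 : 0 < Real.log 2 := Real.log_pos (by norm_num)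
  refine ⟨C * Real.log 2 ^ (β - max β 0), by positivity, fun s hs x hx => ?_⟩
  have hl := log_pos_of_two_le hx
  have h1 : Real.log x ^ (β - max β 0) ≤ Real.log 2 ^ (β - max β 0) :=
    Real.rpow_le_rpow_of_nonpos hl2 (Real.log_le_log (by norm_num) hx)
      (by linarith [le_max_left β 0])
  have h2 : Real.log x ^ (max β 0) ≤ C * s ^ (-max β 0) * x ^ s := by
    have := h (s * Real.log x) (by positivity)
    rw [Real.mul_rpow hs.le hl.le, mul_comm s, Real.exp_mul, Real.exp_log (by linarith)] at this
    rw [Real.rpow_neg hs.le]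
    have hp : 0 < s ^ max β 0 := by positivity
    field_simp
    linarith
  calc Real.log x ^ β = Real.log x ^ (max β 0) * Real.log x ^ (β - max β 0) := by
        rw [← Real.rpow_add hl]; ring_nf
    _ ≤ (C * s ^ (-max β 0) * x ^ s) * Real.log 2 ^ (β - max β 0) := by gcongr
    _ = _ := by ring

lemma exists_dirichletWeight_le (β : ℝ) : ∃ C : ℝ, 0 < C ∧ ∀ s : ℝ, 0 < s → ∀ (z : ℝ) (k : ℕ),
    dirichletWeight β z k ≤ C * s ^ (-max β 0) * ((k : ℝ) ^ (z - s))⁻¹ := by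
  obtain ⟨C, hC, h⟩ := exists_log_rpow_le β
  refine ⟨C, hC, fun s hs z k => ?_⟩
  unfold dirichletWeight
  split_ifs with hk
  · have h2 := two_le_natCast hk
    have := h s hs k h2
    rw [Real.rpow_sub (by linarith), div_le_iff₀ (by positivity)]
    have hz : (k : ℝ) ^ z ≠ 0 := by positivity
    rwa [inv_div, mul_assoc, div_mul_cancel₀ _ hz]
  · positivity

lemma summable_dirichletWeight (β : ℝ) {z : ℝ} (hz : 1 < z) : Summable (dirichletWeight β z) := by
  obtain ⟨C, hC, h⟩ := exists_dirichletWeight_le β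
  refine Summable.of_nonneg_of_le (dirichletWeight_nonneg β z)
    (fun k => h ((z - 1) / 2) (by linarith) z k) ?_
  apply Summable.mul_left
  exact Real.summable_nat_rpow_inv.2 (by linarith)

/-- The logarithmic factor costs at most `x^(1/2)` against `x^(-2)`, which leaves a summable
derivative bound uniform in `s ∈ (0, 1]`. -/
lemma exists_abs_deriv_log_rpow_mul_rpow_le (β : ℝ) : ∃ C : ℝ, 0 < C ∧
    ∀ s : ℝ, 0 < s → s ≤ 1 → ∀ x : ℝ, 2 ≤ x → ∃ d : ℝ,
      HasDerivAt (fun x : ℝ => Real.log x ^ β * x ^ (-(1 + s))) d x ∧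
      |d| ≤ C * x ^ (-(3 / 2) : ℝ) := by
  obtain ⟨C, hC, h⟩ := exists_log_rpow_le β
  have hl2 : 0 < Real.log 2 := Real.log_pos (by norm_num)
  set C' := C * (1 / 2 : ℝ) ^ (-max β 0) with hC'
  refine ⟨C' * (|β| / Real.log 2 + 2), by positivity, fun s hs hs1 x hx => ?_⟩
  have hx0 : 0 < x := by linarith
  have hl := log_pos_of_two_le hx
  have hd := ((Real.hasDerivAt_log hx0.ne').rpow_const (p := β) (Or.inl hl.ne')).mul
    (Real.hasDerivAt_rpow_const (x := x) (p := -(1 + s)) (Or.inl hx0.ne'))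
  refine ⟨_, hd, ?_⟩
  have e : x⁻¹ * β * Real.log x ^ (β - 1) * x ^ (-(1 + s)) +
      Real.log x ^ β * (-(1 + s) * x ^ (-(1 + s) - 1)) =
      Real.log x ^ β * x ^ (-(1 + s) - 1) * (β / Real.log x - (1 + s)) := by
    rw [Real.rpow_sub hl, Real.rpow_one, Real.rpow_sub hx0, Real.rpow_one]
    field_simp
    ring
  rw [e, abs_mul, abs_of_nonneg (by positivity)]
  have h1 : |β / Real.log x - (1 + s)| ≤ |β| / Real.log 2 + 2 := by
    calc |β / Real.log x - (1 + s)| ≤ |β / Real.log x| + |1 + s| := abs_sub _ _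
      _ ≤ |β| / Real.log 2 + 2 := by
        rw [abs_div, abs_of_pos hl, abs_of_pos (by linarith : 0 < 1 + s)]
        have := Real.log_le_log (by norm_num) hx
        gcongr
        linarith
  have h2 : Real.log x ^ β * x ^ (-(1 + s) - 1) ≤ C' * x ^ (-(3 / 2) : ℝ) := by
    calc Real.log x ^ β * x ^ (-(1 + s) - 1) ≤ (C' * x ^ (1 / 2 : ℝ)) * x ^ (-2 : ℝ) := by
          gcongr
          · exact h (1 / 2) (by norm_num) x hx
          · linarith
          · linarith
      _ = C' * x ^ (-(3 / 2) : ℝ) := by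
          rw [mul_assoc, ← Real.rpow_add hx0]; norm_num
  calc _ ≤ (C' * x ^ (-(3 / 2) : ℝ)) * (|β| / Real.log 2 + 2) := by gcongr
    _ = _ := by ring

lemma intervalIntegrable_rpow_mul_exp {β : ℝ} (hβ : -1 < β) (s a b : ℝ) :
    IntervalIntegrable (fun y : ℝ => y ^ β * Real.exp (-(s * y))) volume a b :=
  (intervalIntegral.intervalIntegrable_rpow' hβ).mul_continuousOn (by fun_prop)

/-- The substitution `y = log x` turns the summand into a Gamma integrand and so gives an explicit
primitive. -/
lemma hasDerivAt_integral_rpow_mul_exp_comp_log {β : ℝ} (hβ : -1 < β) (s : ℝ) {x : ℝ}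
    (hx : 1 < x) :
    HasDerivAt (fun x : ℝ => ∫ y in (0 : ℝ)..Real.log x, y ^ β * Real.exp (-(s * y)))
      (Real.log x ^ β * x ^ (-(1 + s))) x := by
  have hl : 0 < Real.log x := Real.log_pos hx
  have hx0 : 0 < x := by linarith
  have hc : ∀ y : ℝ, 0 < y → ContinuousAt (fun y : ℝ => y ^ β * Real.exp (-(s * y))) y := by
    intro y hy
    exact (Real.continuousAt_rpow_const _ _ (Or.inl hy.ne')).mul (by fun_prop)
  have h1 := intervalIntegral.integral_hasDerivAt_right
    (intervalIntegrable_rpow_mul_exp hβ s 0 (Real.log x))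
    (ContinuousAt.stronglyMeasurableAtFilter (s := Set.Ioi 0) isOpen_Ioi hc _ hl) (hc _ hl)
  have h2 := h1.comp x (Real.hasDerivAt_log hx0.ne')
  have e : Real.log x ^ β * x ^ (-(1 + s)) =
      Real.log x ^ β * Real.exp (-(s * Real.log x)) * x⁻¹ := by
    rw [Real.rpow_neg hx0.le, Real.rpow_add hx0, Real.rpow_one, Real.exp_neg, mul_comm s,
      Real.exp_mul, Real.exp_log hx0]
    field_simp
  rw [e]
  exact h2

lemma tendsto_integral_rpow_mul_exp {β : ℝ} (hβ : -1 < β) {s : ℝ} (hs : 0 < s) :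
    Tendsto (fun N : ℕ => ∫ y in (0 : ℝ)..Real.log N, y ^ β * Real.exp (-(s * y))) atTop
      (𝓝 (Real.Gamma (1 + β) * s ^ (-(1 + β)))) := by
  have h1 := Real.integral_rpow_mul_exp_neg_mul_Ioi (a := 1 + β) (r := s) (by linarith) hs
  have hi : IntegrableOn (fun y : ℝ => y ^ β * Real.exp (-(s * y))) (Set.Ioi 0) := by
    -- A non-integrable function would have integral 0, against positivity of the Gamma value.
    by_contra hcon
    rw [show 1 + β - 1 = β by ring, integral_undef hcon] at h1
    have : 0 < (1 / s) ^ (1 + β) * Real.Gamma (1 + β) :=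
      mul_pos (by positivity) (Real.Gamma_pos_of_pos (by linarith))
    linarith
  have h2 := intervalIntegral_tendsto_integral_Ioi 0 hi
    (Real.tendsto_log_atTop.comp tendsto_natCast_atTop_atTop)
  rw [show 1 + β - 1 = β by ring] at h1
  rw [h1] at h2
  rw [mul_comm, one_div, Real.inv_rpow hs.le, ← Real.rpow_neg hs.le] at h2
  exact h2

/-- Two mean value arguments: the increment of `G` is `h ξ` for some `ξ`, and `h` varies by at most
`D` over the unit interval. -/
lemma abs_sub_le_of_deriv_deriv_le {G h : ℝ → ℝ} {a D : ℝ}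
    (hG : ∀ x ∈ Set.Icc a (a + 1), HasDerivAt G (h x) x)
    (hh : ∀ x ∈ Set.Icc a (a + 1), ∃ d, HasDerivAt h d x ∧ |d| ≤ D) :
    |h a - (G (a + 1) - G a)| ≤ D := by
  obtain ⟨ξ, hξ, e⟩ := exists_hasDerivAt_eq_slope G h (by linarith : a < a + 1)
    (fun x hx => (hG x hx).continuousAt.continuousWithinAt)
    (fun x hx => hG x (Set.Ioo_subset_Icc_self hx))
  rw [show a + 1 - a = 1 by ring, div_one] at e
  rw [← e]
  have hD : 0 ≤ D := by
    obtain ⟨d, -, hd⟩ := hh a ⟨le_rfl, by linarith⟩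
    exact (abs_nonneg _).trans hd
  have := Convex.norm_image_sub_le_of_norm_deriv_le (f := h) (C := D) (s := Set.Icc a (a + 1))
    (x := ξ) (y := a)
    (fun x hx => (hh x hx).choose_spec.1.differentiableAt)
    (fun x hx => by
      rw [(hh x hx).choose_spec.1.deriv]; exact (hh x hx).choose_spec.2)
    (convex_Icc _ _) (Set.Ioo_subset_Icc_self hξ) ⟨le_rfl, by linarith⟩
  rw [Real.norm_eq_abs, Real.norm_eq_abs] at this
  refine this.trans ?_
  have : |a - ξ| ≤ 1 := by rw [abs_le]; constructor <;> linarith [hξ.1, hξ.2]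
  nlinarith

/-- Sum and integral differ termwise by `O(k^(-3/2))`, uniformly in `s`. The integral over `(0, log
2)`, which no term of the sum matches, is at most `∫ y^β`, finite because `β > -1`. -/
lemma exists_abs_tsum_dirichletWeight_sub_le {β : ℝ} (hβ : -1 < β) :
    ∃ C : ℝ, 0 < C ∧ ∀ s : ℝ, 0 < s → s ≤ 1 →
      |∑' k, dirichletWeight β (1 + s) k - Real.Gamma (1 + β) * s ^ (-(1 + β))| ≤ C := by
  obtain ⟨D, hD, hder⟩ := exists_abs_deriv_log_rpow_mul_rpow_le β
  have hl2 : 0 < Real.log 2 := Real.log_pos (by norm_num)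
  have hsum : Summable fun k : ℕ => ((k : ℝ) ^ (3 / 2 : ℝ))⁻¹ :=
    Real.summable_nat_rpow_inv.2 (by norm_num)
  set T := ∑' k : ℕ, ((k : ℝ) ^ (3 / 2 : ℝ))⁻¹
  set G0 := ∫ y in (0 : ℝ)..Real.log 2, y ^ β
  have hG0 : 0 ≤ G0 := intervalIntegral.integral_nonneg hl2.le fun y hy => by
    have := hy.1; positivity
  have hT : 0 ≤ T := tsum_nonneg fun k => by positivity
  refine ⟨D * T + G0 + 1, by positivity, fun s hs hs1 => ?_⟩
  set G : ℝ → ℝ := fun x => ∫ y in (0 : ℝ)..Real.log x, y ^ β * Real.exp (-(s * y)) with hG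
  have hG2 : |G 2| ≤ G0 := by
    rw [abs_of_nonneg]
    · apply intervalIntegral.integral_mono_on hl2.le (intervalIntegrable_rpow_mul_exp hβ s _ _)
        (intervalIntegral.intervalIntegrable_rpow' hβ)
      intro y hy
      have h0 : 0 ≤ y := hy.1
      have : Real.exp (-(s * y)) ≤ 1 := Real.exp_le_one_iff.2 (by nlinarith)
      exact mul_le_of_le_one_right (by positivity) this
    · exact intervalIntegral.integral_nonneg hl2.le fun y hy => by
        have := hy.1; positivity
  -- Increments of the primitive, switched off below 2 like the weights, so that they telescope from
  -- 2.
  set d : ℕ → ℝ := fun k => if 2 ≤ k then G ((k : ℝ) + 1) - G k else 0 with hd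
  have hdsum : ∀ N, 2 ≤ N → ∑ k ∈ Finset.range N, d k = G N - G 2 := by
    intro N hN
    induction N, hN using Nat.le_induction with
    | base => simp [hd, Finset.sum_range_succ]
    | succ n hn ih =>
      rw [Finset.sum_range_succ, ih, hd]
      simp only [hn, if_true]
      push_cast
      ring
  have hterm : ∀ k : ℕ, |dirichletWeight β (1 + s) k - d k| ≤ D * ((k : ℝ) ^ (3 / 2 : ℝ))⁻¹ := by
    intro k
    by_cases hk : 2 ≤ k
    · have h2 := two_le_natCast hk
      have := abs_sub_le_of_deriv_deriv_le (a := (k : ℝ)) (G := G)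
        (h := fun x : ℝ => Real.log x ^ β * x ^ (-(1 + s))) (D := D * ((k : ℝ) ^ (3 / 2 : ℝ))⁻¹)
        (fun x hx => hasDerivAt_integral_rpow_mul_exp_comp_log hβ s (by linarith [hx.1]))
        (fun x hx => by
          obtain ⟨e, he, he'⟩ := hder s hs hs1 x (by linarith [hx.1])
          refine ⟨e, he, he'.trans ?_⟩
          rw [← Real.rpow_neg (by linarith)]
          have := Real.rpow_le_rpow_of_nonpos (by linarith : (0 : ℝ) < k) hx.1
            (by norm_num : (-(3 / 2) : ℝ) ≤ 0)
          gcongr)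
      simp only [dirichletWeight, hd, hk, if_true]
      rwa [div_eq_mul_inv, ← Real.rpow_neg (by linarith)]
    · simp only [dirichletWeight, hd, hk, if_false]
      simp only [sub_zero, abs_zero]
      positivity
  have hbd : ∀ N : ℕ, 2 ≤ N →
      |∑ k ∈ Finset.range N, dirichletWeight β (1 + s) k - G N| ≤ D * T + G0 := by
    intro N hN
    have e : ∑ k ∈ Finset.range N, dirichletWeight β (1 + s) k - G N =
        ∑ k ∈ Finset.range N, (dirichletWeight β (1 + s) k - d k) - G 2 := by
      rw [Finset.sum_sub_distrib, hdsum N hN]; ring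
    rw [e]
    refine (abs_sub _ _).trans (add_le_add ?_ hG2)
    refine (Finset.abs_sum_le_sum_abs _ _).trans ((Finset.sum_le_sum fun k _ => hterm k).trans ?_)
    rw [← Finset.mul_sum]
    gcongr
    exact hsum.sum_le_tsum _ fun k _ => by positivity
  have hlim := ((summable_dirichletWeight β (by linarith : 1 < 1 + s)).hasSum.tendsto_sum_nat.sub
    (tendsto_integral_rpow_mul_exp hβ hs)).abs
  refine (le_of_tendsto hlim ?_).trans (by linarith : D * T + G0 ≤ D * T + G0 + 1)
  filter_upwards [eventually_ge_atTop 2] with N hN using hbd N hN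

lemma tendsto_rpow_nhdsGT_zero {c : ℝ} (hc : 0 < c) :
    Tendsto (fun s : ℝ => s ^ c) (𝓝[>] 0) (𝓝 0) := by
  have := (Real.continuousAt_rpow_const 0 c (Or.inr hc.le)).tendsto
  rw [Real.zero_rpow hc.ne'] at this
  exact this.mono_left nhdsWithin_le_nhds

lemma tendsto_rpow_mul_tsum_dirichletWeight {β : ℝ} (hβ : -1 < β) :
    Tendsto (fun s : ℝ => s ^ (1 + β) * ∑' k, dirichletWeight β (1 + s) k) (𝓝[>] 0)
      (𝓝 (Real.Gamma (1 + β))) := by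
  obtain ⟨C, hC, h⟩ := exists_abs_tsum_dirichletWeight_sub_le hβ
  have h0 := (tendsto_rpow_nhdsGT_zero (by linarith : 0 < 1 + β)).mul_const C
  rw [zero_mul] at h0
  rw [← tendsto_sub_nhds_zero_iff]
  refine squeeze_zero_norm' ?_ h0
  filter_upwards [Ioc_mem_nhdsGT (zero_lt_one' ℝ)] with s hs
  have hp : 0 < s ^ (1 + β) := Real.rpow_pos_of_pos hs.1 _
  have e : s ^ (1 + β) * ∑' k, dirichletWeight β (1 + s) k - Real.Gamma (1 + β) =
      s ^ (1 + β) * (∑' k, dirichletWeight β (1 + s) k - Real.Gamma (1 + β) * s ^ (-(1 + β))) := by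
    rw [Real.rpow_neg hs.1.le]
    field_simp
  rw [e, norm_mul, Real.norm_eq_abs, Real.norm_eq_abs, abs_of_pos hp]
  gcongr
  exact h s hs.1 hs.2

lemma exists_tsum_dirichletWeight_le {β : ℝ} (hβ : -1 < β) :
    ∃ C : ℝ, 0 < C ∧ ∀ s : ℝ, 0 < s → s ≤ 1 →
      ∑' k, dirichletWeight β (1 + s) k ≤ C * s ^ (-(1 + β)) := by
  obtain ⟨C, hC, h⟩ := exists_abs_tsum_dirichletWeight_sub_le hβ
  refine ⟨C + Real.Gamma (1 + β), add_pos hC (Real.Gamma_pos_of_pos (by linarith)),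
    fun s hs hs1 => ?_⟩
  have h1 := (abs_le.1 (h s hs hs1)).2
  have h2 : 1 ≤ s ^ (-(1 + β)) := Real.one_le_rpow_of_pos_of_le_one_of_nonpos hs hs1 (by linarith)
  nlinarith

/-! ### Moment generating functions of bounded centred variables -/

/-- The cubic Taylor remainder is absorbed into the quadratic term through `|y|³ ≤ M y²`. -/
lemma abs_exp_sub_quadratic_le {M y : ℝ} (hM : M ≤ 1) (hy : |y| ≤ M) :
    |Real.exp y - (1 + y + y ^ 2 / 2)| ≤ M / 2 * y ^ 2 := by
  have h := Real.exp_bound (x := y) (hy.trans hM) (n := 3) (by norm_num)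
  simp only [Finset.sum_range_succ, Finset.sum_range_zero, Nat.factorial] at h
  norm_num at h
  have e : |y| ^ 3 = |y| * y ^ 2 := by rw [pow_succ, sq_abs]; ring
  rw [e] at h
  have : |y| * y ^ 2 ≤ M * y ^ 2 := by gcongr
  refine h.trans ?_
  linarith [mul_nonneg ((abs_nonneg y).trans hy) (sq_nonneg y)]

section BoundedNoise

set_option linter.unusedSectionVars false

variable {Ω : Type*} [MeasurableSpace Ω] {P : Measure Ω} [IsProbabilityMeasure P]

lemma integrable_of_measurable_of_abs_le {Y : Ω → ℝ} (hY : Measurable Y) {M : ℝ}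
    (hb : ∀ ω, |Y ω| ≤ M) : Integrable Y P :=
  Integrable.of_bound hY.aestronglyMeasurable M (ae_of_all _ hb)

lemma integrable_sq_of_abs_le {Y : Ω → ℝ} (hY : Measurable Y) {M : ℝ}
    (hb : ∀ ω, |Y ω| ≤ M) : Integrable (fun ω => Y ω ^ 2) P :=
  integrable_of_measurable_of_abs_le (M := M ^ 2) (by fun_prop) fun ω => by
    rw [abs_pow]
    have := hb ω
    gcongr

lemma integrable_exp_of_abs_le {Y : Ω → ℝ} (hY : Measurable Y) {M : ℝ}
    (hb : ∀ ω, |Y ω| ≤ M) : Integrable (fun ω => Real.exp (Y ω)) P :=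
  integrable_of_measurable_of_abs_le (M := Real.exp M) (by fun_prop) fun ω => by
    rw [Real.abs_exp]
    exact Real.exp_le_exp.2 ((le_abs_self _).trans (hb ω))

lemma integral_one_add_add_mul_sq {Y : Ω → ℝ} (hY : Measurable Y) {M : ℝ}
    (hb : ∀ ω, |Y ω| ≤ M) (h0 : ∫ ω, Y ω ∂P = 0) (a : ℝ) :
    Integrable (fun ω => 1 + Y ω + a * Y ω ^ 2) P ∧
      ∫ ω, (1 + Y ω + a * Y ω ^ 2) ∂P = 1 + a * ∫ ω, Y ω ^ 2 ∂P := by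
  have i1 := integrable_of_measurable_of_abs_le (P := P) hY hb
  have i2 := integrable_sq_of_abs_le (P := P) hY hb
  have i3 : Integrable (fun ω => 1 + Y ω) P := (integrable_const _).add i1
  refine ⟨i3.add (i2.const_mul _), ?_⟩
  rw [integral_add i3 (i2.const_mul _), integral_add (integrable_const _) i1, h0,
    integral_const_mul]
  simp

lemma integral_exp_le_of_centered {Y : Ω → ℝ} (hY : Measurable Y) {M : ℝ} (hM : M ≤ 1)
    (hb : ∀ ω, |Y ω| ≤ M) (h0 : ∫ ω, Y ω ∂P = 0) :
    ∫ ω, Real.exp (Y ω) ∂P ≤ Real.exp ((1 + M) / 2 * ∫ ω, Y ω ^ 2 ∂P) := by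
  calc ∫ ω, Real.exp (Y ω) ∂P ≤ ∫ ω, (1 + Y ω + (1 + M) / 2 * Y ω ^ 2) ∂P := by
        apply integral_mono (integrable_exp_of_abs_le hY hb)
        · exact (integral_one_add_add_mul_sq hY hb h0 _).1
        · intro ω
          have := (abs_le.1 (abs_exp_sub_quadratic_le hM (hb ω))).2
          simp only
          linarith
    _ = 1 + (1 + M) / 2 * ∫ ω, Y ω ^ 2 ∂P := by
        exact (integral_one_add_add_mul_sq hY hb h0 _).2
    _ ≤ _ := by
        have := Real.add_one_le_exp ((1 + M) / 2 * ∫ ω, Y ω ^ 2 ∂P)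
        linarith

/-- With `z = (1 - M) V / 2`, the quadratic lower bound gives a mean of at least `1 + z`. Returning
to an exponential uses `log (1 + z) ≥ z / (1 + z) ≥ (1 - M) z`, valid since `z ≤ M`. -/
lemma le_integral_exp_of_centered {Y : Ω → ℝ} (hY : Measurable Y) {M : ℝ} (hM : M ≤ 1)
    (hb : ∀ ω, |Y ω| ≤ M) (h0 : ∫ ω, Y ω ∂P = 0) :
    Real.exp ((1 - M) ^ 2 / 2 * ∫ ω, Y ω ^ 2 ∂P) ≤ ∫ ω, Real.exp (Y ω) ∂P := by
  have i2 := integrable_sq_of_abs_le (P := P) hY hb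
  have hM0 : 0 ≤ M := by
    obtain ⟨ω⟩ : Nonempty Ω := nonempty_of_isProbabilityMeasure P
    exact (abs_nonneg _).trans (hb ω)
  set V := ∫ ω, Y ω ^ 2 ∂P
  have hV0 : 0 ≤ V := integral_nonneg fun ω => sq_nonneg _
  have hV1 : V ≤ M := by
    calc V ≤ ∫ ω, M ∂P := by
          apply integral_mono i2 (integrable_const _)
          intro ω
          have := hb ω
          have h2 : |Y ω| ^ 2 ≤ M ^ 2 := by gcongr
          rw [sq_abs] at h2
          simp only
          nlinarith
      _ = M := by simp
  have hz0 : 0 ≤ (1 - M) / 2 * V := mul_nonneg (by linarith) hV0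
  have hz1 : (1 - M) / 2 * V ≤ M := by nlinarith
  set z := (1 - M) / 2 * V with hz
  calc Real.exp ((1 - M) ^ 2 / 2 * V) ≤ 1 + z := by
        rw [← Real.le_log_iff_exp_le (by linarith)]
        refine le_trans ?_ (Real.one_sub_inv_le_log_of_pos (by linarith))
        have : 1 - (1 + z)⁻¹ = z / (1 + z) := by field_simp; ring
        rw [this, le_div_iff₀ (by linarith)]
        have : (1 - M) ^ 2 / 2 * V = (1 - M) * z := by rw [hz]; ring
        rw [this]
        nlinarith [mul_nonneg hM0 hz0, mul_nonneg hz0 hz0]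
    _ = ∫ ω, (1 + Y ω + (1 - M) / 2 * Y ω ^ 2) ∂P := by
        exact (integral_one_add_add_mul_sq hY hb h0 _).2.symm
    _ ≤ _ := by
        apply integral_mono _ (integrable_exp_of_abs_le hY hb)
        · intro ω
          have := (abs_le.1 (abs_exp_sub_quadratic_le hM (hb ω))).1
          simp only
          linarith
        · exact (integral_one_add_add_mul_sq hY hb h0 _).1

/-- Independent centred random variables with `|X k| ≤ 2 √k` and variances bounded by `v`. -/
structure IsBoundedNoise (X : ℕ → Ω → ℝ) (P : Measure Ω) (v : ℝ) : Prop where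
  indep : iIndepFun X P
  meas : ∀ k, Measurable (X k)
  bdd : ∀ k ω, |X k ω| ≤ 2 * √(k : ℝ)
  mean : ∀ k, ∫ ω, X k ω ∂P = 0
  var_le : ∀ k, ∫ ω, X k ω ^ 2 ∂P ≤ v

namespace IsBoundedNoise

variable {X : ℕ → Ω → ℝ} {v : ℝ}

lemma neg (h : IsBoundedNoise X P v) : IsBoundedNoise (fun k ω => -X k ω) P v where
  indep := h.indep.comp (fun _ x => -x) fun _ => measurable_neg
  meas k := (h.meas k).neg
  bdd k ω := by rw [abs_neg]; exact h.bdd k ω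
  mean k := by rw [integral_neg, h.mean, neg_zero]
  var_le k := by simpa using h.var_le k

lemma integral_exp_sum (h : IsBoundedNoise X P v) (c : ℕ → ℝ) (S : Finset ℕ) :
    ∫ ω, Real.exp (∑ k ∈ S, c k * X k ω) ∂P = ∏ k ∈ S, ∫ ω, Real.exp (c k * X k ω) ∂P := by
  have h1 : iIndepFun (fun k ω => c k * X k ω) P :=
    h.indep.comp (fun k x => c k * x) fun _ => measurable_const_mul _
  have := h1.mgf_sum (t := 1) (fun k => (h.meas k).const_mul _) S
  simpa [mgf, Finset.sum_apply] using this

lemma integral_exp_sum_le (h : IsBoundedNoise X P v) {c : ℕ → ℝ} {M : ℝ} (hM : M ≤ 1)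
    (hc : ∀ k, |c k| * (2 * √(k : ℝ)) ≤ M) (S : Finset ℕ) :
    ∫ ω, Real.exp (∑ k ∈ S, c k * X k ω) ∂P ≤
      Real.exp ((1 + M) / 2 * (v * ∑ k ∈ S, c k ^ 2)) := by
  have hM0 : 0 ≤ M := le_trans (by positivity) (hc 0)
  rw [h.integral_exp_sum, Finset.mul_sum, Finset.mul_sum, Real.exp_sum]
  apply Finset.prod_le_prod
  · intro k _
    exact integral_nonneg fun ω => (Real.exp_pos _).le
  · intro k _
    refine (integral_exp_le_of_centered ((h.meas k).const_mul _) hM (fun ω => ?_) ?_).trans ?_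
    · rw [abs_mul]
      exact le_trans (by gcongr; exact h.bdd k ω) (hc k)
    · rw [integral_const_mul, h.mean, mul_zero]
    · apply Real.exp_le_exp.2
      simp only [mul_pow]
      rw [integral_const_mul]
      have := h.var_le k
      rw [mul_comm v]
      gcongr

lemma le_integral_exp_sum (h : IsBoundedNoise X P v) {c : ℕ → ℝ} {M : ℝ} (hM : M ≤ 1)
    (hc : ∀ k, |c k| * (2 * √(k : ℝ)) ≤ M) (S : Finset ℕ) :
    Real.exp ((1 - M) ^ 2 / 2 * ∑ k ∈ S, c k ^ 2 * ∫ ω, X k ω ^ 2 ∂P) ≤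
      ∫ ω, Real.exp (∑ k ∈ S, c k * X k ω) ∂P := by
  rw [h.integral_exp_sum, Finset.mul_sum, Real.exp_sum]
  apply Finset.prod_le_prod
  · intro k _
    positivity
  · intro k _
    refine le_trans ?_ (le_integral_exp_of_centered ((h.meas k).const_mul _) hM (fun ω => ?_) ?_)
    · apply Real.exp_le_exp.2
      simp only [mul_pow]
      rw [integral_const_mul]
    · rw [abs_mul]
      exact le_trans (by gcongr; exact h.bdd k ω) (hc k)
    · rw [integral_const_mul, h.mean, mul_zero]

end IsBoundedNoise

/-- The partial sums form a martingale bounded in `L²` by orthogonality, hence in `L¹` through `|S|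
≤ 1 + S²`, and such a martingale converges almost surely. -/
lemma ae_exists_tendsto_sum_mul {X : ℕ → Ω → ℝ} (hi : iIndepFun X P)
    (hm : ∀ k, Measurable (X k)) (h2 : ∀ k, MemLp (X k) 2 P) (h0 : ∀ k, ∫ ω, X k ω ∂P = 0)
    {v : ℝ} (hv : ∀ k, ∫ ω, X k ω ^ 2 ∂P ≤ v) {c : ℕ → ℝ} (hc : Summable fun k => c k ^ 2) :
    ∀ᵐ ω ∂P, ∃ l : ℝ, Tendsto (fun N => ∑ k ∈ Finset.range N, c k * X k ω) atTop (𝓝 l) := by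
  set S : ℕ → Ω → ℝ := fun n => ∑ k ∈ Finset.range (n + 1), fun ω => c k * X k ω with hS
  have hsm : ∀ k, StronglyMeasurable (X k) := fun k => (hm k).stronglyMeasurable
  set ℱ := Filtration.natural X hsm
  have hL : ∀ k, MemLp (fun ω => c k * X k ω) 2 P := fun k => (h2 k).const_mul _
  have hSL : ∀ n, MemLp (S n) 2 P := fun n => memLp_finsetSum' _ fun k _ => hL k
  have had : StronglyAdapted ℱ S := by
    intro n
    apply Finset.stronglyMeasurable_sum
    intro k hk
    have hk' : k ≤ n := by simpa [Nat.lt_succ_iff] using hk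
    exact ((Filtration.stronglyAdapted_natural hsm k).mono (ℱ.mono hk')).const_mul _
  have hSi : ∀ n, Integrable (S n) P := fun n => (hSL n).integrable one_le_two
  have hmart : Martingale S ℱ P := by
    refine martingale_nat had hSi fun n => ?_
    have e : S (n + 1) = S n + fun ω => c (n + 1) * X (n + 1) ω := by
      simp only [hS]
      rw [Finset.sum_range_succ _ (n + 1)]
    rw [e]
    have h1 := condExp_add (m := ℱ n) (hSi n) ((hL (n + 1)).integrable one_le_two)
    have h3 : P[fun ω => c (n + 1) * X (n + 1) ω | ℱ n] =ᵐ[P] 0 := by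
      have h4 := condExp_smul (μ := P) (c (n + 1)) (X (n + 1)) (ℱ n)
      have h5 := hi.condExp_natural_ae_eq_of_lt hsm (Nat.lt_succ_self n)
      have e2 : (fun ω => c (n + 1) * X (n + 1) ω) = c (n + 1) • X (n + 1) := rfl
      rw [e2]
      filter_upwards [h4, h5] with ω w4 w5
      rw [w4, Pi.smul_apply, w5, h0]
      simp
    filter_upwards [h1, h3] with ω w1 w3
    rw [w1, Pi.add_apply, w3, condExp_of_stronglyMeasurable (ℱ.le n) (had n) (hSi n)]
    simp
  have hvar : ∀ n, ∫ ω, S n ω ^ 2 ∂P ≤ v * ∑' k, c k ^ 2 := by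
    intro n
    have hz : ∫ ω, S n ω ∂P = 0 := by
      simp only [hS, Finset.sum_apply]
      rw [integral_finsetSum _ fun k _ => (hL k).integrable one_le_two]
      simp [integral_const_mul, h0]
    have h1 := IndepFun.variance_sum (μ := P) (X := fun k ω => c k * X k ω)
      (s := Finset.range (n + 1)) (fun k _ => hL k) (fun i _ j _ hij =>
        (hi.indepFun hij).comp (measurable_const_mul (c i)) (measurable_const_mul (c j)))
    rw [variance_of_integral_eq_zero (hSL n).aemeasurable hz] at h1
    rw [h1, ← tsum_mul_left]
    refine le_trans (Finset.sum_le_sum (g := fun k => v * c k ^ 2) fun k _ => ?_)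
      ((hc.mul_left v).sum_le_tsum _ fun k _ => mul_nonneg ?_ (sq_nonneg _))
    · rw [variance_of_integral_eq_zero (hL k).aemeasurable (by rw [integral_const_mul, h0, mul_zero])]
      simp only [mul_pow]
      rw [integral_const_mul, mul_comm]
      have := hv k
      gcongr
    · exact (integral_nonneg fun ω => sq_nonneg (X k ω)).trans (hv k)
  have hbd : ∀ n, eLpNorm (S n) 1 P ≤ ((1 + v * ∑' k, c k ^ 2).toNNReal : ENNReal) := by
    intro n
    rw [eLpNorm_one_eq_lintegral_enorm]
    have hi2 : Integrable (fun ω => S n ω ^ 2) P :=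
      (memLp_two_iff_integrable_sq (hSL n).aestronglyMeasurable).1 (hSL n)
    rw [← ofReal_integral_norm_eq_lintegral_enorm (hSi n)]
    apply ENNReal.ofReal_le_ofReal
    calc ∫ ω, ‖S n ω‖ ∂P ≤ ∫ ω, (1 + S n ω ^ 2) ∂P := by
          apply integral_mono (hSi n).norm ((integrable_const _).add hi2)
          intro ω
          change |S n ω| ≤ 1 + S n ω ^ 2
          nlinarith [sq_abs (S n ω), sq_nonneg (|S n ω| - 1)]
      _ ≤ _ := by
          rw [integral_add (integrable_const _) hi2]
          simpa using hvar n
  filter_upwards [hmart.submartingale.exists_ae_tendsto_of_bdd hbd] with ω hω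
  obtain ⟨l, hl⟩ := hω
  refine ⟨l, (tendsto_add_atTop_iff_nat 1).1 ?_⟩
  simpa [hS, Finset.sum_apply] using hl

end BoundedNoise

/-! ### Abel summation and real-variable properties of the series -/

/-- After summation by parts the increments of `w` have constant sign, so their absolute values
telescope. -/
lemma abs_sum_antitone_mul_le {w y : ℕ → ℝ} {B : ℝ} (hw : Antitone w) (hw0 : ∀ k, 0 ≤ w k)
    (hB : ∀ N, |∑ k ∈ Finset.range N, y k| ≤ B) (N : ℕ) :
    |∑ k ∈ Finset.range N, w k * y k| ≤ w 0 * B := by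
  have hB0 : 0 ≤ B := (abs_nonneg _).trans (hB 0)
  have h := Finset.sum_range_by_parts w y N
  simp only [smul_eq_mul] at h
  rw [h]
  have h1 : |w (N - 1) * ∑ k ∈ Finset.range N, y k| ≤ w (N - 1) * B := by
    rw [abs_mul, abs_of_nonneg (hw0 _)]
    exact mul_le_mul_of_nonneg_left (hB N) (hw0 _)
  have h2 : |∑ i ∈ Finset.range (N - 1), (w (i + 1) - w i) * ∑ i ∈ Finset.range (i + 1), y i| ≤
      (w 0 - w (N - 1)) * B := by
    refine (Finset.abs_sum_le_sum_abs _ _).trans ?_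
    rw [← Finset.sum_range_sub', Finset.sum_mul]
    refine Finset.sum_le_sum fun i _ => ?_
    have : w (i + 1) ≤ w i := hw (Nat.le_succ i)
    rw [abs_mul, abs_of_nonpos (by linarith), neg_sub]
    exact mul_le_mul_of_nonneg_left (hB _) (by linarith)
  calc _ ≤ _ := abs_sub _ _
    _ ≤ w (N - 1) * B + (w 0 - w (N - 1)) * B := add_le_add h1 h2
    _ = w 0 * B := by ring

/-- The maximum with 1 only alters `k = 0`, where `0 ^ (-t) = 0` for `t ≠ 0` would break
monotonicity; the Dirichlet weights vanish there. -/
lemma antitone_max_one_rpow_neg {t : ℝ} (ht : 0 ≤ t) :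
    Antitone fun k : ℕ => (max (k : ℝ) 1) ^ (-t) := by
  intro a b hab
  apply Real.rpow_le_rpow_of_nonpos (by positivity) _ (by linarith)
  exact max_le_max_right _ (by exact_mod_cast hab)

lemma dirichletWeight_add (α z t : ℝ) (k : ℕ) :
    dirichletWeight α (z + t) k = (max (k : ℝ) 1) ^ (-t) * dirichletWeight α z k := by
  unfold dirichletWeight
  split_ifs with h
  · have h2 := two_le_natCast h
    rw [max_eq_left (by linarith), Real.rpow_add (by linarith), Real.rpow_neg (by linarith)]
    field_simp
  · simp

/-- The partial sum over `k < N`, in a form convenient for telescoping. -/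
noncomputable def weightedSum (α : ℝ) (x : ℕ → ℝ) (z : ℝ) (N : ℕ) : ℝ :=
  ∑ k ∈ Finset.range N, dirichletWeight α z k * x k

/-- Moving right multiplies the terms by a nonincreasing factor that starts at 1, so the same `B`
survives. -/
lemma abs_weightedSum_le {α : ℝ} {x : ℕ → ℝ} {z₀ B : ℝ} (hB : ∀ N, |weightedSum α x z₀ N| ≤ B)
    {z : ℝ} (hz : z₀ ≤ z) (N : ℕ) : |weightedSum α x z N| ≤ B := by
  have h := abs_sum_antitone_mul_le (antitone_max_one_rpow_neg (sub_nonneg.2 hz))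
    (fun k => by positivity) hB N
  have e : weightedSum α x z N = ∑ k ∈ Finset.range N, (max (k : ℝ) 1) ^ (-(z - z₀)) *
      (dirichletWeight α z₀ k * x k) := by
    unfold weightedSum
    refine Finset.sum_congr rfl fun k _ => ?_
    rw [← mul_assoc, ← dirichletWeight_add]
    ring_nf
  rw [e]
  simpa using h

/-- Dirichlet's test: moving strictly to the right supplies a monotone factor tending to 0. -/
lemma exists_tendsto_weightedSum {α : ℝ} {x : ℕ → ℝ} {z₀ B : ℝ}
    (hB : ∀ N, |weightedSum α x z₀ N| ≤ B) {z : ℝ} (hz : z₀ < z) :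
    ∃ l, Tendsto (weightedSum α x z) atTop (𝓝 l) := by
  have h0 : Tendsto (fun k : ℕ => (max (k : ℝ) 1) ^ (-(z - z₀))) atTop (𝓝 0) := by
    have h1 : Tendsto (fun k : ℕ => max (k : ℝ) 1) atTop atTop :=
      tendsto_atTop_mono (fun k => le_max_left _ _) tendsto_natCast_atTop_atTop
    exact (tendsto_rpow_neg_atTop (sub_pos.2 hz)).comp h1
  have h := (antitone_max_one_rpow_neg (sub_nonneg.2 hz.le)).cauchySeq_series_mul_of_tendsto_zero_of_bounded
    h0 (z := fun k => dirichletWeight α z₀ k * x k) (b := B) hB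
  have e : (weightedSum α x z) = fun N => ∑ k ∈ Finset.range N, (max (k : ℝ) 1) ^ (-(z - z₀)) •
      (dirichletWeight α z₀ k * x k) := by
    funext N
    unfold weightedSum
    refine Finset.sum_congr rfl fun k _ => ?_
    rw [smul_eq_mul, ← mul_assoc, ← dirichletWeight_add]
    ring_nf
  rw [e]
  exact cauchySeq_tendsto_of_complete h

lemma hasDerivAt_dirichletWeight (α z : ℝ) (k : ℕ) :
    HasDerivAt (fun z => dirichletWeight α z k) (-dirichletWeight (α + 1) z k) z := by
  unfold dirichletWeight
  split_ifs with h
  · have h2 := two_le_natCast h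
    have hl := log_pos_of_two_le h2
    have h0 : (0 : ℝ) < k := by linarith
    have h1 := ((hasDerivAt_neg z).const_rpow h0).const_mul (Real.log (k : ℝ) ^ α)
    have e : (fun z : ℝ => Real.log (k : ℝ) ^ α / (k : ℝ) ^ z) =
        fun z : ℝ => Real.log (k : ℝ) ^ α * (k : ℝ) ^ (-z) := by
      funext y
      rw [Real.rpow_neg h0.le, div_eq_mul_inv]
    rw [e]
    have e' : -(Real.log (k : ℝ) ^ (α + 1) / (k : ℝ) ^ z) =
        Real.log (k : ℝ) ^ α * (Real.log (k : ℝ) * -1 * (k : ℝ) ^ (-z)) := by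
      rw [Real.rpow_add hl, Real.rpow_one, Real.rpow_neg h0.le]
      ring
    rw [e']
    exact h1
  · simpa using hasDerivAt_const z (0 : ℝ)

/-- Differentiation in `z` raises the power of the logarithm by one, which is why the series with `α
+ 1` governs continuity and oscillation. -/
lemma hasDerivAt_weightedSum (α : ℝ) (x : ℕ → ℝ) (z : ℝ) (N : ℕ) :
    HasDerivAt (fun z => weightedSum α x z N) (-weightedSum (α + 1) x z N) z := by
  unfold weightedSum
  rw [← Finset.sum_neg_distrib]
  apply HasDerivAt.fun_sum
  intro k _
  simpa using (hasDerivAt_dirichletWeight α z k).mul_const (x k)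

lemma continuous_weightedSum (α : ℝ) (x : ℕ → ℝ) (N : ℕ) :
    Continuous fun z => weightedSum α x z N :=
  continuous_iff_continuousAt.2 fun z => (hasDerivAt_weightedSum α x z N).continuousAt

lemma dirichletPartialSum_eq_weightedSum (α : ℝ) (x : ℕ → ℝ) (z : ℝ) (N : ℕ) :
    dirichletPartialSum α x z N = weightedSum α x z (N + 1) :=
  dirichletPartialSum_eq_sum_range α x z N

/-- Boundedness of the partial sums, at all points of the half-line `z > 1 / 2`. -/
def BoundedSums (α : ℝ) (x : ℕ → ℝ) : Prop :=
  ∀ s : ℝ, 0 < s → ∃ B, ∀ N, |weightedSum α x (1 / 2 + s) N| ≤ B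

namespace BoundedSums

variable {α : ℝ} {x : ℕ → ℝ}

lemma tendsto_weightedSum (h : BoundedSums α x) {s : ℝ} (hs : 0 < s) :
    Tendsto (weightedSum α x (1 / 2 + s)) atTop (𝓝 (dirichletSeries α x (1 / 2 + s))) := by
  obtain ⟨B, hB⟩ := h (s / 2) (by linarith)
  obtain ⟨l, hl⟩ := exists_tendsto_weightedSum hB (z := 1 / 2 + s) (by linarith)
  have h1 : Tendsto (dirichletPartialSum α x (1 / 2 + s)) atTop (𝓝 l) := by
    have e : dirichletPartialSum α x (1 / 2 + s) = fun N => weightedSum α x (1 / 2 + s) (N + 1) :=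
      funext fun N => dirichletPartialSum_eq_weightedSum _ _ _ _
    rw [e]
    exact (tendsto_add_atTop_iff_nat 1).2 hl
  rw [dirichletSeries, h1.limUnder_eq]
  exact hl

lemma tendsto_dirichletPartialSum (h : BoundedSums α x) {s : ℝ} (hs : 0 < s) :
    Tendsto (dirichletPartialSum α x (1 / 2 + s)) atTop
      (𝓝 (dirichletSeries α x (1 / 2 + s))) := by
  have e : dirichletPartialSum α x (1 / 2 + s) = fun N => weightedSum α x (1 / 2 + s) (N + 1) :=
    funext fun N => dirichletPartialSum_eq_weightedSum _ _ _ _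
  rw [e]
  exact (tendsto_add_atTop_iff_nat 1).2 (h.tendsto_weightedSum hs)

/-- Bounded partial sums for `α + 1` give the partial sums for `α` a common Lipschitz constant on
`[s₁/2, ∞)`, which passes to the limit. -/
lemma continuousOn (h : BoundedSums α x) (h' : BoundedSums (α + 1) x) :
    ContinuousOn (fun s => dirichletSeries α x (1 / 2 + s)) (Set.Ioi 0) := by
  intro s₁ hs₁
  have hs₁' : (0 : ℝ) < s₁ := hs₁
  obtain ⟨B, hB⟩ := h' (s₁ / 2) (by linarith)
  have hLip : ∀ s ∈ Set.Ici (s₁ / 2), ∀ t ∈ Set.Ici (s₁ / 2),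
      |dirichletSeries α x (1 / 2 + s) - dirichletSeries α x (1 / 2 + t)| ≤ B * |s - t| := by
    intro s hs t ht
    have hs' : s₁ / 2 ≤ s := hs
    have ht' : s₁ / 2 ≤ t := ht
    refine le_of_tendsto ((h.tendsto_weightedSum (by linarith)).sub
      (h.tendsto_weightedSum (by linarith))).abs (Eventually.of_forall fun N => ?_)
    have := Convex.norm_image_sub_le_of_norm_hasDerivWithin_le
      (f := fun z => weightedSum α x z N) (s := Set.Ici (1 / 2 + s₁ / 2)) (C := B)
      (fun z _ => (hasDerivAt_weightedSum α x z N).hasDerivWithinAt)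
      (fun z hz => by
        rw [norm_neg]
        exact abs_weightedSum_le hB hz N) (convex_Ici _)
      (x := 1 / 2 + t) (y := 1 / 2 + s) (by simpa using ht') (by simpa using hs')
    simpa using this
  have hL : LipschitzOnWith B.toNNReal (fun s => dirichletSeries α x (1 / 2 + s))
      (Set.Ici (s₁ / 2)) := by
    refine LipschitzOnWith.of_dist_le_mul fun s hs t ht => ?_
    rw [Real.dist_eq, Real.dist_eq, Real.coe_toNNReal _ ((abs_nonneg _).trans (hB 0))]
    exact hLip s hs t ht
  exact (hL.continuousOn.continuousAt (Ici_mem_nhds (by linarith))).continuousWithinAt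

lemma dirichletSeries_add (h : BoundedSums α x) {y : ℕ → ℝ} (hy : BoundedSums α y) {s : ℝ}
    (hs : 0 < s) :
    dirichletSeries α (fun k => x k + y k) (1 / 2 + s) =
      dirichletSeries α x (1 / 2 + s) + dirichletSeries α y (1 / 2 + s) := by
  have h1 := (h.tendsto_weightedSum hs).add (hy.tendsto_weightedSum hs)
  have e : dirichletPartialSum α (fun k => x k + y k) (1 / 2 + s) =
      fun N => weightedSum α x (1 / 2 + s) (N + 1) + weightedSum α y (1 / 2 + s) (N + 1) := by
    funext N
    rw [dirichletPartialSum_eq_weightedSum]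
    simp only [weightedSum, mul_add, Finset.sum_add_distrib]
  rw [dirichletSeries, e]
  exact ((tendsto_add_atTop_iff_nat 1).2 h1).limUnder_eq

lemma dirichletSeries_neg (h : BoundedSums α x) {s : ℝ} (hs : 0 < s) :
    dirichletSeries α (fun k => -x k) (1 / 2 + s) = -dirichletSeries α x (1 / 2 + s) := by
  have e : dirichletPartialSum α (fun k => -x k) (1 / 2 + s) =
      fun N => -dirichletPartialSum α x (1 / 2 + s) N := by
    funext N
    simp [dirichletPartialSum]
  rw [dirichletSeries, e]
  exact (h.tendsto_dirichletPartialSum hs).neg.limUnder_eq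

end BoundedSums

/-! ### Almost sure bounds via Fatou and Chernoff -/

section BoundedNoise

variable {Ω : Type*} [MeasurableSpace Ω] {P : Measure Ω} [IsProbabilityMeasure P]

/-- The weights are square summable at every point right of `1/2`. Boundedness propagates to the
right, so the countably many points `1/2 + 1/(m+1)` yield a single null set for all `s > 0`. -/
lemma ae_boundedSums {X : ℕ → Ω → ℝ} (hi : iIndepFun X P)
    (hm : ∀ k, Measurable (X k)) (h2 : ∀ k, MemLp (X k) 2 P) (h0 : ∀ k, ∫ ω, X k ω ∂P = 0)
    {v : ℝ} (hv : ∀ k, ∫ ω, X k ω ^ 2 ∂P ≤ v) (α : ℝ) :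
    ∀ᵐ ω ∂P, BoundedSums α fun k => X k ω := by
  have h : ∀ᵐ ω ∂P, ∀ m : ℕ, ∃ l : ℝ, Tendsto (fun N => ∑ k ∈ Finset.range N,
      dirichletWeight α (1 / 2 + 1 / ((m : ℝ) + 1)) k * X k ω) atTop (𝓝 l) := by
    rw [ae_all_iff]
    intro m
    refine ae_exists_tendsto_sum_mul hi hm h2 h0 hv ?_
    simp only [dirichletWeight_sq]
    have : (0 : ℝ) < 1 / ((m : ℝ) + 1) := by positivity
    exact summable_dirichletWeight _ (by linarith)
  filter_upwards [h] with ω hω s hs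
  obtain ⟨m, hm⟩ := exists_nat_one_div_lt hs
  obtain ⟨l, hl⟩ := hω m
  obtain ⟨B, hB⟩ := (Metric.isBounded_range_of_tendsto _ hl).exists_norm_le
  refine ⟨B, fun N => abs_weightedSum_le (z₀ := 1 / 2 + 1 / ((m : ℝ) + 1)) (fun N => ?_)
    (by linarith) N⟩
  exact hB _ ⟨N, rfl⟩

end BoundedNoise

section BoundedNoise

set_option linter.unusedSectionVars false

variable {Ω : Type*} [MeasurableSpace Ω] {P : Measure Ω} [IsProbabilityMeasure P]

/-- Fatou in `N` and summation over `n` show that `∑ₙ liminf_N Z` is almost surely finite, so its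
terms tend to 0. Infinitely many `N` are enough later, since a convergent sequence inherits a bound
satisfied infinitely often. -/
lemma ae_eventually_frequently_lt_two {Z : ℕ → ℕ → Ω → ENNReal} (hZ : ∀ n N, Measurable (Z n N))
    {b : ℕ → ENNReal} (hb : ∑' n, b n ≠ ⊤) (h : ∀ᶠ n in atTop, ∀ N, ∫⁻ ω, Z n N ω ∂P ≤ b n) :
    ∀ᵐ ω ∂P, ∀ᶠ n in atTop, ∃ᶠ N in atTop, Z n N ω < 2 := by
  obtain ⟨n₀, hn₀⟩ := eventually_atTop.1 h
  -- Zero below `n₀`, so that the integral bound holds for all `n` and the full series can be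
  -- summed.
  set F : ℕ → Ω → ENNReal := fun n ω => if n₀ ≤ n then liminf (fun N => Z n N ω) atTop else 0
  have hF : ∀ n, Measurable (F n) := by
    intro n
    by_cases hn : n₀ ≤ n
    · simp only [F, hn, if_true]
      exact Measurable.liminf (hZ n)
    · simp only [F, hn, if_false]
      exact measurable_const
  have hFb : ∀ n, ∫⁻ ω, F n ω ∂P ≤ b n := by
    intro n
    by_cases hn : n₀ ≤ n
    · simp only [F, hn, if_true]
      refine (lintegral_liminf_le (hZ n)).trans ?_
      refine (liminf_le_liminf (Eventually.of_forall fun N => hn₀ n hn N)).trans ?_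
      simp
    · simp [F, hn]
  have hfin : ∫⁻ ω, ∑' n, F n ω ∂P ≠ ⊤ := by
    rw [lintegral_tsum fun n => (hF n).aemeasurable]
    exact ne_top_of_le_ne_top hb (ENNReal.tsum_le_tsum hFb)
  filter_upwards [ae_lt_top (Measurable.tsum hF) hfin] with ω hω
  have h1 := ENNReal.tendsto_atTop_zero_of_tsum_ne_top hω.ne
  filter_upwards [h1.eventually_lt_const (by norm_num : (0 : ENNReal) < 2),
    eventually_ge_atTop n₀] with n hn hn0
  simp only [F, hn0, if_true] at hn
  exact frequently_lt_of_liminf_lt (h := hn)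

namespace IsBoundedNoise

variable {X : ℕ → Ω → ℝ} {v : ℝ}

lemma nonneg (h : IsBoundedNoise X P v) : 0 ≤ v :=
  (integral_nonneg fun _ => sq_nonneg _).trans (h.var_le 0)

lemma measurable_sum (h : IsBoundedNoise X P v) (c : ℕ → ℝ) (S : Finset ℕ) :
    Measurable fun ω => ∑ k ∈ S, c k * X k ω :=
  Finset.measurable_sum _ fun k _ => (h.meas k).const_mul _

lemma abs_sum_le (h : IsBoundedNoise X P v) (c : ℕ → ℝ) (S : Finset ℕ) (ω : Ω) :
    |∑ k ∈ S, c k * X k ω| ≤ ∑ k ∈ S, |c k| * (2 * √(k : ℝ)) := by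
  refine (Finset.abs_sum_le_sum_abs _ _).trans (Finset.sum_le_sum fun k _ => ?_)
  rw [abs_mul]
  gcongr
  exact h.bdd k ω

lemma lintegral_exp_sum_le (h : IsBoundedNoise X P v) {c : ℕ → ℝ} {M : ℝ} (hM : M ≤ 1)
    (hc : ∀ k, |c k| * (2 * √(k : ℝ)) ≤ M) (hs : Summable fun k => c k ^ 2) (S : Finset ℕ) :
    ∫⁻ ω, ENNReal.ofReal (Real.exp (∑ k ∈ S, c k * X k ω)) ∂P ≤
      ENNReal.ofReal (Real.exp ((1 + M) / 2 * (v * ∑' k, c k ^ 2))) := by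
  have hM0 : 0 ≤ M := le_trans (by positivity) (hc 0)
  rw [← ofReal_integral_eq_lintegral_ofReal
    (integrable_exp_of_abs_le (h.measurable_sum c S) (h.abs_sum_le c S))
    (ae_of_all _ fun ω => (Real.exp_pos _).le)]
  apply ENNReal.ofReal_le_ofReal
  refine (h.integral_exp_sum_le hM hc S).trans (Real.exp_le_exp.2 ?_)
  have := h.nonneg
  gcongr
  exact hs.sum_le_tsum _ fun k _ => sq_nonneg _

/-- The Chernoff bound: apply the preceding Fatou argument to `exp (sum - t n)`, whose mean is at
most `exp (b n - t n)`. -/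
lemma ae_eventually_frequently_sum_le (h : IsBoundedNoise X P v) {c : ℕ → ℕ → ℝ} {b t : ℕ → ℝ}
    (hc : ∀ᶠ n in atTop, ∃ M : ℝ, M ≤ 1 ∧ (∀ k, |c n k| * (2 * √(k : ℝ)) ≤ M) ∧
      (Summable fun k => c n k ^ 2) ∧ (1 + M) / 2 * (v * ∑' k, c n k ^ 2) ≤ b n)
    (hbt : Summable fun n => Real.exp (b n - t n)) :
    ∀ᵐ ω ∂P, ∀ᶠ n in atTop, ∃ᶠ N in atTop,
      ∑ k ∈ Finset.range N, c n k * X k ω ≤ t n + 1 := by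
  have h1 := ae_eventually_frequently_lt_two (P := P)
    (Z := fun n N ω => ENNReal.ofReal (Real.exp (-t n)) *
      ENNReal.ofReal (Real.exp (∑ k ∈ Finset.range N, c n k * X k ω)))
    (b := fun n => ENNReal.ofReal (Real.exp (b n - t n)))
    (fun n N => by
      have := h.measurable_sum (c n) (Finset.range N)
      fun_prop) (by
      rw [← ENNReal.ofReal_tsum_of_nonneg (fun n => (Real.exp_pos _).le) hbt]
      exact ENNReal.ofReal_ne_top) (by
      filter_upwards [hc] with n hn N
      obtain ⟨M, hM, hcM, hsum, hle⟩ := hn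
      have hm := (h.measurable_sum (c n) (Finset.range N)).exp.ennreal_ofReal
      rw [lintegral_const_mul _ hm]
      refine (mul_le_mul_right (h.lintegral_exp_sum_le hM hcM hsum _) _).trans ?_
      rw [← ENNReal.ofReal_mul (Real.exp_pos _).le, ← Real.exp_add]
      apply ENNReal.ofReal_le_ofReal
      apply Real.exp_le_exp.2
      linarith)
  filter_upwards [h1] with ω hω
  filter_upwards [hω] with n hn
  refine hn.mono fun N hN => ?_
  rw [← ENNReal.ofReal_mul (Real.exp_pos _).le, ← Real.exp_add,
    show (2 : ENNReal) = ENNReal.ofReal 2 by simp, ENNReal.ofReal_lt_ofReal_iff (by norm_num)] at hN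
  -- The threshold 2 lies below `e`, which accounts for the additive 1 in the conclusion.
  have h2 : (2 : ℝ) ≤ Real.exp 1 := by
    have := Real.add_one_le_exp (1 : ℝ); linarith
  have := Real.exp_lt_exp.1 (hN.trans_le h2)
  linarith

end IsBoundedNoise

end BoundedNoise

/-! ### Oscillation between neighbouring grid points -/

/-- This bounds a single summand for noise of size `2√k`: the root cancels `k^(-1/2)`, and `(log
k)^α k^(-s)` remains. -/
lemma exists_dirichletWeight_mul_sqrt_le (α : ℝ) : ∃ C : ℝ, 0 < C ∧ ∀ s : ℝ, 0 < s → ∀ k : ℕ,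
    dirichletWeight α (1 / 2 + s) k * (2 * √(k : ℝ)) ≤ C * s ^ (-max α 0) := by
  obtain ⟨C, hC, h⟩ := exists_dirichletWeight_le α
  refine ⟨2 * C, by positivity, fun s hs k => ?_⟩
  by_cases hk : 2 ≤ k
  · have h2 := two_le_natCast hk
    have h1 := h s hs (1 / 2 + s) k
    rw [add_sub_cancel_right] at h1
    have h3 : 0 < (k : ℝ) ^ (1 / 2 : ℝ) := by positivity
    rw [Real.sqrt_eq_rpow]
    calc dirichletWeight α (1 / 2 + s) k * (2 * (k : ℝ) ^ (1 / 2 : ℝ)) ≤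
        (C * s ^ (-max α 0) * ((k : ℝ) ^ (1 / 2 : ℝ))⁻¹) * (2 * (k : ℝ) ^ (1 / 2 : ℝ)) := by gcongr
      _ = _ := by field_simp
  · simp only [dirichletWeight, hk, if_false]
    rw [zero_mul]
    positivity

lemma summable_dirichletWeight_sq (α : ℝ) {s : ℝ} (hs : 0 < s) :
    Summable fun k => dirichletWeight α (1 / 2 + s) k ^ 2 := by
  simp only [dirichletWeight_sq]
  exact summable_dirichletWeight _ (by linarith)

lemma tsum_dirichletWeight_sq (α s : ℝ) : ∑' k, dirichletWeight α (1 / 2 + s) k ^ 2 =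
    ∑' k, dirichletWeight (2 * α) (1 + 2 * s) k := by
  simp only [dirichletWeight_sq]
  congr 1
  funext k
  ring_nf

lemma measurable_dirichletWeight (α : ℝ) (k : ℕ) : Measurable fun z => dirichletWeight α z k :=
  (continuous_iff_continuousAt.2 fun z => (hasDerivAt_dirichletWeight α z k).continuousAt).measurable

/-- Oscillation of a `C¹` function, controlled through an exponential integral. -/
lemma abs_sub_le_of_lintegral_exp_le {g g' : ℝ → ℝ} (hg : ∀ z, HasDerivAt g (g' z) z)
    (hg' : Continuous g') {a b l t K : ℝ} (hl : 0 < l) (hK : 0 ≤ K)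
    (h : ∫⁻ u in Set.Icc a b, ENNReal.ofReal (Real.exp (l * |g' u|)) ≤ ENNReal.ofReal K)
    {s : ℝ} (hs : s ∈ Set.Icc a b) :
    |g s - g b| ≤ ((b - a) * t + Real.exp (-t) * K) / l := by
  have hab : a ≤ b := hs.1.trans hs.2
  have hc : Continuous fun u => Real.exp (l * |g' u|) := by fun_prop
  have hI : ∫ u in a..b, Real.exp (l * |g' u|) ≤ K := by
    rw [intervalIntegral.integral_of_le hab, ← integral_Icc_eq_integral_Ioc,
      integral_eq_lintegral_of_nonneg_ae (ae_of_all _ fun u => (Real.exp_pos _).le)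
        hc.aestronglyMeasurable]
    exact ENNReal.toReal_le_of_le_ofReal hK h
  have h1 : g b - g s = ∫ u in s..b, g' u :=
    (intervalIntegral.integral_eq_sub_of_hasDerivAt (fun u _ => hg u)
      (hg'.intervalIntegrable _ _)).symm
  rw [abs_sub_comm, h1, le_div_iff₀ hl]
  have h2 : |∫ u in s..b, g' u| ≤ ∫ u in a..b, |g' u| := by
    refine (intervalIntegral.abs_integral_le_integral_abs hs.2).trans ?_
    exact intervalIntegral.integral_mono_interval hs.1 hs.2 le_rfl
      (ae_of_all _ fun u => abs_nonneg _) (hg'.abs.intervalIntegrable _ _)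
  calc |∫ u in s..b, g' u| * l ≤ (∫ u in a..b, |g' u|) * l := by gcongr
    _ = ∫ u in a..b, |g' u| * l := by rw [intervalIntegral.integral_mul_const]
    -- The tangent inequality `y ≤ t + e^(y-t)` with a free level `t`, later taken as `2 log n`.
    _ ≤ ∫ u in a..b, (t + Real.exp (-t) * Real.exp (l * |g' u|)) := by
        apply intervalIntegral.integral_mono_on hab
          ((hg'.abs.mul continuous_const).intervalIntegrable _ _)
          ((continuous_const.add (continuous_const.mul hc)).intervalIntegrable _ _)
        intro u _
        change |g' u| * l ≤ t + Real.exp (-t) * Real.exp (l * |g' u|)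
        rw [← Real.exp_add]
        have := Real.add_one_le_exp (-t + l * |g' u|)
        linarith
    _ = (b - a) * t + Real.exp (-t) * ∫ u in a..b, Real.exp (l * |g' u|) := by
        have hi : IntervalIntegrable (fun u => Real.exp (-t) * Real.exp (l * |g' u|)) volume a b :=
          (continuous_const.mul hc).intervalIntegrable _ _
        rw [intervalIntegral.integral_add (continuous_const.intervalIntegrable _ _) hi, intervalIntegral.integral_const,
          intervalIntegral.integral_const_mul, smul_eq_mul]
    _ ≤ _ := by gcongr

section BoundedNoise

set_option linter.unusedSectionVars false

variable {Ω : Type*} [MeasurableSpace Ω] {P : Measure Ω} [IsProbabilityMeasure P]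

namespace IsBoundedNoise

variable {X : ℕ → Ω → ℝ} {v : ℝ}

lemma measurable_weightedSum (h : IsBoundedNoise X P v) (α : ℝ) (N : ℕ) :
    Measurable fun p : Ω × ℝ => weightedSum α (fun k => X k p.1) (1 / 2 + p.2) N := by
  unfold weightedSum
  refine Finset.measurable_sum _ fun k _ => ?_
  have h1 := measurable_dirichletWeight α k
  have h2 := h.meas k
  exact (h1.comp (by fun_prop)).mul (h2.comp measurable_fst)

/-- Uniform exponential moments of the normalised derivative of the series. -/
lemma exists_lintegral_exp_abs_weightedSum_le (h : IsBoundedNoise X P v) {α : ℝ}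
    (hα : -1 / 2 < α) : ∃ τ K : ℝ, 0 < τ ∧ 0 < K ∧ ∀ a : ℝ, 0 < a → ∀ u : ℝ, a ≤ u → u ≤ 1 / 2 →
      ∀ N, ∫⁻ ω, ENNReal.ofReal (Real.exp (τ * a ^ (3 / 2 + α) *
        |weightedSum (α + 1) (fun k => X k ω) (1 / 2 + u) N|)) ∂P ≤ ENNReal.ofReal K := by
  obtain ⟨C, hC, hCw⟩ := exists_dirichletWeight_mul_sqrt_le (α + 1)
  obtain ⟨D, hD, hDv⟩ := exists_tsum_dirichletWeight_le (β := 2 * (α + 1)) (by linarith)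
  have hv := h.nonneg
  set E := v * ((1 / C) ^ 2 * (D * (2 : ℝ) ^ (-(1 + 2 * (α + 1))))) with hE
  refine ⟨1 / C, 2 * Real.exp E, by positivity, by positivity, fun a ha u hau hu N => ?_⟩
  have hu0 : 0 < u := ha.trans_le hau
  have hmax : max (α + 1) 0 = α + 1 := max_eq_left (by linarith)
  set l := 1 / C * a ^ (3 / 2 + α) with hl
  have hl0 : 0 ≤ l := by positivity
  have hlu : l ≤ 1 / C * u ^ (3 / 2 + α) := by
    rw [hl]
    have := Real.rpow_le_rpow ha.le hau (by linarith : 0 ≤ 3 / 2 + α)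
    gcongr
  have hweight : ∀ k, l * (dirichletWeight (α + 1) (1 / 2 + u) k * (2 * √(k : ℝ))) ≤ 1 := by
    intro k
    have h1 := hCw u hu0 k
    rw [hmax] at h1
    calc l * (dirichletWeight (α + 1) (1 / 2 + u) k * (2 * √(k : ℝ))) ≤
        (1 / C * u ^ (3 / 2 + α)) * (C * u ^ (-(α + 1))) := by
          have := dirichletWeight_nonneg (α + 1) (1 / 2 + u) k
          gcongr
      _ = u ^ (1 / 2 : ℝ) := by
          have : u ^ (1 / 2 : ℝ) = u ^ (3 / 2 + α) * u ^ (-(α + 1)) := by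
            rw [← Real.rpow_add hu0]; ring_nf
          rw [this]
          field_simp
      _ ≤ 1 := Real.rpow_le_one hu0.le (by linarith) (by norm_num)
  have hvar : v * ∑' k, (l * dirichletWeight (α + 1) (1 / 2 + u) k) ^ 2 ≤ E := by
    simp only [mul_pow]
    rw [tsum_mul_left, tsum_dirichletWeight_sq, hE]
    have h1 := hDv (2 * u) (by linarith) (by linarith)
    have h2 : l ^ 2 * u ^ (-(1 + 2 * (α + 1))) ≤ (1 / C) ^ 2 := by
      calc l ^ 2 * u ^ (-(1 + 2 * (α + 1))) ≤
          (1 / C * u ^ (3 / 2 + α)) ^ 2 * u ^ (-(1 + 2 * (α + 1))) := by gcongr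
        _ = (1 / C) ^ 2 := by
          rw [mul_pow, mul_assoc, ← Real.rpow_natCast (u ^ (3 / 2 + α)), ← Real.rpow_mul hu0.le,
            ← Real.rpow_add hu0]
          have : (3 / 2 + α) * ((2 : ℕ) : ℝ) + -(1 + 2 * (α + 1)) = 0 := by push_cast; ring
          rw [this, Real.rpow_zero, mul_one]
    refine mul_le_mul_of_nonneg_left ?_ hv
    calc l ^ 2 * ∑' k, dirichletWeight (2 * (α + 1)) (1 + 2 * u) k ≤
        l ^ 2 * (D * (2 * u) ^ (-(1 + 2 * (α + 1)))) := by gcongr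
      _ = (l ^ 2 * u ^ (-(1 + 2 * (α + 1)))) * (D * (2 : ℝ) ^ (-(1 + 2 * (α + 1)))) := by
          rw [Real.mul_rpow (by norm_num) hu0.le]; ring
      _ ≤ _ := by gcongr
  have hsign : ∀ ε : ℝ, |ε| = 1 →
      ∫⁻ ω, ENNReal.ofReal (Real.exp (∑ k ∈ Finset.range N,
        (ε * (l * dirichletWeight (α + 1) (1 / 2 + u) k)) * X k ω)) ∂P ≤
        ENNReal.ofReal (Real.exp E) := by
    intro ε hε
    have hε2 : ε ^ 2 = 1 := by rw [← sq_abs, hε, one_pow]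
    have hs : Summable fun k => (ε * (l * dirichletWeight (α + 1) (1 / 2 + u) k)) ^ 2 := by
      simp only [mul_pow]
      exact ((summable_dirichletWeight_sq _ hu0).mul_left _).mul_left _
    refine (h.lintegral_exp_sum_le (M := 1) le_rfl (fun k => ?_) hs _).trans ?_
    · rw [abs_mul, hε, one_mul, abs_mul, abs_of_nonneg hl0,
        abs_of_nonneg (dirichletWeight_nonneg _ _ _), mul_assoc]
      exact hweight k
    · apply ENNReal.ofReal_le_ofReal
      apply Real.exp_le_exp.2
      have e : (fun k => (ε * (l * dirichletWeight (α + 1) (1 / 2 + u) k)) ^ 2) =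
          fun k => (l * dirichletWeight (α + 1) (1 / 2 + u) k) ^ 2 := by
        funext k
        rw [mul_pow ε, hε2, one_mul]
      rw [e]
      linarith
  have hm := fun ε : ℝ => (h.measurable_sum
    (fun k => ε * (l * dirichletWeight (α + 1) (1 / 2 + u) k)) (Finset.range N)).exp.ennreal_ofReal
  calc _ ≤ ∫⁻ ω, (ENNReal.ofReal (Real.exp (∑ k ∈ Finset.range N,
        (1 * (l * dirichletWeight (α + 1) (1 / 2 + u) k)) * X k ω)) +
        ENNReal.ofReal (Real.exp (∑ k ∈ Finset.range N,
        (-1 * (l * dirichletWeight (α + 1) (1 / 2 + u) k)) * X k ω))) ∂P := by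
        refine lintegral_mono fun ω => ?_
        have e : ∀ ε : ℝ, ∑ k ∈ Finset.range N,
            (ε * (l * dirichletWeight (α + 1) (1 / 2 + u) k)) * X k ω =
            ε * (l * weightedSum (α + 1) (fun k => X k ω) (1 / 2 + u) N) := by
          intro ε
          unfold weightedSum
          rw [Finset.mul_sum, Finset.mul_sum]
          refine Finset.sum_congr rfl fun k _ => by ring
        simp only [e]
        rw [← ENNReal.ofReal_add (Real.exp_pos _).le (Real.exp_pos _).le]
        apply ENNReal.ofReal_le_ofReal
        rcases abs_cases (weightedSum (α + 1) (fun k => X k ω) (1 / 2 + u) N) with ⟨w, -⟩ | ⟨w, -⟩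
        · rw [w, one_mul]
          linarith [Real.exp_pos (-1 * (l * weightedSum (α + 1) (fun k => X k ω) (1 / 2 + u) N))]
        · rw [w, show l * -weightedSum (α + 1) (fun k => X k ω) (1 / 2 + u) N =
            -1 * (l * weightedSum (α + 1) (fun k => X k ω) (1 / 2 + u) N) by ring]
          linarith [Real.exp_pos (1 * (l * weightedSum (α + 1) (fun k => X k ω) (1 / 2 + u) N))]
    _ ≤ ENNReal.ofReal (Real.exp E) + ENNReal.ofReal (Real.exp E) := by
        rw [lintegral_add_left (hm 1)]
        exact add_le_add (hsign 1 (by simp)) (hsign (-1) (by simp))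
    _ = _ := by
        rw [← ENNReal.ofReal_add (Real.exp_pos _).le (Real.exp_pos _).le]
        ring_nf

/-- The exponential moment of the derivative, integrated over `[s (n+1), s n]`, has mean at most `K
* gap`. Dividing by `gap * K * n²` makes the means summable, so almost surely the integral is
eventually below `2 * gap * K * n²` along infinitely many `N`. The tangent inequality with `t = 2
log n` then cancels `n²` and leaves only a logarithmic loss. -/
lemma exists_ae_eventually_oscillation_le (h : IsBoundedNoise X P v) {α : ℝ}
    (hα : -1 / 2 < α) {s : ℕ → ℝ} (hs0 : ∀ n, 0 < s n) (hs : StrictAnti s)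
    (hlim : Tendsto s atTop (𝓝 0)) : ∃ K : ℝ, 0 < K ∧
      ∀ᵐ ω ∂P, BoundedSums α (fun k => X k ω) → ∀ᶠ n : ℕ in atTop,
        ∀ r ∈ Set.Icc (s (n + 1)) (s n),
          |dirichletSeries α (fun k => X k ω) (1 / 2 + r) -
            dirichletSeries α (fun k => X k ω) (1 / 2 + s n)| ≤
          K * (s n - s (n + 1)) * (Real.log n + 1) * s (n + 1) ^ (-(3 / 2 + α)) := by
  obtain ⟨τ, K, hτ, hK, hexp⟩ := h.exists_lintegral_exp_abs_weightedSum_le hα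
  set gap : ℕ → ℝ := fun n => s n - s (n + 1) with hgap
  have hgap0 : ∀ n, 0 < gap n := fun n => sub_pos.2 (hs (Nat.lt_succ_self n))
  set l : ℕ → ℝ := fun n => τ * s (n + 1) ^ (3 / 2 + α)
  have hl : ∀ n, 0 < l n := fun n => by have := hs0 (n + 1); positivity
  refine ⟨2 * (K + 1) / τ, by positivity, ?_⟩
  have hjoint : ∀ n N, Measurable fun p : Ω × ℝ => ENNReal.ofReal (Real.exp (l n *
      |weightedSum (α + 1) (fun k => X k p.1) (1 / 2 + p.2) N|)) := by
    intro n N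
    have := h.measurable_weightedSum (α + 1) N
    fun_prop
  have h1 := ae_eventually_frequently_lt_two (P := P)
    (Z := fun n N ω => ENNReal.ofReal (1 / (gap n * K * (n : ℝ) ^ 2)) *
      ∫⁻ u in Set.Icc (s (n + 1)) (s n), ENNReal.ofReal (Real.exp (l n *
        |weightedSum (α + 1) (fun k => X k ω) (1 / 2 + u) N|)))
    (b := fun n => ENNReal.ofReal (1 / (n : ℝ) ^ 2))
    (fun n N => (Measurable.lintegral_prod_right (hjoint n N)).const_mul _) (by
      rw [← ENNReal.ofReal_tsum_of_nonneg (fun n => by positivity)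
        (Real.summable_one_div_nat_pow.2 (by norm_num))]
      exact ENNReal.ofReal_ne_top) (by
      filter_upwards [hlim.eventually_le_const (by norm_num : (0 : ℝ) < 1 / 2),
        eventually_ge_atTop 1] with n hn hn1 N
      have hg := hgap0 n
      rw [lintegral_const_mul _ (Measurable.lintegral_prod_right (hjoint n N)),
        lintegral_lintegral_swap (f := fun ω u => ENNReal.ofReal (Real.exp (l n *
          |weightedSum (α + 1) (fun k => X k ω) (1 / 2 + u) N|))) (hjoint n N).aemeasurable]
      have h2 : ∫⁻ u in Set.Icc (s (n + 1)) (s n), ∫⁻ ω, ENNReal.ofReal (Real.exp (l n *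
          |weightedSum (α + 1) (fun k => X k ω) (1 / 2 + u) N|)) ∂P ≤
          ENNReal.ofReal K * ENNReal.ofReal (gap n) := by
        calc _ ≤ ∫⁻ u in Set.Icc (s (n + 1)) (s n), ENNReal.ofReal K := by
              refine setLIntegral_mono' measurableSet_Icc fun u hu => ?_
              exact hexp _ (hs0 _) u hu.1 (hu.2.trans hn) N
          _ = _ := by rw [setLIntegral_const, Real.volume_Icc]
      refine (mul_le_mul_right h2 _).trans ?_
      rw [← ENNReal.ofReal_mul hK.le, ← ENNReal.ofReal_mul (by positivity)]
      apply ENNReal.ofReal_le_ofReal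
      have : (n : ℝ) ≠ 0 := by positivity
      apply le_of_eq
      field_simp)
  filter_upwards [h1] with ω hω hB
  filter_upwards [hω, eventually_ge_atTop 1] with n hn hn1 r hr
  have hn0 : (0 : ℝ) < n := by exact_mod_cast hn1
  have hr0 : 0 < r := (hs0 _).trans_le hr.1
  have hg := hgap0 n
  have hlim1 := ((hB.tendsto_weightedSum hr0).sub (hB.tendsto_weightedSum (hs0 n))).abs
  refine le_of_tendsto_of_frequently hlim1 (hn.mono fun N hN => ?_)
  have hlog : 0 ≤ Real.log n := Real.log_natCast_nonneg n
  have hI : ∫⁻ u in Set.Icc (s (n + 1)) (s n), ENNReal.ofReal (Real.exp (l n *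
      |-weightedSum (α + 1) (fun k => X k ω) (1 / 2 + u) N|)) ≤
      ENNReal.ofReal (2 * (gap n * K * (n : ℝ) ^ 2)) := by
    simp only [abs_neg]
    have hpos : 0 < gap n * K * (n : ℝ) ^ 2 := by positivity
    rw [mul_comm, one_div (gap n * K * (n : ℝ) ^ 2), ENNReal.ofReal_inv_of_pos hpos, ← div_eq_mul_inv] at hN
    have h3 := (ENNReal.div_le_iff (by simpa using hpos) ENNReal.ofReal_ne_top).1 hN.le
    rw [ENNReal.ofReal_mul (by norm_num)]
    simpa using h3
  have h4 := abs_sub_le_of_lintegral_exp_le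
    (g := fun u => weightedSum α (fun k => X k ω) (1 / 2 + u) N)
    (g' := fun u => -weightedSum (α + 1) (fun k => X k ω) (1 / 2 + u) N)
    (fun z => (hasDerivAt_weightedSum α (fun k => X k ω) (1 / 2 + z) N).comp_const_add (1 / 2) z)
    ((continuous_weightedSum (α + 1) (fun k => X k ω) N).comp (by fun_prop)).neg
    (hl n) (t := 2 * Real.log n) (by positivity) hI hr
  refine h4.trans (le_of_eq_of_le (b := gap n * (2 * Real.log n + 2 * K) / l n) ?_ ?_)
  · have e : Real.exp (-(2 * Real.log n)) = ((n : ℝ) ^ 2)⁻¹ := by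
      rw [Real.exp_neg, mul_comm, Real.exp_mul, Real.exp_log hn0]
      norm_num
    rw [e]
    congr 1
    simp only [hgap]
    field_simp
  · have hp := hs0 (n + 1)
    have e : 2 * (K + 1) / τ * (s n - s (n + 1)) * (Real.log n + 1) * s (n + 1) ^ (-(3 / 2 + α)) =
        gap n * (2 * (K + 1) * (Real.log n + 1)) / l n := by
      simp only [l, hgap]
      rw [Real.rpow_neg hp.le]
      field_simp
    rw [e]
    have := hl n
    gcongr
    nlinarith

end IsBoundedNoise

end BoundedNoise

/-! ### The normalisation and the Chernoff bound at its scale -/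

/-- The iterated-logarithm normalisation `(s^{-(1+2α)} log log (1/s))^{1/2}`. -/
noncomputable def lilScale (α s : ℝ) : ℝ :=
  √(s ^ (-(1 + 2 * α)) * Real.log (Real.log (1 / s)))

lemma tendsto_log_one_div_nhdsGT_zero : Tendsto (fun s : ℝ => Real.log (1 / s)) (𝓝[>] 0) atTop := by
  simp only [one_div]
  exact Real.tendsto_log_atTop.comp tendsto_inv_nhdsGT_zero

lemma tendsto_log_log_one_div_nhdsGT_zero :
    Tendsto (fun s : ℝ => Real.log (Real.log (1 / s))) (𝓝[>] 0) atTop :=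
  Real.tendsto_log_atTop.comp tendsto_log_one_div_nhdsGT_zero

lemma tendsto_log_log_mul_rpow {c : ℝ} (hc : 0 < c) :
    Tendsto (fun s : ℝ => Real.log (Real.log (1 / s)) * s ^ c) (𝓝[>] 0) (𝓝 0) := by
  have h1 := (tendsto_log_mul_rpow_nhdsGT_zero hc).neg
  rw [neg_zero] at h1
  refine squeeze_zero' ?_ ?_ h1
  · filter_upwards [tendsto_log_log_one_div_nhdsGT_zero.eventually_ge_atTop 0,
      self_mem_nhdsWithin] with s hs hs0
    have : (0 : ℝ) < s := hs0
    positivity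
  · filter_upwards [tendsto_log_one_div_nhdsGT_zero.eventually_gt_atTop 0,
      self_mem_nhdsWithin] with s hs hs0
    have h0 : (0 : ℝ) < s := hs0
    rw [← neg_mul]
    have : Real.log (Real.log (1 / s)) ≤ -Real.log s := by
      have := Real.log_le_sub_one_of_pos hs
      rw [show -Real.log s = Real.log (1 / s) by rw [one_div, Real.log_inv]]
      linarith
    gcongr

lemma lilScale_le_lilScale {α : ℝ} (hα : -1 / 2 < α) {s t : ℝ} (hs : 0 < s) (hst : s ≤ t)
    (ht : t ≤ Real.exp (-1)) : lilScale α t ≤ lilScale α s := by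
  have ht0 : 0 < t := hs.trans_le hst
  have h1 : 1 ≤ Real.log (1 / t) := by
    rw [one_div, Real.log_inv, le_neg, Real.log_le_iff_le_exp ht0]
    exact ht
  have h2 : Real.log (1 / t) ≤ Real.log (1 / s) :=
    Real.log_le_log (by positivity) (one_div_le_one_div_of_le hs hst)
  have h3 : Real.log (Real.log (1 / t)) ≤ Real.log (Real.log (1 / s)) :=
    Real.log_le_log (by linarith) h2
  have h4 := Real.log_nonneg h1
  have h5 := Real.rpow_le_rpow_of_nonpos hs hst (by linarith : -(1 + 2 * α) ≤ 0)
  unfold lilScale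
  gcongr

lemma rpow_le_lilScale {α s : ℝ} (hs : 0 < s) (h : 1 ≤ Real.log (Real.log (1 / s))) :
    s ^ (-(1 / 2 + α)) ≤ lilScale α s := by
  unfold lilScale
  apply Real.le_sqrt_of_sq_le
  rw [← Real.rpow_natCast, ← Real.rpow_mul hs.le]
  have e : -(1 / 2 + α) * ((2 : ℕ) : ℝ) = -(1 + 2 * α) := by push_cast; ring
  rw [e]
  exact le_mul_of_one_le_right (by positivity) h

/-- The left side is the Chernoff tilt times the bound for one summand. It tends to 0 because `1 +
2α > 2 max α 0`, which is where `α > -1/2` is used. -/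
lemma eventually_sqrt_mul_rpow_le {α : ℝ} (hα : -1 / 2 < α) {q m : ℝ} (hq : 0 ≤ q) (hm : 0 < m)
    (C : ℝ) : ∀ᶠ s : ℝ in 𝓝[>] 0,
      √(q * Real.log (Real.log (1 / s)) / s ^ (-(1 + 2 * α))) * (C * s ^ (-max α 0)) ≤ m := by
  have hc : 0 < 1 + 2 * α - 2 * max α 0 := by
    rcases max_cases α 0 with ⟨e, -⟩ | ⟨e, -⟩ <;> rw [e] <;> linarith
  have h1 := (tendsto_log_log_mul_rpow hc).const_mul (q * C ^ 2)
  rw [mul_zero] at h1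
  filter_upwards [h1.eventually_le_const (by positivity : 0 < m ^ 2),
    tendsto_log_log_one_div_nhdsGT_zero.eventually_ge_atTop 0, self_mem_nhdsWithin] with s hs hL hs0
  have hp : (0 : ℝ) < s := hs0
  refine (abs_le_of_sq_le_sq' (le_of_eq_of_le ?_ hs) hm.le).2
  have e : s ^ (1 + 2 * α - 2 * max α 0) = (s ^ (-(1 + 2 * α)))⁻¹ * (s ^ (-max α 0)) ^ 2 := by
    rw [← Real.rpow_neg hp.le, ← Real.rpow_natCast, ← Real.rpow_mul hp.le, ← Real.rpow_add hp]
    congr 1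
    push_cast
    ring
  rw [mul_pow, mul_pow, Real.sq_sqrt (by positivity), e]
  ring

section BoundedNoise

variable {Ω : Type*} [MeasurableSpace Ω] {P : Measure Ω} [IsProbabilityMeasure P]

namespace IsBoundedNoise

variable {X : ℕ → Ω → ℝ} {v : ℝ}

/-- For variance `D w` the tilt `√(2ρL / (D w))` is optimal at level `√(2ρD)` times the scale and
gives failure probability about `exp (-ρL)`. The slack `κ` pays for the non-Gaussian factor and for
the additive 1. Dominated weights `u` are allowed so that one lemma serves both the full series and
its off-block part. -/
lemma ae_eventually_frequently_sum_le_lilScale (h : IsBoundedNoise X P v) {α : ℝ}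
    (hα : -1 / 2 < α) {s : ℕ → ℝ} (hs0 : ∀ n, 0 < s n) (hlim : Tendsto s atTop (𝓝 0))
    {u : ℕ → ℕ → ℝ} (hu0 : ∀ n k, 0 ≤ u n k) (hu : ∀ n k, u n k ≤ dirichletWeight α (1 / 2 + s n) k)
    {D : ℝ} (hD : 0 < D) (hvar : ∀ᶠ n in atTop, v * ∑' k, u n k ^ 2 ≤ D * s n ^ (-(1 + 2 * α)))
    {ρ κ : ℝ} (hρ : 0 < ρ) (hκ : 0 < κ)
    (hsum : Summable fun n => Real.exp (-(ρ * (1 - κ)) * Real.log (Real.log (1 / s n)))) :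
    ∀ᵐ ω ∂P, ∀ᶠ n in atTop, ∃ᶠ N in atTop,
      ∑ k ∈ Finset.range N, u n k * X k ω ≤ (1 + κ) * √(2 * ρ * D) * lilScale α (s n) := by
  have hs : Tendsto s atTop (𝓝[>] 0) :=
    tendsto_nhdsWithin_iff.2 ⟨hlim, Eventually.of_forall hs0⟩
  obtain ⟨C, hC, hCw⟩ := exists_dirichletWeight_mul_sqrt_le α
  set L : ℕ → ℝ := fun n => Real.log (Real.log (1 / s n)) with hL
  set w : ℕ → ℝ := fun n => s n ^ (-(1 + 2 * α)) with hw
  have hw0 : ∀ n, 0 < w n := fun n => Real.rpow_pos_of_pos (hs0 n) _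
  set θ : ℕ → ℝ := fun n => √(2 * ρ * L n / (D * w n)) with hθ
  have hLlim : Tendsto L atTop atTop := tendsto_log_log_one_div_nhdsGT_zero.comp hs
  -- The moment generating function bound needs summands of size at most 1.
  set m := min κ 1
  have hm : 0 < m := lt_min hκ one_pos
  have hsmall : ∀ᶠ n in atTop, θ n * (C * s n ^ (-max α 0)) ≤ m := by
    filter_upwards [hs.eventually (eventually_sqrt_mul_rpow_le hα (q := 2 * ρ / D) (by positivity)
      hm C)] with n hn
    refine le_of_eq_of_le ?_ hn
    simp only [hθ, hL, hw]
    congr 2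
    field_simp
  have h1 := h.ae_eventually_frequently_sum_le (c := fun n k => θ n * u n k)
    (b := fun n => (1 + κ) * ρ * L n) (t := fun n => 2 * ρ * L n) (by
      filter_upwards [hsmall, hvar, hLlim.eventually_ge_atTop 0] with n hn hv hLn
      have hθ0 : 0 ≤ θ n := Real.sqrt_nonneg _
      have hus : Summable fun k => u n k ^ 2 :=
        Summable.of_nonneg_of_le (fun k => sq_nonneg _)
          (fun k => pow_le_pow_left₀ (hu0 n k) (hu n k) 2) (summable_dirichletWeight_sq α (hs0 n))
      refine ⟨m, min_le_right _ _, fun k => ?_, ?_, ?_⟩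
      · rw [abs_of_nonneg (mul_nonneg hθ0 (hu0 n k)), mul_assoc]
        refine le_trans ?_ hn
        have h2 := hCw (s n) (hs0 n) k
        have h3 := hu n k
        refine mul_le_mul_of_nonneg_left (le_trans ?_ h2) hθ0
        gcongr
      · simp only [mul_pow]
        exact hus.mul_left _
      · simp only [mul_pow]
        rw [tsum_mul_left]
        have hwn := hw0 n
        have h2 : θ n ^ 2 = 2 * ρ * L n / (D * w n) := by
          rw [hθ, Real.sq_sqrt (by positivity)]
        have hvn := h.nonneg
        calc (1 + m) / 2 * (v * (θ n ^ 2 * ∑' k, u n k ^ 2)) =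
            (1 + m) / 2 * (θ n ^ 2 * (v * ∑' k, u n k ^ 2)) := by ring
          _ ≤ (1 + κ) / 2 * (θ n ^ 2 * (D * w n)) := by
            have : 0 ≤ ∑' k, u n k ^ 2 := tsum_nonneg fun k => sq_nonneg _
            gcongr
            exact min_le_left _ _
          _ = (1 + κ) * ρ * L n := by
            rw [h2]; field_simp) (by
      convert hsum using 2 with n
      simp only [hL]
      ring_nf)
  filter_upwards [h1] with ω hω
  filter_upwards [hω, hLlim.eventually_ge_atTop (1 / (2 * ρ * κ)), hLlim.eventually_gt_atTop 0]
    with n hn hLn hL0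
  refine hn.mono fun N hN => ?_
  have hwn := hw0 n
  have hθ0 : 0 < θ n := Real.sqrt_pos.2 (by positivity)
  have e1 : ∑ k ∈ Finset.range N, θ n * u n k * X k ω =
      θ n * ∑ k ∈ Finset.range N, u n k * X k ω := by
    rw [Finset.mul_sum]
    exact Finset.sum_congr rfl fun k _ => by ring
  rw [e1] at hN
  have e2 : θ n * (√(2 * ρ * D) * lilScale α (s n)) = 2 * ρ * L n := by
    rw [hθ, lilScale, ← Real.sqrt_mul (by positivity), ← Real.sqrt_mul (by positivity)]
    have : 2 * ρ * L n / (D * w n) * (2 * ρ * D * (s n ^ (-(1 + 2 * α)) *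
        Real.log (Real.log (1 / s n)))) = (2 * ρ * L n) ^ 2 := by
      change 2 * ρ * L n / (D * w n) * (2 * ρ * D * (w n * L n)) = _
      field_simp
    rw [this, Real.sqrt_sq (by positivity)]
  have h3 : 1 ≤ κ * (2 * ρ * L n) := by
    rw [div_le_iff₀ (by positivity)] at hLn
    linarith
  refine le_of_mul_le_mul_left ?_ hθ0
  calc θ n * ∑ k ∈ Finset.range N, u n k * X k ω ≤ 2 * ρ * L n + 1 := hN
    _ ≤ (1 + κ) * (2 * ρ * L n) := by linarith
    _ = _ := by rw [← e2]; ring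

end IsBoundedNoise

end BoundedNoise

/-! ### Upper half of the law -/

lemma summable_exp_neg_mul_log {r : ℝ} (hr : 1 < r) :
    Summable fun n : ℕ => Real.exp (-r * Real.log n) := by
  rw [← summable_nat_add_iff 1]
  have h := (summable_nat_add_iff 1).2 (Real.summable_nat_rpow_inv.2 hr)
  refine h.congr fun n => ?_
  have : (0 : ℝ) < ((n + 1 : ℕ) : ℝ) := by positivity
  rw [← Real.rpow_neg this.le, Real.rpow_def_of_pos this, mul_comm]

lemma tendsto_rpow_mul_tsum_dirichletWeight_sq {α : ℝ} (hα : -1 / 2 < α) (v : ℝ) :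
    Tendsto (fun s : ℝ => s ^ (1 + 2 * α) * (v * ∑' k, dirichletWeight α (1 / 2 + s) k ^ 2))
      (𝓝[>] 0) (𝓝 (v * Real.Gamma (1 + 2 * α) / 2 ^ (1 + 2 * α))) := by
  have h2 : Tendsto (fun s : ℝ => 2 * s) (𝓝[>] 0) (𝓝[>] 0) := by
    refine tendsto_nhdsWithin_iff.2 ⟨?_, ?_⟩
    · have : Tendsto (fun s : ℝ => 2 * s) (𝓝 0) (𝓝 (2 * 0)) := by
        exact (continuous_const.mul continuous_id).tendsto 0
      rw [mul_zero] at this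
      exact this.mono_left nhdsWithin_le_nhds
    · filter_upwards [self_mem_nhdsWithin] with s hs
      have : (0 : ℝ) < s := hs
      exact Set.mem_Ioi.2 (by linarith)
  have h1 := ((tendsto_rpow_mul_tsum_dirichletWeight (β := 2 * α) (by linarith)).comp h2).const_mul
    (v / 2 ^ (1 + 2 * α))
  rw [show v * Real.Gamma (1 + 2 * α) / 2 ^ (1 + 2 * α) =
    v / 2 ^ (1 + 2 * α) * Real.Gamma (1 + 2 * α) by ring]
  refine h1.congr' ?_
  filter_upwards [self_mem_nhdsWithin] with s hs
  have hs0 : (0 : ℝ) < s := hs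
  simp only [Function.comp]
  rw [tsum_dirichletWeight_sq, Real.mul_rpow (by norm_num) hs0.le]
  field_simp

lemma exists_mem_Icc_succ_of_tendsto_zero {s : ℕ → ℝ} (hs : Antitone s)
    (hlim : Tendsto s atTop (𝓝 0)) (n₀ : ℕ) {r : ℝ} (hr : 0 < r) (hr' : r < s n₀) :
    ∃ n, n₀ ≤ n ∧ r ∈ Set.Icc (s (n + 1)) (s n) := by
  have hex : ∃ m, s m ≤ r := (hlim.eventually_le_const hr).exists
  classical
  set m := Nat.find hex with hm
  have h1 : s m ≤ r := Nat.find_spec hex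
  have h2 : n₀ < m := by
    by_contra hcon
    exact absurd ((hs (not_lt.1 hcon)).trans h1) (not_le.2 hr')
  refine ⟨m - 1, by omega, ?_, ?_⟩
  · rwa [Nat.sub_add_cancel (by omega)]
  · exact (not_le.1 (Nat.find_min hex (m := m - 1) (by omega))).le

lemma rpow_succ_sub_rpow_le {p : ℝ} (hp0 : 0 ≤ p) (hp1 : p ≤ 1) {n : ℕ} (hn : 1 ≤ n) :
    ((n + 1 : ℕ) : ℝ) ^ p - (n : ℝ) ^ p ≤ p * (n : ℝ) ^ (p - 1) := by
  have h0 : (0 : ℝ) < n := by exact_mod_cast hn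
  have h1 := _root_.rpow_one_add_le_one_add_mul_self (s := 1 / (n : ℝ))
    (by have : 0 < 1 / (n : ℝ) := by positivity
        linarith) hp0 hp1
  have e : ((n + 1 : ℕ) : ℝ) = n * (1 + 1 / (n : ℝ)) := by push_cast; field_simp
  rw [e, Real.mul_rpow h0.le (by positivity), Real.rpow_sub h0, Real.rpow_one]
  calc (n : ℝ) ^ p * (1 + 1 / (n : ℝ)) ^ p - (n : ℝ) ^ p ≤
      (n : ℝ) ^ p * (1 + p * (1 / (n : ℝ))) - (n : ℝ) ^ p := by gcongr
    _ = _ := by ring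

/-- The relative gap of the grid is of order `p n^(p-1)`, and since `p < 1` it beats the factor `log
n + 1`. A geometric grid would be too sparse here. -/
lemma exists_oscillation_exp_neg_rpow_le {α : ℝ} (hα : -1 / 2 < α) {p : ℝ} (hp0 : 0 < p) (hp1 : p < 1)
    {s : ℕ → ℝ} (hs : s = fun n : ℕ => Real.exp (-(n : ℝ) ^ p)) (K : ℝ) (hK : 0 < K)
    {ε : ℝ} (hε : 0 < ε) :
    ∀ᶠ n : ℕ in atTop, K * (s n - s (n + 1)) * (Real.log n + 1) * s (n + 1) ^ (-(3 / 2 + α)) ≤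
      ε * s n ^ (-(1 / 2 + α)) := by
  have hcast : Tendsto (fun n : ℕ => (n : ℝ)) atTop atTop := tendsto_natCast_atTop_atTop
  have h1 : Tendsto (fun n : ℕ => (n : ℝ) ^ (p - 1)) atTop (𝓝 0) := by
    have := (tendsto_rpow_neg_atTop (sub_pos.2 hp1)).comp hcast
    simpa [Function.comp_def] using this
  have h2 : Tendsto (fun n : ℕ => (n : ℝ) ^ (p - 1) * (Real.log n + 1)) atTop (𝓝 0) := by
    have h3 := ((isLittleO_log_rpow_atTop (sub_pos.2 hp1)).tendsto_div_nhds_zero).comp hcast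
    have h4 := h3.add h1
    rw [add_zero] at h4
    refine h4.congr' ?_
    filter_upwards [eventually_ge_atTop 1] with n hn
    have h0 : (0 : ℝ) < n := by exact_mod_cast hn
    simp only [Function.comp]
    rw [show p - 1 = -(1 - p) by ring, Real.rpow_neg h0.le]
    ring
  have h3 := h2.const_mul (K * 2 * p * Real.exp (1 / 2 + α))
  rw [mul_zero] at h3
  filter_upwards [h3.eventually_le_const hε, h1.eventually_le_const one_pos,
    eventually_ge_atTop 1] with n hn hn1 hn0
  have hn0' : (0 : ℝ) < n := by exact_mod_cast hn0
  have hlog : 0 ≤ Real.log n := Real.log_natCast_nonneg n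
  set x := ((n + 1 : ℕ) : ℝ) ^ p - (n : ℝ) ^ p with hx
  have hx0 : 0 ≤ x := sub_nonneg.2 (Real.rpow_le_rpow hn0'.le (by push_cast; linarith) hp0.le)
  have hxp : x ≤ p * (n : ℝ) ^ (p - 1) := rpow_succ_sub_rpow_le hp0.le hp1.le hn0
  have hx1 : x ≤ 1 := hxp.trans (by nlinarith)
  have hs0 : ∀ n, 0 < s n := fun n => by rw [hs]; exact Real.exp_pos _
  have e1 : s n = s (n + 1) * Real.exp x := by
    simp only [hs, hx]
    rw [← Real.exp_add]; ring_nf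
  have h4 : Real.exp x - 1 ≤ 2 * x := by
    have := Real.abs_exp_sub_one_le (x := x) (by rwa [abs_of_nonneg hx0])
    rw [abs_of_nonneg hx0] at this
    exact (le_abs_self _).trans this
  have h5 : s (n + 1) ^ (-(1 / 2 + α)) ≤ Real.exp (1 / 2 + α) * s n ^ (-(1 / 2 + α)) := by
    rw [e1, Real.mul_rpow (hs0 _).le (Real.exp_pos _).le, ← Real.exp_mul]
    have h6 : 1 ≤ Real.exp (1 / 2 + α) * Real.exp (x * -(1 / 2 + α)) := by
      rw [← Real.exp_add, Real.one_le_exp_iff]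
      nlinarith
    have := hs0 (n + 1)
    calc s (n + 1) ^ (-(1 / 2 + α)) ≤ s (n + 1) ^ (-(1 / 2 + α)) *
        (Real.exp (1 / 2 + α) * Real.exp (x * -(1 / 2 + α))) := le_mul_of_one_le_right (by positivity) h6
      _ = _ := by ring
  have h7 : s (n + 1) ^ (-(3 / 2 + α)) * s (n + 1) = s (n + 1) ^ (-(1 / 2 + α)) := by
    nth_rewrite 2 [← Real.rpow_one (s (n + 1))]
    rw [← Real.rpow_add (hs0 _)]
    ring_nf
  have hsn := hs0 n
  have hsn1 := hs0 (n + 1)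
  calc K * (s n - s (n + 1)) * (Real.log n + 1) * s (n + 1) ^ (-(3 / 2 + α)) =
      K * (Real.exp x - 1) * (Real.log n + 1) * s (n + 1) ^ (-(1 / 2 + α)) := by
        rw [← h7, e1]; ring
    _ ≤ K * (2 * (p * (n : ℝ) ^ (p - 1))) * (Real.log n + 1) *
        (Real.exp (1 / 2 + α) * s n ^ (-(1 / 2 + α))) := by
        gcongr
        exact h4.trans (by gcongr)
    _ = (K * 2 * p * Real.exp (1 / 2 + α) * ((n : ℝ) ^ (p - 1) * (Real.log n + 1))) *
        s n ^ (-(1 / 2 + α)) := by ring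
    _ ≤ _ := by gcongr

section BoundedNoise

variable {Ω : Type*} [MeasurableSpace Ω] {P : Measure Ω} [IsProbabilityMeasure P]

namespace IsBoundedNoise

variable {X : ℕ → Ω → ℝ} {v : ℝ}

lemma ae_boundedSums (h : IsBoundedNoise X P v) (α : ℝ) :
    ∀ᵐ ω ∂P, BoundedSums α fun k => X k ω :=
  _root_.ae_boundedSums h.indep h.meas
    (fun k => MemLp.of_bound (h.meas k).aestronglyMeasurable _ (ae_of_all _ (h.bdd k)))
    h.mean h.var_le α

/-- Upper half of the law of the iterated logarithm. -/
theorem ae_eventually_le_lilScale (h : IsBoundedNoise X P v) (hv : 0 < v) {α : ℝ}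
    (hα : -1 / 2 < α) {A : ℝ} (hA : √(v * Real.Gamma (1 + 2 * α) / 2 ^ (2 * α)) < A) :
    ∀ᵐ ω ∂P, ∀ᶠ r in 𝓝[>] (0 : ℝ),
      dirichletSeries α (fun k => X k ω) (1 / 2 + r) ≤ A * lilScale α r := by
  have hΓ : 0 < Real.Gamma (1 + 2 * α) := Real.Gamma_pos_of_pos (by linarith)
  set c := v * Real.Gamma (1 + 2 * α) / 2 ^ (1 + 2 * α) with hc
  have hc0 : 0 < c := by positivity
  have hc2 : v * Real.Gamma (1 + 2 * α) / 2 ^ (2 * α) = 2 * c := by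
    rw [hc, Real.rpow_add (by norm_num), Real.rpow_one]
    field_simp
  rw [hc2] at hA
  -- By continuity: at `κ = 0` the expression is `√(2c) < A`.
  obtain ⟨κ, hκA, hκ0, hκ1⟩ : ∃ κ : ℝ,
      (1 + κ) * √(2 * ((1 + κ) / (1 - κ)) * ((1 + κ) * c)) + κ < A ∧ 0 < κ ∧ κ < 1 := by
    have hcont : ContinuousAt (fun κ : ℝ =>
        (1 + κ) * √(2 * ((1 + κ) / (1 - κ)) * ((1 + κ) * c)) + κ) 0 := by
      have : ContinuousAt (fun κ : ℝ => (1 + κ) / (1 - κ)) 0 :=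
        ContinuousAt.div (by fun_prop) (by fun_prop) (by norm_num)
      fun_prop
    have h1 := hcont.tendsto.mono_left (nhdsWithin_le_nhds (s := Set.Ioi 0))
    have h2 := h1.eventually_lt_const (u := A) (by simpa using hA)
    obtain ⟨κ, hκ⟩ := (h2.and (Ioo_mem_nhdsGT (zero_lt_one' ℝ))).exists
    exact ⟨κ, hκ.1, hκ.2.1, hκ.2.2⟩
  -- Chosen so that the Chernoff exponent `ρ (1 - κ)` equals `1 + κ`.
  set ρ := (1 + κ) / (1 - κ) with hρ
  have hρ0 : 0 < ρ := div_pos (by linarith) (by linarith)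
  have hρκ : ρ * (1 - κ) = 1 + κ := by rw [hρ]; field_simp [(by linarith : 1 - κ ≠ 0)]
  -- Below 1, so that oscillation is negligible, yet `(1 + κ) p > 1`, so that `n^(-(1+κ)p)` is
  -- summable.
  set p := 1 / (1 + κ / 2) with hp
  have hp0 : 0 < p := by positivity
  have hp1 : p < 1 := by rw [hp, div_lt_one (by positivity)]; linarith
  set s : ℕ → ℝ := fun n : ℕ => Real.exp (-(n : ℝ) ^ p) with hs
  have hs0 : ∀ n, 0 < s n := fun n => Real.exp_pos _
  have hanti : StrictAnti s := by
    intro a b hab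
    apply Real.exp_lt_exp.2
    apply neg_lt_neg
    exact Real.rpow_lt_rpow (Nat.cast_nonneg _) (by exact_mod_cast hab) hp0
  have hlim : Tendsto s atTop (𝓝 0) := by
    apply Real.tendsto_exp_neg_atTop_nhds_zero.comp
    exact (tendsto_rpow_atTop hp0).comp tendsto_natCast_atTop_atTop
  have hs' : Tendsto s atTop (𝓝[>] 0) :=
    tendsto_nhdsWithin_iff.2 ⟨hlim, Eventually.of_forall hs0⟩
  have hvar : ∀ᶠ n in atTop, v * ∑' k, dirichletWeight α (1 / 2 + s n) k ^ 2 ≤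
      ((1 + κ) * c) * s n ^ (-(1 + 2 * α)) := by
    have h1 := (tendsto_rpow_mul_tsum_dirichletWeight_sq hα v).comp hs'
    filter_upwards [h1.eventually_le_const (by nlinarith : c < (1 + κ) * c)] with n hn
    simp only [Function.comp] at hn
    rw [Real.rpow_neg (hs0 n).le, ← div_eq_mul_inv, le_div_iff₀ (Real.rpow_pos_of_pos (hs0 n) _)]
    linarith
  have hsum : Summable fun n => Real.exp (-(ρ * (1 - κ)) * Real.log (Real.log (1 / s n))) := by
    have h1 : 1 < (1 + κ) * p := by
      rw [hp, mul_one_div, one_lt_div (by positivity)]; linarith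
    refine (summable_exp_neg_mul_log h1).congr fun n => ?_
    congr 1
    rw [hρκ, hs]
    simp only
    rw [one_div, Real.log_inv, Real.log_exp, neg_neg]
    rcases Nat.eq_zero_or_pos n with rfl | hn
    · simp [Real.zero_rpow hp0.ne']
    · rw [Real.log_rpow (by exact_mod_cast hn)]
      ring
  have hgrid := h.ae_eventually_frequently_sum_le_lilScale hα hs0 hlim
    (u := fun n k => dirichletWeight α (1 / 2 + s n) k) (fun n k => dirichletWeight_nonneg _ _ _)
    (fun n k => le_rfl) (by positivity) hvar hρ0 hκ0 hsum
  obtain ⟨K, hK, hosc⟩ := h.exists_ae_eventually_oscillation_le hα hs0 hanti hlim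
  have hsmall := exists_oscillation_exp_neg_rpow_le hα hp0 hp1 hs K hK hκ0
  filter_upwards [hgrid, hosc, h.ae_boundedSums α] with ω h1 h2 h3
  obtain ⟨n₀, hn₀⟩ := eventually_atTop.1 (((h1.and (h2 h3)).and (hsmall.and
    ((tendsto_log_log_one_div_nhdsGT_zero.comp hs').eventually_ge_atTop 1))).and
    (hlim.eventually_le_const (Real.exp_pos (-1))))
  filter_upwards [Ioo_mem_nhdsGT (hs0 n₀)] with r hr
  obtain ⟨n, hn, hrn⟩ := exists_mem_Icc_succ_of_tendsto_zero hanti.antitone hlim n₀ hr.1 hr.2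
  obtain ⟨⟨⟨g1, g2⟩, g3, g4⟩, g5⟩ := hn₀ n hn
  have k1 : dirichletSeries α (fun k => X k ω) (1 / 2 + s n) ≤
      (1 + κ) * √(2 * ρ * ((1 + κ) * c)) * lilScale α (s n) :=
    le_of_tendsto_of_frequently (h3.tendsto_weightedSum (hs0 n)) g1
  have k2 := (abs_le.1 (g2 r hrn)).2
  have k3 : s n ^ (-(1 / 2 + α)) ≤ lilScale α (s n) := rpow_le_lilScale (hs0 n) g4
  have k4 := lilScale_le_lilScale hα hr.1 hrn.2 g5
  have k5 : 0 ≤ lilScale α r := Real.sqrt_nonneg _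
  set q := (1 + κ) * √(2 * ρ * ((1 + κ) * c)) with hq
  have hq0 : 0 ≤ q := by positivity
  calc dirichletSeries α (fun k => X k ω) (1 / 2 + r) ≤
      q * lilScale α (s n) + κ * s n ^ (-(1 / 2 + α)) := by linarith
    _ ≤ q * lilScale α r + κ * lilScale α r := by
        gcongr
        exact k3.trans k4
    _ = (q + κ) * lilScale α r := by ring
    _ ≤ A * lilScale α r := by gcongr

end IsBoundedNoise

end BoundedNoise

/-! ### Lower deviations, independent blocks and their variance -/

section LowerDeviation

variable {Ω : Type*} [MeasurableSpace Ω] {P : Measure Ω} [IsProbabilityMeasure P]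

/-- Lower bound for a large deviation probability, from two-sided Gaussian bounds on the moment
generating function. -/
lemma le_measureReal_of_mgf_bounds {Y : Ω → ℝ} (hY : Measurable Y) {B : ℝ} (hB : ∀ ω, |Y ω| ≤ B)
    {x δ : ℝ} (hx : 0 ≤ x) (hδ0 : 0 < δ) (hδ1 : δ < 1)
    (h0 : Real.exp (x ^ 2 * (1 - δ ^ 2 / 10) / 2) ≤ ∫ ω, Real.exp (x * Y ω) ∂P)
    (h1 : ∀ θ : ℝ, |θ| ≤ 2 →
      ∫ ω, Real.exp (θ * x * Y ω) ∂P ≤ Real.exp (θ ^ 2 * x ^ 2 * (1 + δ ^ 2 / 10) / 2))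
    (hr : 4 ≤ Real.exp (x ^ 2 * δ ^ 2 / 4)) :
    1 / 2 * Real.exp (-(x ^ 2 * (1 + 3 * δ) / 2)) ≤ P.real {ω | (1 - δ) * x ≤ Y ω} := by
  set r := x ^ 2 with hrdef
  have hr0 : 0 ≤ r := sq_nonneg x
  have hE : MeasurableSet {ω | (1 - δ) * x ≤ Y ω} := measurableSet_le measurable_const hY
  have hint : ∀ a : ℝ, Integrable (fun ω => Real.exp (a * Y ω)) P := fun a =>
    integrable_exp_of_abs_le (M := |a| * B) (hY.const_mul a) fun ω => by
      rw [abs_mul]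
      exact mul_le_mul_of_nonneg_left (hB ω) (abs_nonneg a)
  have hi1 := (hint ((1 + δ) * x)).const_mul (Real.exp (-(δ * (1 + δ) * r)))
  have hi2 := (hint ((1 - δ) * x)).const_mul (Real.exp (δ * (1 - δ) * r))
  have hi3 : Integrable ({ω | (1 - δ) * x ≤ Y ω}.indicator fun _ => Real.exp (r * (1 + δ))) P :=
    (integrable_const _).indicator hE
  -- Split according to `Y` below, inside or above the window `[(1-δ)x, (1+δ)x]`. Below and above
  -- it, the tilts `1 - δ` and `1 + δ` dominate with an exponentially small prefactor; inside it,
  -- `exp (xY)` is at most its value at the right end.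
  have hpt : ∀ ω, Real.exp (x * Y ω) ≤
      Real.exp (-(δ * (1 + δ) * r)) * Real.exp ((1 + δ) * x * Y ω) +
      Real.exp (δ * (1 - δ) * r) * Real.exp ((1 - δ) * x * Y ω) +
      {ω | (1 - δ) * x ≤ Y ω}.indicator (fun _ => Real.exp (r * (1 + δ))) ω := by
    intro ω
    have p3 : 0 ≤ {ω | (1 - δ) * x ≤ Y ω}.indicator (fun _ => Real.exp (r * (1 + δ))) ω :=
      Set.indicator_nonneg (fun _ _ => (Real.exp_pos _).le) ω
    rw [← Real.exp_add, ← Real.exp_add]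
    have p1 := Real.exp_pos (-(δ * (1 + δ) * r) + (1 + δ) * x * Y ω)
    have p2 := Real.exp_pos (δ * (1 - δ) * r + (1 - δ) * x * Y ω)
    by_cases c1 : (1 - δ) * x ≤ Y ω
    · by_cases c2 : Y ω ≤ (1 + δ) * x
      · have : Real.exp (x * Y ω) ≤ Real.exp (r * (1 + δ)) := by
          apply Real.exp_le_exp.2
          rw [hrdef]
          nlinarith
        rw [Set.indicator_of_mem (by exact c1)]
        linarith
      · have : Real.exp (x * Y ω) ≤ Real.exp (-(δ * (1 + δ) * r) + (1 + δ) * x * Y ω) := by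
          apply Real.exp_le_exp.2
          rw [hrdef]
          have h5 : 0 ≤ δ * x * (Y ω - (1 + δ) * x) :=
            mul_nonneg (mul_nonneg hδ0.le hx) (by linarith [not_le.1 c2])
          nlinarith
        linarith
    · have : Real.exp (x * Y ω) ≤ Real.exp (δ * (1 - δ) * r + (1 - δ) * x * Y ω) := by
        apply Real.exp_le_exp.2
        rw [hrdef]
        have h5 : 0 ≤ δ * x * ((1 - δ) * x - Y ω) :=
          mul_nonneg (mul_nonneg hδ0.le hx) (by linarith [not_le.1 c1])
        nlinarith
      linarith
  have hi12 : Integrable (fun ω => Real.exp (-(δ * (1 + δ) * r)) * Real.exp ((1 + δ) * x * Y ω) +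
      Real.exp (δ * (1 - δ) * r) * Real.exp ((1 - δ) * x * Y ω)) P := hi1.add hi2
  have hmain : Real.exp (r * (1 - δ ^ 2 / 10) / 2) ≤
      Real.exp (-(δ * (1 + δ) * r)) * Real.exp ((1 + δ) ^ 2 * r * (1 + δ ^ 2 / 10) / 2) +
      Real.exp (δ * (1 - δ) * r) * Real.exp ((1 - δ) ^ 2 * r * (1 + δ ^ 2 / 10) / 2) +
      P.real {ω | (1 - δ) * x ≤ Y ω} * Real.exp (r * (1 + δ)) := by
    refine h0.trans ((integral_mono (hint x) (hi12.add hi3) hpt).trans ?_)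
    rw [integral_add' hi12 hi3, integral_add hi1 hi2, integral_const_mul, integral_const_mul,
      integral_indicator_const _ hE, smul_eq_mul]
    gcongr
    · exact h1 (1 + δ) (by rw [abs_of_pos] <;> linarith)
    · exact h1 (1 - δ) (by rw [abs_of_pos] <;> linarith)
  have hδ2 : δ ^ 2 ≤ 1 := by nlinarith
  have hb1 : Real.exp (-(δ * (1 + δ) * r)) * Real.exp ((1 + δ) ^ 2 * r * (1 + δ ^ 2 / 10) / 2) ≤
      Real.exp (r * (1 - δ ^ 2 * (3 / 5)) / 2) := by
    rw [← Real.exp_add]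
    apply Real.exp_le_exp.2
    have : (1 + δ) ^ 2 ≤ 4 := by nlinarith
    have h6 : (1 + δ) ^ 2 * (δ ^ 2 * r) ≤ 4 * (δ ^ 2 * r) := by gcongr
    linarith
  have hb2 : Real.exp (δ * (1 - δ) * r) * Real.exp ((1 - δ) ^ 2 * r * (1 + δ ^ 2 / 10) / 2) ≤
      Real.exp (r * (1 - δ ^ 2 * (3 / 5)) / 2) := by
    rw [← Real.exp_add]
    apply Real.exp_le_exp.2
    have : (1 - δ) ^ 2 ≤ 4 := by nlinarith
    have h6 : (1 - δ) ^ 2 * (δ ^ 2 * r) ≤ 4 * (δ ^ 2 * r) := by gcongr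
    linarith
  -- By the lower bound on `x² δ²`, each tail is at most a quarter of the total, which leaves at
  -- least half for the remaining term.
  have hb3 : 4 * Real.exp (r * (1 - δ ^ 2 * (3 / 5)) / 2) ≤ Real.exp (r * (1 - δ ^ 2 / 10) / 2) := by
    calc 4 * Real.exp (r * (1 - δ ^ 2 * (3 / 5)) / 2) ≤
        Real.exp (r * δ ^ 2 / 4) * Real.exp (r * (1 - δ ^ 2 * (3 / 5)) / 2) := by gcongr
      _ = _ := by rw [← Real.exp_add]; congr 1; ring
  have hfin : 1 / 2 * Real.exp (r * (1 - δ ^ 2 / 10) / 2) ≤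
      P.real {ω | (1 - δ) * x ≤ Y ω} * Real.exp (r * (1 + δ)) := by linarith
  have he : Real.exp (-(r * (1 + 3 * δ) / 2)) * Real.exp (r * (1 + δ)) ≤
      Real.exp (r * (1 - δ ^ 2 / 10) / 2) := by
    rw [← Real.exp_add]
    apply Real.exp_le_exp.2
    have h6 : r * (δ ^ 2 / 10) ≤ r * δ := by
      apply mul_le_mul_of_nonneg_left _ hr0
      nlinarith
    linarith
  refine le_of_mul_le_mul_right ?_ (Real.exp_pos (r * (1 + δ)))
  linarith

/-- Induction on the finite set of events: the new block and the union of the earlier blocks are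
disjoint, so the corresponding families of coordinates are independent. -/
lemma iIndepFun_sum_of_disjoint {X : ℕ → Ω → ℝ} (hX : iIndepFun X P) (hm : ∀ k, Measurable (X k))
    {J : ℕ → Finset ℕ} (hJ : Pairwise fun i j => Disjoint (J i) (J j)) (c : ℕ → ℕ → ℝ) :
    iIndepFun (fun n ω => ∑ k ∈ J n, c n k * X k ω) P := by
  rw [iIndepFun_iff_measure_inter_preimage_eq_mul]
  intro S
  induction S using Finset.induction_on with
  | empty => simp
  | insert a S ha ih =>
    intro sets hsets
    have hS := ih (sets := sets) fun i hi => hsets i (Finset.mem_insert_of_mem hi)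
    rw [Finset.prod_insert ha, ← hS, Finset.set_biInter_insert]
    set T := S.biUnion J
    have hdisj : Disjoint (J a) T := by
      rw [Finset.disjoint_biUnion_right]
      intro i hi
      exact hJ (fun h => ha (h ▸ hi))
    have hind := hX.indepFun_finset (J a) T hdisj hm
    set A : Set (J a → ℝ) := {y | ∑ k : J a, c a k * y k ∈ sets a} with hA
    -- The default 0 is never reached, since each `J i` with `i ∈ S` lies in `T`; it only lets the
    -- sums be written as functions on `T`.
    set B : Set (T → ℝ) := {y | ∀ i ∈ S, ∑ k ∈ J i,
      c i k * (if h : k ∈ T then y ⟨k, h⟩ else 0) ∈ sets i} with hB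
    have hAm : MeasurableSet A :=
      (Finset.measurable_sum _ fun k _ => (measurable_pi_apply k).const_mul _)
        (hsets a (Finset.mem_insert_self _ _))
    have hBm : MeasurableSet B := by
      have : B = ⋂ i ∈ S, {y : T → ℝ | ∑ k ∈ J i,
          c i k * (if h : k ∈ T then y ⟨k, h⟩ else 0) ∈ sets i} := by
        ext y; simp [hB]
      rw [this]
      refine Finset.measurableSet_biInter S fun i hi => ?_
      refine (Finset.measurable_sum _ fun k _ => ?_) (hsets i (Finset.mem_insert_of_mem hi))
      by_cases h : k ∈ T
      · simp only [h, dif_pos]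
        exact (measurable_pi_apply _).const_mul _
      · simp only [h, dif_neg, not_false_eq_true]
        exact measurable_const
    have h1 := hind.measure_inter_preimage_eq_mul A B hAm hBm
    have eA : (fun ω (i : J a) => X i ω) ⁻¹' A =
        (fun ω => ∑ k ∈ J a, c a k * X k ω) ⁻¹' sets a := by
      ext ω
      simp only [hA, Set.mem_preimage, Set.mem_ofPred_eq]
      rw [Finset.sum_coe_sort (J a) fun k => c a k * X k ω]
    have eB : (fun ω (i : T) => X i ω) ⁻¹' B =
        ⋂ i ∈ S, (fun ω => ∑ k ∈ J i, c i k * X k ω) ⁻¹' sets i := by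
      ext ω
      simp only [hB, Set.mem_preimage, Set.mem_ofPred_eq, Set.mem_iInter]
      refine forall₂_congr fun i hi => ?_
      rw [Finset.sum_congr rfl fun k hk => ?_]
      rw [dif_pos (Finset.mem_biUnion.2 ⟨i, hi, hk⟩)]
    rw [eA, eB] at h1
    exact h1

end LowerDeviation

/-- The indices `k` for which `s log k` lies in `(1 / A, A]`. -/
noncomputable def logBlock (A s : ℝ) : Finset ℕ :=
  (Finset.range (⌈Real.exp (A / s)⌉₊ + 1)).filter
    fun k => 1 / A < s * Real.log k ∧ s * Real.log k ≤ A

/-- The range in the definition only provides finiteness: `s log k ≤ A` already forces `k ≤ exp (A /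
s)`, and `k = 0` fails the strict lower bound because `log 0 = 0`. -/
lemma mem_logBlock {A s : ℝ} (hA : 0 < A) (hs : 0 < s) {k : ℕ} :
    k ∈ logBlock A s ↔ 1 / A < s * Real.log k ∧ s * Real.log k ≤ A := by
  simp only [logBlock, Finset.mem_filter, Finset.mem_range, and_iff_right_iff_imp, and_imp]
  intro h1 h2
  have h0 : 0 < 1 / A := by positivity
  have hk : (0 : ℝ) < k := by
    rcases Nat.eq_zero_or_pos k with rfl | h
    · simp at h1; linarith [inv_pos.2 hA]
    · exact_mod_cast h
  have h3 : (k : ℝ) ≤ Real.exp (A / s) := by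
    rw [← Real.log_le_iff_le_exp hk, le_div_iff₀ hs]
    linarith
  have h4 : (k : ℝ) ≤ (⌈Real.exp (A / s)⌉₊ : ℝ) := h3.trans (Nat.le_ceil _)
  have : k ≤ ⌈Real.exp (A / s)⌉₊ := by exact_mod_cast h4
  omega

/-- With `t = s log k`, off the block either `A t ≤ 1` or `t > A`, so `1 ≤ A^(-m) (t^(-m) + t^m)`
for `k ≥ 2`. This shifts the exponent `2α` by `∓m`, and both sums keep the order `s^(-(1+2α))`.
Taking `m` as half of `1 + 2α` keeps `2α - m > -1`. -/
lemma exists_tsum_dirichletWeight_compl_logBlock_le {α : ℝ} (hα : -1 / 2 < α) :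
    ∃ C m : ℝ, 0 < C ∧ 0 < m ∧ ∀ A : ℝ, 0 < A → ∀ s : ℝ, 0 < s → s ≤ 1 / 2 →
      ∑' k, (if k ∈ logBlock A s then 0 else dirichletWeight α (1 / 2 + s) k) ^ 2 ≤
        C * A ^ (-m) * s ^ (-(1 + 2 * α)) := by
  set m := (1 + 2 * α) / 2 with hm
  have hm0 : 0 < m := by rw [hm]; linarith
  obtain ⟨C₁, hC₁, h₁⟩ := exists_tsum_dirichletWeight_le (β := 2 * α - m) (by rw [hm]; linarith)
  obtain ⟨C₂, hC₂, h₂⟩ := exists_tsum_dirichletWeight_le (β := 2 * α + m) (by linarith)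
  refine ⟨C₁ * 2 ^ (-(1 + (2 * α - m))) + C₂ * 2 ^ (-(1 + (2 * α + m))), m, by positivity, hm0,
    fun A hA s hs hs1 => ?_⟩
  have hsum1 := summable_dirichletWeight (2 * α - m) (by linarith : 1 < 1 + 2 * s)
  have hsum2 := summable_dirichletWeight (2 * α + m) (by linarith : 1 < 1 + 2 * s)
  have hpt : ∀ k, (if k ∈ logBlock A s then 0 else dirichletWeight α (1 / 2 + s) k) ^ 2 ≤
      A ^ (-m) * (s ^ (-m) * dirichletWeight (2 * α - m) (1 + 2 * s) k +
        s ^ m * dirichletWeight (2 * α + m) (1 + 2 * s) k) := by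
    intro k
    have n1 := dirichletWeight_nonneg (2 * α - m) (1 + 2 * s) k
    have n2 := dirichletWeight_nonneg (2 * α + m) (1 + 2 * s) k
    split_ifs with hk
    · rw [zero_pow two_ne_zero]
      positivity
    · rw [dirichletWeight_sq, show 2 * (1 / 2 + s) = 1 + 2 * s by ring]
      by_cases h2 : 2 ≤ k
      · have hl := log_pos_of_two_le (two_le_natCast h2)
        have hsl : 0 < s * Real.log k := by positivity
        rw [mem_logBlock hA hs] at hk
        have e1 : dirichletWeight (2 * α - m) (1 + 2 * s) k =
            dirichletWeight (2 * α) (1 + 2 * s) k * Real.log k ^ (-m) := by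
          simp only [dirichletWeight, h2, if_true, sub_eq_add_neg, Real.rpow_add hl]
          ring
        have e2 : dirichletWeight (2 * α + m) (1 + 2 * s) k =
            dirichletWeight (2 * α) (1 + 2 * s) k * Real.log k ^ m := by
          simp only [dirichletWeight, h2, if_true, Real.rpow_add hl]
          ring
        have key : 1 ≤ A ^ (-m) * ((s * Real.log k) ^ (-m) + (s * Real.log k) ^ m) := by
          by_cases h3 : 1 / A < s * Real.log k
          · have h4 : A < s * Real.log k := by
              by_contra hcon
              exact hk ⟨h3, not_lt.1 hcon⟩
            have h5 : 1 ≤ A ^ (-m) * (s * Real.log k) ^ m := by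
              rw [Real.rpow_neg hA.le, ← div_eq_inv_mul, one_le_div (by positivity)]
              exact Real.rpow_le_rpow hA.le h4.le hm0.le
            have h6 : 0 ≤ A ^ (-m) * (s * Real.log k) ^ (-m) := by positivity
            linarith
          · have h4 : A * (s * Real.log k) ≤ 1 := by
              have := not_lt.1 h3
              rw [le_div_iff₀ hA] at this
              linarith
            have h5 : 1 ≤ A ^ (-m) * (s * Real.log k) ^ (-m) := by
              rw [← Real.mul_rpow hA.le hsl.le]
              exact Real.one_le_rpow_of_pos_of_le_one_of_nonpos (by positivity) h4 (by linarith)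
            have h6 : 0 ≤ A ^ (-m) * (s * Real.log k) ^ m := by positivity
            linarith
        have n0 := dirichletWeight_nonneg (2 * α) (1 + 2 * s) k
        rw [Real.mul_rpow hs.le hl.le, Real.mul_rpow hs.le hl.le] at key
        rw [e1, e2]
        calc dirichletWeight (2 * α) (1 + 2 * s) k ≤ dirichletWeight (2 * α) (1 + 2 * s) k *
            (A ^ (-m) * (s ^ (-m) * Real.log k ^ (-m) + s ^ m * Real.log k ^ m)) :=
              le_mul_of_one_le_right n0 key
          _ = _ := by ring
      · have : dirichletWeight (2 * α) (1 + 2 * s) k = 0 := by simp [dirichletWeight, h2]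
        rw [this]
        positivity
  have hsumR := ((hsum1.mul_left (s ^ (-m))).add (hsum2.mul_left (s ^ m))).mul_left (A ^ (-m))
  have hsumL := Summable.of_nonneg_of_le (fun k => sq_nonneg _) hpt hsumR
  refine (hsumL.tsum_le_tsum hpt hsumR).trans ?_
  rw [tsum_mul_left, (hsum1.mul_left _).tsum_add (hsum2.mul_left _), tsum_mul_left, tsum_mul_left]
  have g1 := h₁ (2 * s) (by linarith) (by linarith)
  have g2 := h₂ (2 * s) (by linarith) (by linarith)
  calc _ ≤ A ^ (-m) * (s ^ (-m) * (C₁ * (2 * s) ^ (-(1 + (2 * α - m)))) +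
        s ^ m * (C₂ * (2 * s) ^ (-(1 + (2 * α + m))))) := by gcongr
    _ = _ := by
      have e1 : s ^ (-(1 + 2 * α)) = s ^ (-m) * s ^ (-(1 + (2 * α - m))) := by
        rw [← Real.rpow_add hs]; ring_nf
      have e2 : s ^ (-(1 + 2 * α)) = s ^ m * s ^ (-(1 + (2 * α + m))) := by
        rw [← Real.rpow_add hs]; ring_nf
      rw [Real.mul_rpow (by norm_num) hs.le, Real.mul_rpow (by norm_num) hs.le]
      have : (C₁ * 2 ^ (-(1 + (2 * α - m))) + C₂ * 2 ^ (-(1 + (2 * α + m)))) * A ^ (-m) *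
          s ^ (-(1 + 2 * α)) = A ^ (-m) * (C₁ * 2 ^ (-(1 + (2 * α - m))) * s ^ (-(1 + 2 * α)) +
          C₂ * 2 ^ (-(1 + (2 * α + m))) * s ^ (-(1 + 2 * α))) := by ring
      rw [this]
      nth_rewrite 1 [e1]
      rw [e2]
      ring

/-- As `s → 0` the block `k > exp (1/(A s))` escapes to infinity, where `u k ≥ (1 - ζ) v`. One `ζ`
is lost in the total variance, one off the block and one here, and `(1 - ζ)(1 - 2ζ) ≥ 1 - 3ζ`. -/
lemma eventually_le_sum_logBlock_mul {u : ℕ → ℝ} {v : ℝ} (hv : 0 < v)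
    (hlim : Tendsto u atTop (𝓝 v)) {α c : ℝ} (hc : 0 < c)
    (hcv : Tendsto (fun s : ℝ => s ^ (1 + 2 * α) *
      (v * ∑' k, dirichletWeight α (1 / 2 + s) k ^ 2)) (𝓝[>] 0) (𝓝 c))
    {ζ A : ℝ} (hζ : 0 < ζ) (hζ1 : ζ < 1) (hA : 0 < A)
    (hcompl : ∀ᶠ s : ℝ in 𝓝[>] 0, v * ∑' k, (if k ∈ logBlock A s then 0 else
      dirichletWeight α (1 / 2 + s) k) ^ 2 ≤ ζ * c * s ^ (-(1 + 2 * α))) :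
    ∀ᶠ s : ℝ in 𝓝[>] 0, (1 - 3 * ζ) * c * s ^ (-(1 + 2 * α)) ≤
      ∑ k ∈ logBlock A s, dirichletWeight α (1 / 2 + s) k ^ 2 * u k := by
  obtain ⟨K, hK⟩ := eventually_atTop.1 (hlim.eventually_const_le (by nlinarith : (1 - ζ) * v < v))
  have hbig : ∀ᶠ s : ℝ in 𝓝[>] 0, Real.log (max K 1 : ℕ) ≤ 1 / (A * s) := by
    have := tendsto_inv_nhdsGT_zero (𝕜 := ℝ) |>.const_mul_atTop (inv_pos.2 hA)
    filter_upwards [this.eventually_ge_atTop (Real.log (max K 1 : ℕ))] with s hs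
    rwa [one_div, mul_inv]
  filter_upwards [hcompl, hbig, hcv.eventually_const_le (by nlinarith : (1 - ζ) * c < c),
    self_mem_nhdsWithin] with s h1 h2 h3 hs
  have hs0 : (0 : ℝ) < s := hs
  set J := logBlock A s
  set w := s ^ (-(1 + 2 * α)) with hw
  have hw0 : 0 < w := Real.rpow_pos_of_pos hs0 _
  have htot : (1 - ζ) * c * w ≤ v * ∑' k, dirichletWeight α (1 / 2 + s) k ^ 2 := by
    rw [hw, Real.rpow_neg hs0.le, ← div_eq_mul_inv, div_le_iff₀ (Real.rpow_pos_of_pos hs0 _)]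
    linarith
  have hsplit : ∑' k, dirichletWeight α (1 / 2 + s) k ^ 2 =
      ∑ k ∈ J, dirichletWeight α (1 / 2 + s) k ^ 2 +
      ∑' k, (if k ∈ J then 0 else dirichletWeight α (1 / 2 + s) k) ^ 2 := by
    have hsum := summable_dirichletWeight_sq α hs0
    have hin : Summable fun k => if k ∈ J then dirichletWeight α (1 / 2 + s) k ^ 2 else 0 :=
      Summable.of_nonneg_of_le (fun k => by positivity)
        (fun k => by split_ifs <;> [exact le_rfl; positivity]) hsum
    have hout : Summable fun k => (if k ∈ J then 0 else dirichletWeight α (1 / 2 + s) k) ^ 2 :=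
      Summable.of_nonneg_of_le (fun k => by positivity)
        (fun k => by split_ifs <;> [simpa using sq_nonneg _; exact le_rfl]) hsum
    have e1 : ∑ k ∈ J, dirichletWeight α (1 / 2 + s) k ^ 2 =
        ∑' k, if k ∈ J then dirichletWeight α (1 / 2 + s) k ^ 2 else 0 := by
      rw [tsum_eq_sum (s := J) fun k hk => by simp [hk]]
      exact Finset.sum_congr rfl fun k hk => by simp [hk]
    rw [e1, ← hin.tsum_add hout]
    congr 1
    funext k
    split_ifs <;> simp
  have hJ : (1 - ζ) * (v * ∑ k ∈ J, dirichletWeight α (1 / 2 + s) k ^ 2) ≤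
      ∑ k ∈ J, dirichletWeight α (1 / 2 + s) k ^ 2 * u k := by
    rw [Finset.mul_sum, Finset.mul_sum]
    refine Finset.sum_le_sum fun k hk => ?_
    have hk1 := ((mem_logBlock hA hs0).1 hk).1
    have hk2 : Real.log (max K 1 : ℕ) < Real.log k := by
      refine h2.trans_lt ?_
      rw [div_lt_iff₀ (by positivity)]
      rw [div_lt_iff₀ hA] at hk1
      linarith
    have hmax : 0 < max K 1 := by positivity
    have hk0 : (0 : ℝ) < k := by
      rcases Nat.eq_zero_or_pos k with rfl | h'
      · have : 0 ≤ Real.log (max K 1 : ℕ) := Real.log_natCast_nonneg _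
        simp only [Nat.cast_zero, Real.log_zero] at hk2
        linarith
      · exact_mod_cast h'
    have hk3 : max K 1 < k := by
      have := (Real.log_lt_log_iff (by exact_mod_cast hmax) hk0).1 hk2
      exact_mod_cast this
    have := hK k (by omega)
    calc _ = dirichletWeight α (1 / 2 + s) k ^ 2 * ((1 - ζ) * v) := by ring
      _ ≤ _ := by gcongr
  refine le_trans ?_ hJ
  rw [hsplit, mul_add] at htot
  have h5 : (1 - 2 * ζ) * c * w ≤ v * ∑ k ∈ J, dirichletWeight α (1 / 2 + s) k ^ 2 := by linarith
  calc (1 - 3 * ζ) * c * w ≤ (1 - ζ) * ((1 - 2 * ζ) * c * w) := by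
        have : 0 ≤ ζ ^ 2 * (c * w) := by positivity
        nlinarith
    _ ≤ _ := mul_le_mul_of_nonneg_left h5 (by linarith)

section BoundedNoise

variable {Ω : Type*} [MeasurableSpace Ω] {P : Measure Ω} [IsProbabilityMeasure P]

namespace IsBoundedNoise

variable {X : ℕ → Ω → ℝ} {v : ℝ}

/-- The block sum is rescaled to nearly unit variance, so that the event becomes `Y ≥ (1 - δ) x`
with `x² = 2ρL`. With `ζ = δ²/50`, all errors in the variance and in the moment generating function
fit into the tolerance `δ²/10 = 5ζ`. -/
lemma eventually_le_measureReal_logBlock (h : IsBoundedNoise X P v) {α : ℝ} (hα : -1 / 2 < α)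
    {c : ℝ} (hc : 0 < c)
    (hcv : Tendsto (fun s : ℝ => s ^ (1 + 2 * α) *
      (v * ∑' k, dirichletWeight α (1 / 2 + s) k ^ 2)) (𝓝[>] 0) (𝓝 c))
    {δ ρ A : ℝ} (hδ0 : 0 < δ) (hδ1 : δ < 1) (hρ : 0 < ρ)
    (hvar : ∀ᶠ s : ℝ in 𝓝[>] 0, (1 - 3 * (δ ^ 2 / 50)) * c * s ^ (-(1 + 2 * α)) ≤
      ∑ k ∈ logBlock A s, dirichletWeight α (1 / 2 + s) k ^ 2 * ∫ ω, X k ω ^ 2 ∂P) :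
    ∀ᶠ s : ℝ in 𝓝[>] 0,
      1 / 2 * Real.exp (-(ρ * (1 + 3 * δ) * Real.log (Real.log (1 / s)))) ≤
      P.real {ω | (1 - δ) * √(2 * ρ * c) * lilScale α s ≤
        ∑ k ∈ logBlock A s, dirichletWeight α (1 / 2 + s) k * X k ω} := by
  set ζ := δ ^ 2 / 50 with hζ
  have hζ0 : 0 < ζ := by positivity
  have hζ1 : ζ ≤ 1 / 50 := by rw [hζ]; nlinarith
  obtain ⟨C, hC, hCw⟩ := exists_dirichletWeight_mul_sqrt_le α
  have hsmall := eventually_sqrt_mul_rpow_le hα (q := 2 * ρ / c) (by positivity)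
    (by positivity : 0 < ζ / 2) C
  have hL4 := (tendsto_log_log_one_div_nhdsGT_zero.const_mul_atTop
    (by positivity : 0 < 2 * ρ * δ ^ 2 / 4)).eventually_ge_atTop (Real.log 4)
  filter_upwards [hvar, hsmall, hL4, tendsto_log_log_one_div_nhdsGT_zero.eventually_gt_atTop 0,
    hcv.eventually_le_const (by nlinarith : c < (1 + ζ) * c), self_mem_nhdsWithin]
    with s hvars hsm hL4s hL0 hup hs
  have hs0 : (0 : ℝ) < s := hs
  set J := logBlock A s
  set w := s ^ (-(1 + 2 * α)) with hw
  set L := Real.log (Real.log (1 / s)) with hL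
  have hw0 : 0 < w := Real.rpow_pos_of_pos hs0 _
  set q := √(2 * ρ / c * L / w) with hq
  have hq0 : 0 < q := Real.sqrt_pos.2 (by positivity)
  have hq2 : q ^ 2 * (c * w) = 2 * ρ * L := by
    rw [hq, Real.sq_sqrt (by positivity)]
    field_simp
  set x := √(2 * ρ * L) with hx
  have hx0 : 0 < x := Real.sqrt_pos.2 (by positivity)
  have hx2 : x ^ 2 = 2 * ρ * L := Real.sq_sqrt (by positivity)
  set Y : Ω → ℝ := fun ω => q / x * ∑ k ∈ J, dirichletWeight α (1 / 2 + s) k * X k ω with hY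
  have hYm : Measurable Y := (h.measurable_sum _ J).const_mul _
  have hexp : ∀ θ ω, θ * x * Y ω =
      ∑ k ∈ J, (θ * (q * dirichletWeight α (1 / 2 + s) k)) * X k ω := by
    intro θ ω
    have e : θ * x * (q / x * ∑ k ∈ J, dirichletWeight α (1 / 2 + s) k * X k ω) =
        θ * q * ∑ k ∈ J, dirichletWeight α (1 / 2 + s) k * X k ω := by field_simp
    simp only [hY]
    rw [e, Finset.mul_sum]
    exact Finset.sum_congr rfl fun k _ => by ring
  have hcoef : ∀ θ : ℝ, |θ| ≤ 2 → ∀ k : ℕ,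
      |θ * (q * dirichletWeight α (1 / 2 + s) k)| * (2 * √(k : ℝ)) ≤ ζ := by
    intro θ hθ k
    have n0 := dirichletWeight_nonneg α (1 / 2 + s) k
    rw [abs_mul, abs_of_nonneg (mul_nonneg hq0.le n0)]
    calc |θ| * (q * dirichletWeight α (1 / 2 + s) k) * (2 * √(k : ℝ)) =
        |θ| * (q * (dirichletWeight α (1 / 2 + s) k * (2 * √(k : ℝ)))) := by ring
      _ ≤ 2 * (q * (C * s ^ (-max α 0))) := by
        have := hCw s hs0 k
        gcongr
      _ ≤ ζ := by linarith
  have hupper : ∀ θ : ℝ, |θ| ≤ 2 →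
      ∫ ω, Real.exp (θ * x * Y ω) ∂P ≤ Real.exp (θ ^ 2 * x ^ 2 * (1 + δ ^ 2 / 10) / 2) := by
    intro θ hθ
    simp only [hexp]
    refine (h.integral_exp_sum_le (by linarith) (hcoef θ hθ) J).trans (Real.exp_le_exp.2 ?_)
    simp only [mul_pow]
    rw [← Finset.mul_sum, ← Finset.mul_sum]
    have h1 : v * ∑ k ∈ J, dirichletWeight α (1 / 2 + s) k ^ 2 ≤ (1 + ζ) * c * w := by
      have h2 : ∑ k ∈ J, dirichletWeight α (1 / 2 + s) k ^ 2 ≤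
          ∑' k, dirichletWeight α (1 / 2 + s) k ^ 2 :=
        (summable_dirichletWeight_sq α hs0).sum_le_tsum _ fun k _ => sq_nonneg _
      refine (mul_le_mul_of_nonneg_left h2 h.nonneg).trans ?_
      rw [hw, Real.rpow_neg hs0.le, ← div_eq_mul_inv, le_div_iff₀ (Real.rpow_pos_of_pos hs0 _)]
      linarith
    calc (1 + ζ) / 2 * (v * (θ ^ 2 * (q ^ 2 * ∑ k ∈ J, dirichletWeight α (1 / 2 + s) k ^ 2))) =
        (1 + ζ) / 2 * (θ ^ 2 * q ^ 2) * (v * ∑ k ∈ J, dirichletWeight α (1 / 2 + s) k ^ 2) := by ring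
      _ ≤ (1 + ζ) / 2 * (θ ^ 2 * q ^ 2) * ((1 + ζ) * c * w) := by gcongr
      _ = θ ^ 2 * x ^ 2 * ((1 + ζ) ^ 2) / 2 := by rw [hx2, ← hq2]; ring
      _ ≤ _ := by
        have : (1 + ζ) ^ 2 ≤ 1 + δ ^ 2 / 10 := by
          have : δ ^ 2 / 10 = 5 * ζ := by rw [hζ]; ring
          nlinarith
        gcongr
  have hlower : Real.exp (x ^ 2 * (1 - δ ^ 2 / 10) / 2) ≤ ∫ ω, Real.exp (x * Y ω) ∂P := by
    have h1 := h.le_integral_exp_sum (by linarith) (hcoef 1 (by norm_num)) J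
    have h2 : ∀ ω, x * Y ω = ∑ k ∈ J, (1 * (q * dirichletWeight α (1 / 2 + s) k)) * X k ω :=
      fun ω => by rw [← hexp, one_mul]
    simp only [← h2] at h1
    refine le_trans (Real.exp_le_exp.2 ?_) h1
    simp only [one_mul, mul_pow, mul_assoc]
    rw [← Finset.mul_sum]
    calc x ^ 2 * (1 - δ ^ 2 / 10) / 2 ≤ x ^ 2 * ((1 - ζ) ^ 2 * (1 - 3 * ζ) / 2) := by
          have : δ ^ 2 / 10 = 5 * ζ := by rw [hζ]; ring
          rw [this, mul_div_assoc]
          have h3 : 1 - 5 * ζ ≤ (1 - ζ) ^ 2 * (1 - 3 * ζ) := by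
            have : 0 ≤ ζ ^ 2 * (7 - 3 * ζ) := by
              apply mul_nonneg (sq_nonneg _); linarith
            nlinarith
          gcongr
      _ = (1 - ζ) ^ 2 / 2 * (q ^ 2 * ((1 - 3 * ζ) * c * w)) := by rw [hx2, ← hq2]; ring
      _ ≤ _ := mul_le_mul_of_nonneg_left (mul_le_mul_of_nonneg_left hvars (sq_nonneg q))
        (by positivity)
  have hr : 4 ≤ Real.exp (x ^ 2 * δ ^ 2 / 4) := by
    rw [← Real.log_le_iff_le_exp (by norm_num), hx2]
    linarith
  have hfin := le_measureReal_of_mgf_bounds (P := P) hYm (B := q / x * ∑ k ∈ J,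
    |dirichletWeight α (1 / 2 + s) k| * (2 * √(k : ℝ))) (fun ω => by
      rw [hY]
      simp only
      rw [abs_mul, abs_of_pos (by positivity)]
      exact mul_le_mul_of_nonneg_left (h.abs_sum_le _ J ω) (by positivity)) hx0.le hδ0 hδ1
    hlower hupper hr
  have eset : {ω | (1 - δ) * √(2 * ρ * c) * lilScale α s ≤
      ∑ k ∈ J, dirichletWeight α (1 / 2 + s) k * X k ω} = {ω | (1 - δ) * x ≤ Y ω} := by
    ext ω
    simp only [Set.mem_ofPred_eq, hY]
    have e1 : √(2 * ρ * c) * lilScale α s * q = x ^ 2 := by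
      rw [hx2, lilScale, hq, ← Real.sqrt_mul (by positivity), ← Real.sqrt_mul (by positivity)]
      have : 2 * ρ * c * (s ^ (-(1 + 2 * α)) * Real.log (Real.log (1 / s))) *
          (2 * ρ / c * L / w) = (2 * ρ * L) ^ 2 := by
        change 2 * ρ * c * (w * L) * (2 * ρ / c * L / w) = _
        field_simp
      rw [this, Real.sqrt_sq (by positivity)]
    have e2 : (1 - δ) * √(2 * ρ * c) * lilScale α s * q = (1 - δ) * x * x := by
      linear_combination (1 - δ) * e1
    rw [div_mul_eq_mul_div, le_div_iff₀ hx0, ← mul_le_mul_iff_left₀ hq0, e2, mul_comm q]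
  rw [eset]
  refine le_trans (le_of_eq ?_) hfin
  rw [hx2]
  ring_nf

end IsBoundedNoise

end BoundedNoise

/-! ### Lower half of the law -/

section BoundedNoise

variable {Ω : Type*} [MeasurableSpace Ω] {P : Measure Ω} [IsProbabilityMeasure P]

/-- Second Borel–Cantelli lemma, with divergence by comparison with the harmonic series. -/
lemma ae_frequently_mem_of_iIndepFun {B : ℕ → Ω → ℝ} (hB : iIndepFun B P)
    (hm : ∀ n, Measurable (B n)) {t : ℕ → ℝ} {κ : ℝ} (hκ : 0 < κ)
    (h : ∀ᶠ n : ℕ in atTop, κ * (1 / (n : ℝ)) ≤ P.real {ω | t n ≤ B n ω}) :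
    ∀ᵐ ω ∂P, ∃ᶠ n in atTop, t n ≤ B n ω := by
  set E : ℕ → Set Ω := fun n => {ω | t n ≤ B n ω}
  have hE : ∀ n, MeasurableSet (E n) := fun n => measurableSet_le measurable_const (hm n)
  have hind : iIndepSet E P := by
    rw [iIndepSet_iff_meas_biInter hE]
    intro S
    exact (iIndepFun_iff_measure_inter_preimage_eq_mul.1 hB) S (sets := fun n => Set.Ici (t n))
      fun i _ => measurableSet_Ici
  have hsum : ∑' n, P (E n) = ⊤ := by
    by_contra hcon
    have h1 := ENNReal.summable_toReal hcon
    obtain ⟨n₀, hn₀⟩ := eventually_atTop.1 h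
    refine Real.not_summable_one_div_natCast ?_
    rw [← summable_nat_add_iff n₀]
    have h2 := ((summable_nat_add_iff n₀).2 h1).mul_left κ⁻¹
    refine Summable.of_nonneg_of_le (fun n => by positivity) (fun n => ?_) h2
    have h3 := hn₀ (n + n₀) (by omega)
    rw [← div_eq_inv_mul, le_div_iff₀ hκ, mul_comm]
    exact h3
  have h1 := measure_limsup_eq_one hE hind hsum
  have hml : MeasurableSet (limsup E atTop) := MeasurableSet.measurableSet_limsup hE
  have h2 : ∀ᵐ ω ∂P, ω ∈ limsup E atTop := (prob_compl_eq_zero_iff hml).2 h1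
  filter_upwards [h2] with ω hω
  rw [limsup_eq_iInf_iSup_of_nat] at hω
  simp only [Set.iInf_eq_iInter, Set.iSup_eq_iUnion, Set.mem_iInter, Set.mem_iUnion] at hω
  rw [frequently_atTop]
  intro n
  obtain ⟨m, hm, hmE⟩ := hω n
  exact ⟨m, hm, hmE⟩

namespace IsBoundedNoise

variable {X : ℕ → Ω → ℝ} {v : ℝ}

/-- Lower half of the law of the iterated logarithm. -/
theorem ae_frequently_lilScale_le (h : IsBoundedNoise X P v) (hv : 0 < v)
    (hlim : Tendsto (fun k => ∫ ω, X k ω ^ 2 ∂P) atTop (𝓝 v)) {α : ℝ} (hα : -1 / 2 < α)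
    {A : ℝ} (hA : A < √(v * Real.Gamma (1 + 2 * α) / 2 ^ (2 * α))) :
    ∀ᵐ ω ∂P, ∃ᶠ r in 𝓝[>] (0 : ℝ),
      A * lilScale α r ≤ dirichletSeries α (fun k => X k ω) (1 / 2 + r) := by
  have hΓ : 0 < Real.Gamma (1 + 2 * α) := Real.Gamma_pos_of_pos (by linarith)
  set c := v * Real.Gamma (1 + 2 * α) / 2 ^ (1 + 2 * α) with hc
  have hc0 : 0 < c := by positivity
  have hc2 : v * Real.Gamma (1 + 2 * α) / 2 ^ (2 * α) = 2 * c := by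
    rw [hc, Real.rpow_add (by norm_num), Real.rpow_one]
    field_simp
  rw [hc2] at hA
  have hcv := tendsto_rpow_mul_tsum_dirichletWeight_sq hα v
  -- By continuity at `δ = 0`, where the block level is `√(2c)` and the subtracted off-block level
  -- vanishes.
  obtain ⟨δ, hδA, hδ0, hδ1⟩ : ∃ δ : ℝ,
      A < (1 - δ) * √(2 * (1 / (1 + 3 * δ)) * c) - (1 + 1 / 2) * √(2 * 4 * (δ ^ 2 / 50 * c)) ∧
        0 < δ ∧ δ < 1 := by
    have hcont : ContinuousAt (fun δ : ℝ => (1 - δ) * √(2 * (1 / (1 + 3 * δ)) * c) -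
        (1 + 1 / 2) * √(2 * 4 * (δ ^ 2 / 50 * c))) 0 := by
      have : ContinuousAt (fun δ : ℝ => 1 / (1 + 3 * δ)) 0 :=
        ContinuousAt.div (by fun_prop) (by fun_prop) (by norm_num)
      fun_prop
    have h1 := hcont.tendsto.mono_left (nhdsWithin_le_nhds (s := Set.Ioi 0))
    have h2 := h1.eventually_const_lt (u := A) (by simpa using hA)
    obtain ⟨δ, hδ⟩ := (h2.and (Ioo_mem_nhdsGT (zero_lt_one' ℝ))).exists
    exact ⟨δ, hδ.1, hδ.2.1, hδ.2.2⟩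
  set ζ := δ ^ 2 / 50 with hζ
  have hζ0 : 0 < ζ := by positivity
  have hζ1 : ζ < 1 := by rw [hζ]; nlinarith
  -- This makes the deviation exponent `ρ (1 + 3δ)` equal to 1, so the probabilities are bounded
  -- below by a multiple of `1/n`.
  set ρ := 1 / (1 + 3 * δ) with hρ
  have hρ0 : 0 < ρ := by positivity
  have hρδ : ρ * (1 + 3 * δ) = 1 := by rw [hρ]; field_simp
  obtain ⟨C, m, hC, hm, hcompl⟩ := exists_tsum_dirichletWeight_compl_logBlock_le hα
  obtain ⟨R, hR, hR1⟩ : ∃ R : ℝ, v * (C * R ^ (-m)) ≤ ζ * c ∧ 1 < R := by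
    have h1 := ((tendsto_rpow_neg_atTop hm).const_mul C).const_mul v
    rw [mul_zero, mul_zero] at h1
    obtain ⟨R, hR⟩ := ((h1.eventually_le_const (by positivity : 0 < ζ * c)).and
      (eventually_gt_atTop 1)).exists
    exact ⟨R, hR.1, hR.2⟩
  have hR0 : 0 < R := by linarith
  have hcompl' : ∀ᶠ s : ℝ in 𝓝[>] 0, v * ∑' k, (if k ∈ logBlock R s then 0 else
      dirichletWeight α (1 / 2 + s) k) ^ 2 ≤ ζ * c * s ^ (-(1 + 2 * α)) := by
    filter_upwards [Ioc_mem_nhdsGT (by norm_num : (0 : ℝ) < 1 / 2)] with s hs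
    have hw : 0 < s ^ (-(1 + 2 * α)) := Real.rpow_pos_of_pos hs.1 _
    calc _ ≤ v * (C * R ^ (-m) * s ^ (-(1 + 2 * α))) :=
          mul_le_mul_of_nonneg_left (hcompl R hR0 s hs.1 hs.2) hv.le
      _ = v * (C * R ^ (-m)) * s ^ (-(1 + 2 * α)) := by ring
      _ ≤ _ := by gcongr
  have hprob := h.eventually_le_measureReal_logBlock hα hc0 hcv hδ0 hδ1 hρ0
    (eventually_le_sum_logBlock_mul hv hlim hc0 hcv hζ0 hζ1 hR0 hcompl')
  -- Consecutive grid points then have ratio `R²`, exactly what makes the half-open blocks disjoint.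
  set b := 2 * Real.log R with hb
  have hb0 : 0 < b := mul_pos two_pos (Real.log_pos hR1)
  set s : ℕ → ℝ := fun n => Real.exp (-(b * n)) with hs
  have hs0 : ∀ n, 0 < s n := fun n => Real.exp_pos _
  have hslim : Tendsto s atTop (𝓝 0) := by
    apply Real.tendsto_exp_neg_atTop_nhds_zero.comp
    exact tendsto_natCast_atTop_atTop.const_mul_atTop hb0
  have hs' : Tendsto s atTop (𝓝[>] 0) :=
    tendsto_nhdsWithin_iff.2 ⟨hslim, Eventually.of_forall hs0⟩
  have hslog : ∀ n, Real.log (1 / s n) = b * n := fun n => by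
    rw [one_div, Real.log_inv, hs, Real.log_exp, neg_neg]
  set J : ℕ → Finset ℕ := fun n => logBlock R (s n)
  have hJlt : ∀ i j, i < j → Disjoint (J i) (J j) := by
    intro i j hij
    rw [Finset.disjoint_left]
    intro k hi hj
    have h1 := ((mem_logBlock hR0 (hs0 i)).1 hi).2
    have h2 := ((mem_logBlock hR0 (hs0 j)).1 hj).1
    have h3 : s j * R ^ 2 ≤ s i := by
      have e : R ^ 2 = Real.exp b := by
        rw [hb, mul_comm, Real.exp_mul, Real.exp_log hR0]; norm_num
      rw [e, hs, ← Real.exp_add]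
      apply Real.exp_le_exp.2
      have : (i : ℝ) + 1 ≤ j := by exact_mod_cast hij
      nlinarith
    have h4 : 0 ≤ Real.log k := Real.log_natCast_nonneg k
    have h5 : s j * R ^ 2 * Real.log k ≤ R := (mul_le_mul_of_nonneg_right h3 h4).trans h1
    rw [div_lt_iff₀ hR0] at h2
    nlinarith
  have hJ : Pairwise fun i j => Disjoint (J i) (J j) := by
    intro i j hij
    rcases lt_or_gt_of_ne hij with h' | h'
    · exact hJlt i j h'
    · exact (hJlt j i h').symm
  have hindep := iIndepFun_sum_of_disjoint h.indep h.meas hJ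
    fun n k => dirichletWeight α (1 / 2 + s n) k
  have hlow := ae_frequently_mem_of_iIndepFun hindep (fun n => h.measurable_sum _ (J n))
    (t := fun n => (1 - δ) * √(2 * ρ * c) * lilScale α (s n)) (κ := 1 / (2 * b)) (by positivity) (by
      filter_upwards [hs'.eventually hprob, eventually_ge_atTop 1] with n hn hn1
      refine le_trans (le_of_eq ?_) hn
      have h0 : (0 : ℝ) < n := by exact_mod_cast hn1
      rw [hρδ, one_mul, hslog, Real.exp_neg, Real.exp_log (by positivity)]
      field_simp)
  -- The off-block part is bounded below by applying the upper bound to the negated noise. No sharp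
  -- constant is needed since its variance carries the factor `ζ`; `ρ = 4` and `κ = 1/2` give the
  -- summable exponent 2.
  have hrest := h.neg.ae_eventually_frequently_sum_le_lilScale hα hs0 hslim
    (u := fun n k => if k ∈ J n then 0 else dirichletWeight α (1 / 2 + s n) k)
    (fun n k => by split_ifs <;> [exact le_rfl; exact dirichletWeight_nonneg _ _ _])
    (fun n k => by split_ifs <;> [exact dirichletWeight_nonneg _ _ _; exact le_rfl])
    (by positivity : 0 < ζ * c) (hs'.eventually hcompl') (ρ := 4) (κ := 1 / 2) (by norm_num)
    (by norm_num) (by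
      have h1 := (summable_exp_neg_mul_log (r := 2) (by norm_num)).mul_left
        (Real.exp (-2 * Real.log b))
      rw [← summable_nat_add_iff 1] at h1 ⊢
      refine h1.congr fun n => ?_
      rw [hslog, Real.log_mul hb0.ne' (by positivity), ← Real.exp_add]
      ring_nf)
  filter_upwards [hlow, hrest, h.ae_boundedSums α] with ω h1 h2 h3
  refine hs'.frequently ((h1.and_eventually h2).mono fun n hn => ?_)
  obtain ⟨g1, g2⟩ := hn
  set q := √(2 * 4 * (ζ * c))
  have g3 : ∃ᶠ N in atTop, (1 - δ) * √(2 * ρ * c) * lilScale α (s n) -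
      (1 + 1 / 2) * q * lilScale α (s n) ≤ weightedSum α (fun k => X k ω) (1 / 2 + s n) N := by
    have hev : ∀ᶠ N in atTop, J n ⊆ Finset.range N :=
      (Filter.tendsto_finset_range.eventually_ge_atTop (J n))
    refine (g2.and_eventually hev).mono fun N hN => ?_
    obtain ⟨hN1, hN2⟩ := hN
    have e : weightedSum α (fun k => X k ω) (1 / 2 + s n) N =
        ∑ k ∈ J n, dirichletWeight α (1 / 2 + s n) k * X k ω -
        ∑ k ∈ Finset.range N,
          (if k ∈ J n then 0 else dirichletWeight α (1 / 2 + s n) k) * -X k ω := by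
      have e1 : ∑ k ∈ J n, dirichletWeight α (1 / 2 + s n) k * X k ω =
          ∑ k ∈ Finset.range N,
            if k ∈ J n then dirichletWeight α (1 / 2 + s n) k * X k ω else 0 := by
        rw [← Finset.sum_filter]
        congr 1
        ext k
        simp only [Finset.mem_filter]
        exact ⟨fun hk => ⟨hN2 hk, hk⟩, fun hk => hk.2⟩
      rw [e1, ← Finset.sum_sub_distrib]
      refine Finset.sum_congr rfl fun k _ => ?_
      split_ifs <;> ring
    rw [e]
    linarith
  have g4 := ge_of_tendsto_of_frequently (h3.tendsto_weightedSum (hs0 n)) g3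
  have k5 : 0 ≤ lilScale α (s n) := Real.sqrt_nonneg _
  refine le_trans ?_ g4
  rw [← sub_mul]
  exact mul_le_mul_of_nonneg_right hδA.le k5

end IsBoundedNoise

end BoundedNoise

/-! ### Truncation and its removal -/

lemma abs_weightedSum_le_of_summable {α : ℝ} {C : ℝ} (hC : ∀ s : ℝ, 0 < s → ∀ k : ℕ,
    dirichletWeight α (1 / 2 + s) k * (2 * √(k : ℝ)) ≤ C * s ^ (-max α 0)) {x : ℕ → ℝ}
    (hx : Summable fun k => |x k| / √(k : ℝ)) {s : ℝ} (hs : 0 < s) (N : ℕ) :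
    |weightedSum α x (1 / 2 + s) N| ≤ C * s ^ (-max α 0) * ∑' k, |x k| / √(k : ℝ) := by
  have hC0 : 0 ≤ C * s ^ (-max α 0) := le_trans
    (mul_nonneg (dirichletWeight_nonneg α (1 / 2 + s) 0) (by positivity)) (hC s hs 0)
  unfold weightedSum
  refine (Finset.abs_sum_le_sum_abs _ _).trans ?_
  calc ∑ k ∈ Finset.range N, |dirichletWeight α (1 / 2 + s) k * x k| ≤
      ∑ k ∈ Finset.range N, C * s ^ (-max α 0) * (|x k| / √(k : ℝ)) := by
        refine Finset.sum_le_sum fun k _ => ?_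
        have n0 := dirichletWeight_nonneg α (1 / 2 + s) k
        rw [abs_mul, abs_of_nonneg n0]
        rcases Nat.eq_zero_or_pos k with rfl | hk
        · simp [dirichletWeight]
        · have hk0 : 0 < √(k : ℝ) := Real.sqrt_pos.2 (by exact_mod_cast hk)
          have h1 := hC s hs k
          have h2 : dirichletWeight α (1 / 2 + s) k * √(k : ℝ) ≤ C * s ^ (-max α 0) := by
            have : 0 ≤ dirichletWeight α (1 / 2 + s) k * √(k : ℝ) := by positivity
            linarith
          calc dirichletWeight α (1 / 2 + s) k * |x k| =
              dirichletWeight α (1 / 2 + s) k * √(k : ℝ) * (|x k| / √(k : ℝ)) := by field_simp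
            _ ≤ _ := by gcongr
    _ ≤ _ := by
        rw [← Finset.mul_sum]
        exact mul_le_mul_of_nonneg_left (hx.sum_le_tsum _ fun k _ => by positivity) hC0

lemma boundedSums_of_summable (α : ℝ) {x : ℕ → ℝ} (hx : Summable fun k => |x k| / √(k : ℝ)) :
    BoundedSums α x := by
  obtain ⟨C, -, hCw⟩ := exists_dirichletWeight_mul_sqrt_le α
  exact fun s hs => ⟨_, abs_weightedSum_le_of_summable hCw hx hs⟩

/-- Such a perturbation contributes only `O(s^(-max α 0))`, which is `o(s^(-(1/2+α)))` because `α >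
-1/2`. -/
lemma eventually_abs_dirichletSeries_le_of_summable {α : ℝ} (hα : -1 / 2 < α) {x : ℕ → ℝ}
    (hx : Summable fun k => |x k| / √(k : ℝ)) {ε : ℝ} (hε : 0 < ε) :
    ∀ᶠ s : ℝ in 𝓝[>] 0, |dirichletSeries α x (1 / 2 + s)| ≤ ε * lilScale α s := by
  obtain ⟨C, hC, hCw⟩ := exists_dirichletWeight_mul_sqrt_le α
  set S := ∑' k, |x k| / √(k : ℝ)
  have hc : 0 < 1 / 2 + α - max α 0 := by
    rcases max_cases α 0 with ⟨e, -⟩ | ⟨e, -⟩ <;> rw [e] <;> linarith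
  have h1 := (tendsto_rpow_nhdsGT_zero hc).const_mul (C * S)
  rw [mul_zero] at h1
  filter_upwards [h1.eventually_le_const hε, self_mem_nhdsWithin,
    tendsto_log_log_one_div_nhdsGT_zero.eventually_ge_atTop 1] with s hs hs0 hL
  have hp : (0 : ℝ) < s := hs0
  have h2 : |dirichletSeries α x (1 / 2 + s)| ≤ C * s ^ (-max α 0) * S :=
    le_of_tendsto ((boundedSums_of_summable α hx).tendsto_weightedSum hp).abs
      (Eventually.of_forall fun N => abs_weightedSum_le_of_summable hCw hx hp N)
  have h3 := rpow_le_lilScale (α := α) hp hL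
  calc _ ≤ _ := h2
    _ = C * S * s ^ (1 / 2 + α - max α 0) * s ^ (-(1 / 2 + α)) := by
      rw [mul_assoc (C * S), ← Real.rpow_add hp]
      ring_nf
    _ ≤ ε * lilScale α s := by gcongr

lemma sum_range_succ_inv_sqrt_le (n : ℕ) :
    ∑ k ∈ Finset.range (n + 1), (√(k : ℝ))⁻¹ ≤ 2 * √(n : ℝ) := by
  induction n with
  | zero => simp
  | succ n ih =>
    rw [Finset.sum_range_succ]
    have h1 : 0 < √((n + 1 : ℕ) : ℝ) := Real.sqrt_pos.2 (by positivity)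
    have h2 : √((n + 1 : ℕ) : ℝ) ^ 2 = n + 1 := by rw [Real.sq_sqrt (by positivity)]; push_cast; ring
    have h3 : √(n : ℝ) ^ 2 = n := Real.sq_sqrt (by positivity)
    have h4 : (√((n + 1 : ℕ) : ℝ))⁻¹ ≤ 2 * √((n + 1 : ℕ) : ℝ) - 2 * √(n : ℝ) := by
      rw [inv_le_iff_one_le_mul₀ h1]
      nlinarith [sq_nonneg (√((n + 1 : ℕ) : ℝ) - √(n : ℝ))]
    linarith

/-- Only indices `k ≤ f²` contribute, each at most `|f| / √k`, and `∑ 1/√k` up to `f²` is at most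
`2|f|`. This is how the second moment pays for truncation at `√k`. -/
lemma sum_abs_sub_truncation_div_sqrt_le {Ω : Type*} (f : Ω → ℝ) (ω : Ω) (N : ℕ) :
    ∑ k ∈ Finset.range N, |f ω - truncation f (√(k : ℝ)) ω| / √(k : ℝ) ≤ 2 * f ω ^ 2 := by
  set n := ⌊f ω ^ 2⌋₊
  have hterm : ∀ k : ℕ, |f ω - truncation f (√(k : ℝ)) ω| / √(k : ℝ) ≤
      if k ∈ Finset.range (n + 1) then |f ω| * (√(k : ℝ))⁻¹ else 0 := by
    intro k
    split_ifs with hk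
    · rw [div_eq_mul_inv]
      refine mul_le_mul_of_nonneg_right ?_ (by positivity)
      simp only [truncation, Set.indicator, id, Function.comp_apply]
      split_ifs
      · simp
      · simp
    · have h1 : n < k := by simpa using hk
      have h2 : f ω ^ 2 < k := (Nat.floor_lt (sq_nonneg _)).1 h1
      have h3 : |f ω| < √(k : ℝ) := by
        rw [← Real.sqrt_sq_eq_abs]
        exact Real.sqrt_lt_sqrt (sq_nonneg _) h2
      rw [truncation_eq_self h3]
      simp
  calc _ ≤ ∑ k ∈ Finset.range N, if k ∈ Finset.range (n + 1) then |f ω| * (√(k : ℝ))⁻¹ else 0 :=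
        Finset.sum_le_sum fun k _ => hterm k
    _ ≤ ∑ k ∈ Finset.range (n + 1), |f ω| * (√(k : ℝ))⁻¹ := by
        rw [← Finset.sum_filter]
        refine Finset.sum_le_sum_of_subset_of_nonneg (fun k hk => (Finset.mem_filter.1 hk).2)
          fun k _ _ => by positivity
    _ ≤ |f ω| * (2 * √(n : ℝ)) := by
        rw [← Finset.mul_sum]
        exact mul_le_mul_of_nonneg_left (sum_range_succ_inv_sqrt_le n) (abs_nonneg _)
    _ ≤ |f ω| * (2 * |f ω|) := by
        have : √(n : ℝ) ≤ |f ω| := by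
          rw [← Real.sqrt_sq_eq_abs]
          exact Real.sqrt_le_sqrt (Nat.floor_le (sq_nonneg _))
        gcongr
    _ = 2 * f ω ^ 2 := by rw [← sq_abs]; ring

section Truncation

set_option linter.unusedSectionVars false

variable {Ω : Type*} [MeasurableSpace Ω] {P : Measure Ω} [IsProbabilityMeasure P]

/-- Independent copies of a centred square-integrable variable, preceded by a zero entry. -/
structure IsIIDNoise (ζ : ℕ → Ω → ℝ) (P : Measure Ω) (v : ℝ) : Prop where
  indep : iIndepFun ζ P
  meas : ∀ k, Measurable (ζ k)
  zero : ζ 0 = 0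
  ident : ∀ k, 1 ≤ k → IdentDistrib (ζ k) (ζ 1) P P
  memLp : MemLp (ζ 1) 2 P
  mean : ∫ ω, ζ 1 ω ∂P = 0
  var : ∫ ω, ζ 1 ω ^ 2 ∂P = v

/-- Truncation of the `k`-th variable at level `√k`, followed by centring. -/
noncomputable def truncatedNoise (ζ : ℕ → Ω → ℝ) (P : Measure Ω) (k : ℕ) (ω : Ω) : ℝ :=
  truncation (ζ k) (√(k : ℝ)) ω - ∫ ω', truncation (ζ k) (√(k : ℝ)) ω' ∂P

namespace IsIIDNoise

variable {ζ : ℕ → Ω → ℝ} {v : ℝ}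

lemma memLp' (h : IsIIDNoise ζ P v) (k : ℕ) : MemLp (ζ k) 2 P := by
  rcases Nat.eq_zero_or_pos k with rfl | hk
  · rw [h.zero]; exact MemLp.zero
  · exact (h.ident k hk).memLp_iff.2 h.memLp

lemma integrable_sq (h : IsIIDNoise ζ P v) (k : ℕ) : Integrable (fun ω => ζ k ω ^ 2) P :=
  (memLp_two_iff_integrable_sq (h.meas k).aestronglyMeasurable).1 (h.memLp' k)

lemma nonneg (h : IsIIDNoise ζ P v) : 0 ≤ v := by
  rw [← h.var]
  exact integral_nonneg fun ω => sq_nonneg _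

lemma integral_eq_zero (h : IsIIDNoise ζ P v) (k : ℕ) : ∫ ω, ζ k ω ∂P = 0 := by
  rcases Nat.eq_zero_or_pos k with rfl | hk
  · simp [h.zero]
  · rw [(h.ident k hk).integral_eq, h.mean]

lemma integral_sq_le (h : IsIIDNoise ζ P v) (k : ℕ) : ∫ ω, ζ k ω ^ 2 ∂P ≤ v := by
  rcases Nat.eq_zero_or_pos k with rfl | hk
  · simpa [h.zero] using h.nonneg
  · have := ((h.ident k hk).comp (u := fun x : ℝ => x ^ 2) (by fun_prop)).integral_eq
    simp only [Function.comp_def] at this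
    rw [this, h.var]

lemma neg (h : IsIIDNoise ζ P v) : IsIIDNoise (fun k ω => -ζ k ω) P v where
  indep := h.indep.comp (fun _ x => -x) fun _ => measurable_neg
  meas k := (h.meas k).neg
  zero := by funext ω; simp [h.zero]
  ident k hk := (h.ident k hk).comp measurable_neg
  memLp := h.memLp.neg
  mean := by rw [integral_neg, h.mean, neg_zero]
  var := by simpa using h.var

lemma ae_boundedSums (h : IsIIDNoise ζ P v) (α : ℝ) : ∀ᵐ ω ∂P, BoundedSums α fun k => ζ k ω :=
  _root_.ae_boundedSums h.indep h.meas h.memLp' h.integral_eq_zero h.integral_sq_le α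

lemma measurable_truncation (h : IsIIDNoise ζ P v) (k : ℕ) (A : ℝ) :
    Measurable (truncation (ζ k) A) :=
  (measurable_id.indicator measurableSet_Ioc).comp (h.meas k)

lemma integrable_truncation (h : IsIIDNoise ζ P v) (k : ℕ) (A : ℝ) :
    Integrable (truncation (ζ k) A) P :=
  (h.meas k).aestronglyMeasurable.integrable_truncation

lemma integrable_truncation_sq (h : IsIIDNoise ζ P v) (k : ℕ) (A : ℝ) :
    Integrable (fun ω => truncation (ζ k) A ω ^ 2) P :=
  integrable_sq_of_abs_le (h.measurable_truncation k A) (abs_truncation_le_bound _ _)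

lemma integral_truncatedNoise_sq (h : IsIIDNoise ζ P v) (k : ℕ) :
    ∫ ω, truncatedNoise ζ P k ω ^ 2 ∂P = ∫ ω, truncation (ζ k) (√(k : ℝ)) ω ^ 2 ∂P -
      (∫ ω, truncation (ζ k) (√(k : ℝ)) ω ∂P) ^ 2 := by
  unfold truncatedNoise
  set m := ∫ ω, truncation (ζ k) (√(k : ℝ)) ω ∂P with hm
  have i1 := h.integrable_truncation_sq k (√(k : ℝ))
  have i2 := h.integrable_truncation k (√(k : ℝ))
  have e : ∀ ω, (truncation (ζ k) (√(k : ℝ)) ω - m) ^ 2 =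
      truncation (ζ k) (√(k : ℝ)) ω ^ 2 - 2 * m * truncation (ζ k) (√(k : ℝ)) ω + m ^ 2 :=
    fun ω => by ring
  have i3 : Integrable (fun ω => truncation (ζ k) (√(k : ℝ)) ω ^ 2 -
      2 * m * truncation (ζ k) (√(k : ℝ)) ω) P := i1.sub (i2.const_mul _)
  simp only [e]
  rw [integral_add i3 (integrable_const _), integral_sub i1 (i2.const_mul _), integral_const_mul,
    ← hm]
  simp
  ring

lemma isBoundedNoise (h : IsIIDNoise ζ P v) : IsBoundedNoise (truncatedNoise ζ P) P v where
  indep := h.indep.comp (fun k x => Set.indicator (Set.Ioc (-√(k : ℝ)) (√(k : ℝ))) id x -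
    ∫ ω', truncation (ζ k) (√(k : ℝ)) ω' ∂P)
    fun k => (measurable_id.indicator measurableSet_Ioc).sub_const _
  meas k := (h.measurable_truncation k _).sub_const _
  bdd k ω := by
    have h1 := abs_truncation_le_bound (ζ k) (√(k : ℝ)) ω
    have h2 : |∫ ω', truncation (ζ k) (√(k : ℝ)) ω' ∂P| ≤ √(k : ℝ) := by
      have := norm_integral_le_of_norm_le_const (μ := P) (f := truncation (ζ k) (√(k : ℝ)))
        (C := √(k : ℝ)) (ae_of_all _ fun ω => by
          have := abs_truncation_le_bound (ζ k) (√(k : ℝ)) ω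
          rwa [abs_of_nonneg (Real.sqrt_nonneg _)] at this)
      simpa using this
    rw [abs_of_nonneg (Real.sqrt_nonneg _)] at h1
    refine (abs_sub _ _).trans ?_
    linarith
  mean k := by
    unfold truncatedNoise
    rw [integral_sub (h.integrable_truncation k _) (integrable_const _)]
    simp
  var_le k := by
    rw [h.integral_truncatedNoise_sq]
    have h1 : ∫ ω, truncation (ζ k) (√(k : ℝ)) ω ^ 2 ∂P ≤ ∫ ω, ζ k ω ^ 2 ∂P := by
      refine integral_mono (h.integrable_truncation_sq k _) (h.integrable_sq k) fun ω => ?_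
      exact sq_le_sq.2 (abs_truncation_le_abs_self _ _ _)
    have := h.integral_sq_le k
    nlinarith [sq_nonneg (∫ ω, truncation (ζ k) (√(k : ℝ)) ω ∂P)]

lemma tendsto_sqrt_natCast : Tendsto (fun k : ℕ => √(k : ℝ)) atTop atTop :=
  Real.tendsto_sqrt_atTop.comp tendsto_natCast_atTop_atTop

lemma tendsto_integral_truncatedNoise_sq (h : IsIIDNoise ζ P v) :
    Tendsto (fun k => ∫ ω, truncatedNoise ζ P k ω ^ 2 ∂P) atTop (𝓝 v) := by
  have h1 : Tendsto (fun k : ℕ => ∫ ω, truncation (ζ 1) (√(k : ℝ)) ω ∂P) atTop (𝓝 0) := by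
    have := (tendsto_integral_truncation (h.memLp.integrable one_le_two)).comp tendsto_sqrt_natCast
    rwa [h.mean] at this
  have h2 : Tendsto (fun k : ℕ => ∫ ω, truncation (ζ 1) (√(k : ℝ)) ω ^ 2 ∂P) atTop (𝓝 v) := by
    rw [← h.var]
    refine tendsto_integral_of_dominated_convergence (fun ω => ζ 1 ω ^ 2)
      (fun k => (h.integrable_truncation_sq 1 _).aestronglyMeasurable) (h.integrable_sq 1)
      (fun k => ae_of_all _ fun ω => ?_) (ae_of_all _ fun ω => ?_)
    · rw [Real.norm_eq_abs, abs_of_nonneg (sq_nonneg _)]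
      exact sq_le_sq.2 (abs_truncation_le_abs_self _ _ _)
    · refine tendsto_const_nhds.congr' ?_
      filter_upwards [tendsto_sqrt_natCast.eventually_gt_atTop |ζ 1 ω|] with k hk
      rw [truncation_eq_self hk]
  have h3 := h2.sub (h1.pow 2)
  rw [zero_pow two_ne_zero, sub_zero] at h3
  refine h3.congr' ?_
  filter_upwards [eventually_ge_atTop 1] with k hk
  have hid := (h.ident k hk).truncation (A := √(k : ℝ))
  have hsq := (hid.comp (u := fun x : ℝ => x ^ 2) (by fun_prop)).integral_eq
  simp only [Function.comp_def] at hsq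
  rw [h.integral_truncatedNoise_sq, hid.integral_eq, hsq]

/-- For a centred variable the truncated mean is minus the mean of the removed part, so the
pointwise inequality integrates to the bound `2v`. -/
lemma summable_abs_integral_truncation_div_sqrt (h : IsIIDNoise ζ P v) :
    Summable fun k : ℕ => |∫ ω, truncation (ζ k) (√(k : ℝ)) ω ∂P| / √(k : ℝ) := by
  refine summable_of_sum_range_le (c := 2 * v) (fun k => by positivity) fun N => ?_
  have hi1 : Integrable (ζ 1) P := h.memLp.integrable one_le_two
  have hint : ∀ k : ℕ, Integrable
      (fun ω => |ζ 1 ω - truncation (ζ 1) (√(k : ℝ)) ω| / √(k : ℝ)) P := fun k =>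
    ((hi1.sub (h.integrable_truncation 1 _)).abs).div_const _
  calc ∑ k ∈ Finset.range N, |∫ ω, truncation (ζ k) (√(k : ℝ)) ω ∂P| / √(k : ℝ) ≤
      ∑ k ∈ Finset.range N, ∫ ω, |ζ 1 ω - truncation (ζ 1) (√(k : ℝ)) ω| / √(k : ℝ) ∂P := by
        refine Finset.sum_le_sum fun k _ => ?_
        rcases Nat.eq_zero_or_pos k with rfl | hk
        · simp
        · rw [integral_div, (h.ident k hk).truncation.integral_eq]
          refine div_le_div_of_nonneg_right ?_ (Real.sqrt_nonneg _)
          have e : ∫ ω, truncation (ζ 1) (√(k : ℝ)) ω ∂P =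
              -∫ ω, (ζ 1 ω - truncation (ζ 1) (√(k : ℝ)) ω) ∂P := by
            rw [integral_sub hi1 (h.integrable_truncation 1 _), h.mean]
            ring
          rw [e, abs_neg]
          exact abs_integral_le_integral_abs
    _ = ∫ ω, ∑ k ∈ Finset.range N, |ζ 1 ω - truncation (ζ 1) (√(k : ℝ)) ω| / √(k : ℝ) ∂P :=
        (integral_finsetSum _ fun k _ => hint k).symm
    _ ≤ ∫ ω, 2 * ζ 1 ω ^ 2 ∂P :=
        integral_mono (integrable_finsetSum _ fun k _ => hint k) ((h.integrable_sq 1).const_mul 2)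
          fun ω => sum_abs_sub_truncation_div_sqrt_le (ζ 1) ω N
    _ = 2 * v := by rw [integral_const_mul, h.var]

lemma ae_eventually_truncation_eq (h : IsIIDNoise ζ P v) :
    ∀ᵐ ω ∂P, ∀ᶠ k : ℕ in atTop, truncation (ζ k) (√(k : ℝ)) ω = ζ k ω := by
  have h1 := ae_eventually_notMem (μ := P)
    -- Using `k - 1` instead of `k` gives the strict inequality `|ζ k| < √k` needed for truncation
    -- to act trivially; the shifted tail sum is finite by the second moment.
    (s := fun k : ℕ => {ω | ζ k ω ^ 2 ∈ Set.Ioi ((k - 1 : ℕ) : ℝ)}) (by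
      have h2 : ∑' k : ℕ, P {ω | ζ 1 ω ^ 2 ∈ Set.Ioi (k : ℝ)} < ⊤ := by
        let _ : MeasureSpace Ω := ⟨P⟩
        have : IsProbabilityMeasure (volume : Measure Ω) := ‹IsProbabilityMeasure P›
        exact tsum_prob_mem_Ioi_lt_top (X := fun ω => ζ 1 ω ^ 2) (h.integrable_sq 1)
          fun ω => sq_nonneg _
      rw [tsum_eq_zero_add' ENNReal.summable]
      refine ENNReal.add_ne_top.2 ⟨measure_ne_top _ _, ?_⟩
      refine ne_of_lt (lt_of_le_of_lt (le_of_eq (tsum_congr fun k => ?_)) h2)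
      have hid := (h.ident (k + 1) (by omega)).comp (u := fun x : ℝ => x ^ 2) (by fun_prop)
      exact hid.measure_mem_eq measurableSet_Ioi)
  filter_upwards [h1] with ω hω
  filter_upwards [hω, eventually_ge_atTop 1] with k hk hk1
  apply truncation_eq_self
  have h2 : ζ k ω ^ 2 ≤ ((k - 1 : ℕ) : ℝ) := not_lt.1 hk
  rw [Nat.cast_sub hk1] at h2
  rw [← Real.sqrt_sq_eq_abs]
  exact Real.sqrt_lt_sqrt (sq_nonneg _) (by push_cast at h2; linarith)

lemma ae_summable_abs_sub_truncatedNoise (h : IsIIDNoise ζ P v) :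
    ∀ᵐ ω ∂P, Summable fun k : ℕ => |ζ k ω - truncatedNoise ζ P k ω| / √(k : ℝ) := by
  filter_upwards [h.ae_eventually_truncation_eq] with ω hω
  obtain ⟨K, hK⟩ := eventually_atTop.1 hω
  rw [← summable_nat_add_iff K]
  refine ((summable_nat_add_iff K).2 h.summable_abs_integral_truncation_div_sqrt).congr fun k => ?_
  unfold truncatedNoise
  rw [hK (k + K) (by omega)]
  congr 2
  ring

lemma ae_dirichletSeries_sub_truncatedNoise (h : IsIIDNoise ζ P v) {α : ℝ} (hα : -1 / 2 < α) :
    ∀ᵐ ω ∂P, ∀ ε : ℝ, 0 < ε → ∀ᶠ s : ℝ in 𝓝[>] 0,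
      |dirichletSeries α (fun k => ζ k ω) (1 / 2 + s) -
        dirichletSeries α (fun k => truncatedNoise ζ P k ω) (1 / 2 + s)| ≤ ε * lilScale α s := by
  filter_upwards [h.ae_summable_abs_sub_truncatedNoise, h.isBoundedNoise.ae_boundedSums α]
    with ω h1 h2 ε hε
  filter_upwards [eventually_abs_dirichletSeries_le_of_summable hα h1 hε, self_mem_nhdsWithin]
    with s hs hs0
  have h3 := h2.dirichletSeries_add (boundedSums_of_summable α h1) hs0
  simp only [add_sub_cancel] at h3
  rw [h3, add_sub_cancel_left]
  exact hs

theorem ae_eventually_le_lilScale (h : IsIIDNoise ζ P v) (hv : 0 < v) {α : ℝ}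
    (hα : -1 / 2 < α) {A : ℝ} (hA : √(v * Real.Gamma (1 + 2 * α) / 2 ^ (2 * α)) < A) :
    ∀ᵐ ω ∂P, ∀ᶠ r in 𝓝[>] (0 : ℝ),
      dirichletSeries α (fun k => ζ k ω) (1 / 2 + r) ≤ A * lilScale α r := by
  obtain ⟨A', h1, h2⟩ := exists_between hA
  filter_upwards [h.isBoundedNoise.ae_eventually_le_lilScale hv hα h1,
    h.ae_dirichletSeries_sub_truncatedNoise hα] with ω g1 g2
  filter_upwards [g1, g2 (A - A') (by linarith)] with r k1 k2
  have := (abs_le.1 k2).2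
  linarith

theorem ae_frequently_lilScale_le (h : IsIIDNoise ζ P v) (hv : 0 < v) {α : ℝ}
    (hα : -1 / 2 < α) {A : ℝ} (hA : A < √(v * Real.Gamma (1 + 2 * α) / 2 ^ (2 * α))) :
    ∀ᵐ ω ∂P, ∃ᶠ r in 𝓝[>] (0 : ℝ),
      A * lilScale α r ≤ dirichletSeries α (fun k => ζ k ω) (1 / 2 + r) := by
  obtain ⟨A', h1, h2⟩ := exists_between hA
  filter_upwards [h.isBoundedNoise.ae_frequently_lilScale_le hv
    h.tendsto_integral_truncatedNoise_sq hα h2, h.ae_dirichletSeries_sub_truncatedNoise hα]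
    with ω g1 g2
  refine (g1.and_eventually (g2 (A' - A) (by linarith))).mono fun r hr => ?_
  have := (abs_le.1 hr.2).1
  linarith [hr.1]

end IsIIDNoise

end Truncation

/-! ### Upper and lower limits and cluster points -/

section Limits

variable {ι : Type*} {F : Filter ι} {g : ι → ℝ} {B : ℝ}

/-- Taking the limit in `EReal` removes boundedness side conditions, and real thresholds suffice by
density. -/
lemma limsup_coe_eq_of_forall (h1 : ∀ A, B < A → ∀ᶠ i in F, g i ≤ A)
    (h2 : ∀ A, A < B → ∃ᶠ i in F, A ≤ g i) : limsup (fun i => (g i : EReal)) F = (B : EReal) := by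
  apply le_antisymm
  · refine EReal.le_of_forall_lt_iff_le.1 fun A hA => limsup_le_of_le (h := ?_)
    filter_upwards [h1 A (EReal.coe_lt_coe_iff.1 hA)] with i hi
    exact EReal.coe_le_coe_iff.2 hi
  · refine EReal.ge_of_forall_gt_iff_ge.1 fun A hA => le_limsup_of_frequently_le' ?_
    exact (h2 A (EReal.coe_lt_coe_iff.1 hA)).mono fun i hi => EReal.coe_le_coe_iff.2 hi

lemma liminf_coe_eq_of_forall (h1 : ∀ A, A < B → ∀ᶠ i in F, A ≤ g i)
    (h2 : ∀ A, B < A → ∃ᶠ i in F, g i ≤ A) : liminf (fun i => (g i : EReal)) F = (B : EReal) := by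
  apply le_antisymm
  · refine EReal.le_of_forall_lt_iff_le.1 fun A hA => liminf_le_of_frequently_le' ?_
    exact (h2 A (EReal.coe_lt_coe_iff.1 hA)).mono fun i hi => EReal.coe_le_coe_iff.2 hi
  · refine EReal.ge_of_forall_gt_iff_ge.1 fun A hA => le_liminf_of_le (h := ?_)
    filter_upwards [h1 A (EReal.coe_lt_coe_iff.1 hA)] with i hi
    exact EReal.coe_le_coe_iff.2 hi

/-- Cluster points at `0+` of a continuous function oscillating between `-1` and `1`. -/
lemma setOf_mapClusterPt_eq_Icc {g : ℝ → ℝ} {r₀ : ℝ} (hr₀ : 0 < r₀)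
    (hg : ContinuousOn g (Set.Ioo 0 r₀))
    (h1 : ∀ A, 1 < A → ∀ᶠ s in 𝓝[>] (0 : ℝ), g s ≤ A)
    (h2 : ∀ A, A < 1 → ∃ᶠ s in 𝓝[>] (0 : ℝ), A ≤ g s)
    (h3 : ∀ A, A < -1 → ∀ᶠ s in 𝓝[>] (0 : ℝ), A ≤ g s)
    (h4 : ∀ A, -1 < A → ∃ᶠ s in 𝓝[>] (0 : ℝ), g s ≤ A) :
    {x : ℝ | MapClusterPt x (𝓝[>] (0 : ℝ)) g} = Set.Icc (-1) 1 := by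
  ext x
  simp only [Set.mem_ofPred_eq, mapClusterPt_iff_frequently, Set.mem_Icc]
  constructor
  · intro hx
    constructor
    · by_contra hcon
      have hcon' := not_le.1 hcon
      obtain ⟨A, hA1, hA2⟩ := exists_between hcon'
      obtain ⟨s, hs1, hs2⟩ := ((hx _ (Iio_mem_nhds hA1)).and_eventually (h3 A hA2)).exists
      exact absurd hs2 (not_le.2 hs1)
    · by_contra hcon
      have hcon' := not_le.1 hcon
      obtain ⟨A, hA1, hA2⟩ := exists_between hcon'
      obtain ⟨s, hs1, hs2⟩ := ((hx _ (Ioi_mem_nhds hA2)).and_eventually (h1 A hA1)).exists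
      exact absurd hs2 (not_le.2 hs1)
  · rintro ⟨hx1, hx2⟩ U hU
    obtain ⟨ε, hε, hεU⟩ := Metric.mem_nhds_iff.1 hU
    set e := min (ε / 2) 1 with he
    have he0 : 0 < e := lt_min (by linarith) one_pos
    have he1 : e ≤ 1 := min_le_right _ _
    have he2 : e ≤ ε / 2 := min_le_left _ _
    -- `x` is shrunk towards 0 because the hypotheses only guarantee values reaching levels strictly
    -- between `-1` and `1`.
    obtain ⟨y, hy1, hy2, hy⟩ : ∃ y : ℝ, -1 < y ∧ y < 1 ∧ |y - x| < ε := by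
      refine ⟨(1 - e / 2) * x, by nlinarith, by nlinarith, ?_⟩
      rw [show (1 - e / 2) * x - x = -(e / 2 * x) by ring, abs_neg, abs_mul,
        abs_of_pos (by positivity)]
      have : |x| ≤ 1 := abs_le.2 ⟨hx1, hx2⟩
      nlinarith [abs_nonneg x]
    rw [Filter.frequently_iff]
    intro V hV
    obtain ⟨r, hr, hrV⟩ := mem_nhdsGT_iff_exists_Ioo_subset.1 hV
    have hr0 : (0 : ℝ) < r := hr
    have hmem : Set.Ioo 0 (min r r₀) ∈ 𝓝[>] (0 : ℝ) := Ioo_mem_nhdsGT (lt_min hr0 hr₀)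
    obtain ⟨a, ha1, ha2⟩ := ((h2 y hy2).and_eventually hmem).exists
    obtain ⟨b, hb1, hb2⟩ := ((h4 y hy1).and_eventually hmem).exists
    have hsub : Set.Ioo 0 (min r r₀) ⊆ Set.Ioo 0 r₀ :=
      Set.Ioo_subset_Ioo_right (min_le_right _ _)
    -- Near 0 there are points with `g ≥ y` and with `g ≤ y`, so the value `y` is attained between
    -- them.
    obtain ⟨s, hs, hsy⟩ := isPreconnected_Ioo.intermediate_value hb2 ha2 (hg.mono hsub) ⟨hb1, ha1⟩
    refine ⟨s, hrV ⟨hs.1, hs.2.trans_le (min_le_left _ _)⟩, hεU ?_⟩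
    rw [Metric.mem_ball, Real.dist_eq, hsy]
    exact hy

end Limits

lemma continuousOn_rpow_div_log_log (α : ℝ) :
    ContinuousOn (fun s : ℝ => s ^ (1 + 2 * α) / Real.log (Real.log (1 / s)))
      (Set.Ioo 0 (Real.exp (-1))) := by
  intro s hs
  have h1 : 1 < Real.log (1 / s) := by
    rw [one_div, Real.log_inv, lt_neg, Real.log_lt_iff_lt_exp hs.1]
    exact hs.2
  have h2 := Real.log_pos h1
  refine ContinuousAt.continuousWithinAt ?_
  refine ContinuousAt.div (Real.continuousAt_rpow_const _ _ (Or.inl hs.1.ne')) ?_ h2.ne'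
  refine ContinuousAt.log (ContinuousAt.log ?_ (by have := hs.1; positivity)) (by linarith)
  exact ContinuousAt.div continuousAt_const continuousAt_id hs.1.ne'

lemma sqrt_rpow_div_mul_lilScale {α s : ℝ} (hs : 0 < s) (hL : 0 < Real.log (Real.log (1 / s))) :
    √(s ^ (1 + 2 * α) / Real.log (Real.log (1 / s))) * lilScale α s = 1 := by
  rw [lilScale, ← Real.sqrt_mul (by positivity), Real.rpow_neg hs.le, Real.sqrt_eq_one]
  field_simp

/-! ### Reduction to measurable noise with a zero entry -/

section Reindexing

variable {Ω : Type*} [MeasurableSpace Ω] {P : Measure Ω} [IsProbabilityMeasure P]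

/-- A constant variable is independent of everything: its events are empty or the whole space. -/
lemma iIndepFun_of_succ_of_zero {f : ℕ → Ω → ℝ} (h : iIndepFun (fun n => f (n + 1)) P)
    (h0 : f 0 = 0) : iIndepFun f P := by
  rw [iIndepFun_iff_measure_inter_preimage_eq_mul] at h ⊢
  have key : ∀ S : Finset ℕ, 0 ∉ S → ∀ sets : ℕ → Set ℝ, (∀ i ∈ S, MeasurableSet (sets i)) →
      P (⋂ i ∈ S, f i ⁻¹' sets i) = ∏ i ∈ S, P (f i ⁻¹' sets i) := by
    intro S hS sets hsets
    obtain ⟨T, rfl⟩ : ∃ T : Finset ℕ, S = T.image (· + 1) := by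
      refine ⟨S.image (· - 1), ?_⟩
      rw [Finset.image_image]
      ext k
      simp only [Finset.mem_image, Function.comp]
      constructor
      · intro hk
        have : k ≠ 0 := fun h' => hS (h' ▸ hk)
        exact ⟨k, hk, by omega⟩
      · rintro ⟨j, hj, rfl⟩
        have : j ≠ 0 := fun h' => hS (h' ▸ hj)
        rwa [Nat.sub_add_cancel (by omega)]
    rw [Finset.set_biInter_finset_image, Finset.prod_image fun a _ b _ hab => Nat.succ_injective hab]
    exact h T (sets := fun i => sets (i + 1))
      fun i hi => hsets _ (Finset.mem_image_of_mem _ hi)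
  intro S sets hsets
  by_cases hS : 0 ∈ S
  · rw [← Finset.insert_erase hS, Finset.set_biInter_insert,
      Finset.prod_insert (Finset.notMem_erase 0 S),
      ← key _ (Finset.notMem_erase 0 S) sets fun i hi => hsets i (Finset.mem_of_mem_erase hi)]
    by_cases h' : (0 : ℝ) ∈ sets 0
    · have : f 0 ⁻¹' sets 0 = Set.univ := by ext ω; simp [h0, h']
      rw [this]
      simp
    · have : f 0 ⁻¹' sets 0 = ∅ := by ext ω; simp [h0, h']
      rw [this]
      simp
  · exact key S hS sets hsets

/-- A sequence of i.i.d. variables indexed from `1`, up to null sets, as an `IsIIDNoise`. -/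
lemma exists_isIIDNoise {η : ℕ → Ω → ℝ} (hindep : iIndepFun (fun n : ℕ => η (n + 1)) P)
    (hident : ∀ n : ℕ, 1 ≤ n → IdentDistrib (η n) (η 1) P P) (hL2 : MemLp (η 1) 2 P)
    (hmean : ∫ ω, η 1 ω ∂P = 0) {v : ℝ} (hvar : ∫ ω, η 1 ω ^ 2 ∂P = v) :
    ∃ ζ : ℕ → Ω → ℝ, IsIIDNoise ζ P v ∧ ∀ᵐ ω ∂P, ∀ k, 1 ≤ k → ζ k ω = η k ω := by
  have hae : ∀ n, AEMeasurable (η (n + 1)) P := fun n =>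
    (hident (n + 1) (by omega)).aemeasurable_fst
  -- Measurable versions of the variables from index 1 on; `η 0` is unconstrained and never enters
  -- the sums, so it is replaced by 0.
  set ζ : ℕ → Ω → ℝ := fun k => Nat.casesOn k 0 fun n => (hae n).mk (η (n + 1)) with hζ
  have heq : ∀ n, η (n + 1) =ᵐ[P] ζ (n + 1) := fun n => (hae n).ae_eq_mk
  have hm : ∀ k, Measurable (ζ k) := by
    intro k
    cases k with
    | zero => exact measurable_const
    | succ n => exact (hae n).measurable_mk
  refine ⟨ζ, ⟨iIndepFun_of_succ_of_zero (hindep.congr heq) rfl, hm, rfl, fun k hk => ?_,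
    hL2.ae_eq (heq 0), ?_, ?_⟩, ?_⟩
  · obtain ⟨n, rfl⟩ : ∃ n, k = n + 1 := ⟨k - 1, by omega⟩
    exact ((IdentDistrib.of_ae_eq (hae n) (heq n)).symm.trans (hident _ hk)).trans
      (IdentDistrib.of_ae_eq (hae 0) (heq 0))
  · rw [← hmean]
    exact integral_congr_ae (heq 0).symm
  · rw [← hvar]
    refine integral_congr_ae ?_
    filter_upwards [heq 0] with ω hω
    rw [show η 1 ω = ζ 1 ω from hω]
  · filter_upwards [ae_all_iff.2 heq] with ω hω k hk
    obtain ⟨n, rfl⟩ : ∃ n, k = n + 1 := ⟨k - 1, by omega⟩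
    exact (hω n).symm

end Reindexing

lemma dirichletPartialSum_congr {x y : ℕ → ℝ} (h : ∀ k, 1 ≤ k → x k = y k) (α z : ℝ) :
    dirichletPartialSum α x z = dirichletPartialSum α y z := by
  funext N
  refine Finset.sum_congr rfl fun k hk => ?_
  rw [h k (by have := (Finset.mem_Icc.1 hk).1; omega)]

lemma dirichletSeries_congr {x y : ℕ → ℝ} (h : ∀ k, 1 ≤ k → x k = y k) (α z : ℝ) :
    dirichletSeries α x z = dirichletSeries α y z := by
  rw [dirichletSeries, dirichletSeries, dirichletPartialSum_congr h]

/-! ### Assembling the law of the iterated logarithm -/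

section LIL

variable {Ω : Type*} [MeasurableSpace Ω] {P : Measure Ω} [IsProbabilityMeasure P]

/-- Sequences approaching `B` from both sides collect the level-dependent null sets into one, so the
bounds hold for all real levels simultaneously. -/
lemma IsIIDNoise.ae_lil_bounds {ζ : ℕ → Ω → ℝ} {v : ℝ} (h : IsIIDNoise ζ P v) (hv : 0 < v) {α : ℝ}
    (hα : -1 / 2 < α) {B : ℝ} (hB : B = √(v * Real.Gamma (1 + 2 * α) / 2 ^ (2 * α))) :
    ∀ᵐ ω ∂P,
      (∀ A, B < A → ∀ᶠ s : ℝ in 𝓝[>] 0,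
        √(s ^ (1 + 2 * α) / Real.log (Real.log (1 / s))) *
          dirichletSeries α (fun k => ζ k ω) (1 / 2 + s) ≤ A) ∧
      (∀ A, A < B → ∃ᶠ s : ℝ in 𝓝[>] 0,
        A ≤ √(s ^ (1 + 2 * α) / Real.log (Real.log (1 / s))) *
          dirichletSeries α (fun k => ζ k ω) (1 / 2 + s)) := by
  obtain ⟨u, -, hu1, hu2⟩ := exists_seq_strictAnti_tendsto' (lt_add_one B)
  obtain ⟨l, -, hl1, hl2⟩ := exists_seq_strictMono_tendsto' (sub_one_lt B)
  have h1 := ae_all_iff.2 fun n =>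
    h.ae_eventually_le_lilScale hv hα (A := u n) (by rw [← hB]; exact (hu1 n).1)
  have h2 := ae_all_iff.2 fun n =>
    h.ae_frequently_lilScale_le hv hα (A := l n) (by rw [← hB]; exact (hl1 n).2)
  filter_upwards [h1, h2] with ω g1 g2
  have hscale : ∀ᶠ s : ℝ in 𝓝[>] 0,
      √(s ^ (1 + 2 * α) / Real.log (Real.log (1 / s))) * lilScale α s = 1 := by
    filter_upwards [self_mem_nhdsWithin,
      tendsto_log_log_one_div_nhdsGT_zero.eventually_gt_atTop 0] with s hs hL
    exact sqrt_rpow_div_mul_lilScale hs hL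
  constructor
  · intro A hA
    obtain ⟨n, hn⟩ := (hu2.eventually_lt_const hA).exists
    filter_upwards [g1 n, hscale] with s hs hsc
    have := mul_le_mul_of_nonneg_left hs
      (Real.sqrt_nonneg (s ^ (1 + 2 * α) / Real.log (Real.log (1 / s))))
    rw [mul_left_comm, hsc, mul_one] at this
    linarith
  · intro A hA
    obtain ⟨n, hn⟩ := (hl2.eventually_const_lt hA).exists
    refine ((g2 n).and_eventually hscale).mono fun s hs => ?_
    have := mul_le_mul_of_nonneg_left hs.1
      (Real.sqrt_nonneg (s ^ (1 + 2 * α) / Real.log (Real.log (1 / s))))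
    rw [mul_left_comm, hs.2, mul_one] at this
    linarith

end LIL

theorem mainTheorem2 {Ω : Type*} [MeasurableSpace Ω] (P : Measure Ω) [IsProbabilityMeasure P]
    (η : ℕ → Ω → ℝ)
    (hindep : iIndepFun (fun n : ℕ => η (n + 1)) P)
    (hident : ∀ n : ℕ, 1 ≤ n → IdentDistrib (η n) (η 1) P P)
    (hL2 : MemLp (η 1) 2 P)
    (hmean : ∫ ω, η 1 ω ∂P = 0)
    (σ₁ : ℝ) (hσ : 0 < σ₁ ^ 2) (hvar : ∫ ω, η 1 ω ^ 2 ∂P = σ₁ ^ 2)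
    (α : ℝ) (hα : -1 / 2 < α) :
    -- the series converges for all `s > 0`
    (∀ᵐ ω ∂P, ∀ s : ℝ, 0 < s →
      Tendsto (dirichletPartialSum α (fun k => η k ω) (1 / 2 + s)) atTop
        (𝓝 (dirichletSeries α (fun k => η k ω) (1 / 2 + s)))) ∧
    -- upper limit
    (∀ᵐ ω ∂P,
      limsup (fun s : ℝ =>
          ((√(s ^ (1 + 2 * α) / Real.log (Real.log (1 / s))) *
            dirichletSeries α (fun k => η k ω) (1 / 2 + s) : ℝ) : EReal)) (𝓝[>] 0) =
        ((√(σ₁ ^ 2 * Real.Gamma (1 + 2 * α) / 2 ^ (2 * α)) : ℝ) : EReal)) ∧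
    -- lower limit
    (∀ᵐ ω ∂P,
      liminf (fun s : ℝ =>
          ((√(s ^ (1 + 2 * α) / Real.log (Real.log (1 / s))) *
            dirichletSeries α (fun k => η k ω) (1 / 2 + s) : ℝ) : EReal)) (𝓝[>] 0) =
        ((-√(σ₁ ^ 2 * Real.Gamma (1 + 2 * α) / 2 ^ (2 * α)) : ℝ) : EReal)) ∧
    -- set of limit points as `s → 0+`
    (∀ᵐ ω ∂P,
      {x : ℝ | MapClusterPt x (𝓝[>] (0 : ℝ)) (fun s : ℝ =>
          √(2 ^ (2 * α) / (σ₁ ^ 2 * Real.Gamma (1 + 2 * α)) *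
              (s ^ (1 + 2 * α) / Real.log (Real.log (1 / s)))) *
            dirichletSeries α (fun k => η k ω) (1 / 2 + s))} =
        Set.Icc (-1) 1) := by
  obtain ⟨ζ, hζ, hζη⟩ := exists_isIIDNoise hindep hident hL2 hmean hvar
  set B := √(σ₁ ^ 2 * Real.Gamma (1 + 2 * α) / 2 ^ (2 * α)) with hB
  have hΓ : 0 < Real.Gamma (1 + 2 * α) := Real.Gamma_pos_of_pos (by linarith)
  have hB0 : 0 < B := Real.sqrt_pos.2 (by positivity)
  have hsum : ∀ᵐ ω ∂P, BoundedSums α fun k => ζ k ω := hζ.ae_boundedSums α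
  have hpos := hζ.ae_lil_bounds hσ hα hB
  have hneg : ∀ᵐ ω ∂P,
      (∀ A, A < -B → ∀ᶠ s : ℝ in 𝓝[>] 0,
        A ≤ √(s ^ (1 + 2 * α) / Real.log (Real.log (1 / s))) *
          dirichletSeries α (fun k => ζ k ω) (1 / 2 + s)) ∧
      (∀ A, -B < A → ∃ᶠ s : ℝ in 𝓝[>] 0,
        √(s ^ (1 + 2 * α) / Real.log (Real.log (1 / s))) *
          dirichletSeries α (fun k => ζ k ω) (1 / 2 + s) ≤ A) := by
    -- The negated noise satisfies the same hypotheses, and its series is the negative of the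
    -- original wherever the latter converges.
    filter_upwards [hζ.neg.ae_lil_bounds hσ hα hB, hsum] with ω h hω
    refine ⟨fun A hA => ?_, fun A hA => ?_⟩
    · filter_upwards [h.1 (-A) (by linarith), self_mem_nhdsWithin] with s hs hs0
      rw [hω.dirichletSeries_neg hs0] at hs
      linarith
    · refine ((h.2 (-A) (by linarith)).and_eventually self_mem_nhdsWithin).mono fun s hs => ?_
      have h1 := hs.1
      rw [hω.dirichletSeries_neg hs.2] at h1
      linarith
  refine ⟨?_, ?_, ?_, ?_⟩
  · filter_upwards [hζη, hsum] with ω hω h s hs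
    rw [← dirichletPartialSum_congr hω, ← dirichletSeries_congr hω]
    exact h.tendsto_dirichletPartialSum hs
  · filter_upwards [hζη, hpos] with ω hω h
    simp only [← dirichletSeries_congr hω]
    exact limsup_coe_eq_of_forall h.1 h.2
  · filter_upwards [hζη, hneg] with ω hω h
    simp only [← dirichletSeries_congr hω]
    exact liminf_coe_eq_of_forall h.1 h.2
  -- The bounded sums for `α + 1` supply the continuity in `s` that the intermediate value argument
  -- needs.
  · filter_upwards [hζη, hpos, hneg, hsum, hζ.ae_boundedSums (α + 1)] with ω hω h h' hs hs'
    simp only [← dirichletSeries_congr hω]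
    have e : ∀ s : ℝ, √(2 ^ (2 * α) / (σ₁ ^ 2 * Real.Gamma (1 + 2 * α)) *
        (s ^ (1 + 2 * α) / Real.log (Real.log (1 / s)))) *
        dirichletSeries α (fun k => ζ k ω) (1 / 2 + s) =
        √(s ^ (1 + 2 * α) / Real.log (Real.log (1 / s))) *
          dirichletSeries α (fun k => ζ k ω) (1 / 2 + s) / B := by
      intro s
      rw [Real.sqrt_mul (by positivity), hB, ← inv_div, Real.sqrt_inv]
      ring
    simp only [e]
    refine setOf_mapClusterPt_eq_Icc (Real.exp_pos (-1)) ?_ (fun A hA => ?_) (fun A hA => ?_)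
      (fun A hA => ?_) (fun A hA => ?_)
    · refine ContinuousOn.div_const (ContinuousOn.mul ?_ ?_) _
      · exact (continuousOn_rpow_div_log_log α).sqrt
      · exact (hs.continuousOn hs').mono fun s hs => hs.1
    · filter_upwards [h.1 (A * B) (by nlinarith)] with s hs
      rwa [div_le_iff₀ hB0]
    · refine (h.2 (A * B) (by nlinarith)).mono fun s hs => ?_
      rwa [le_div_iff₀ hB0]
    · filter_upwards [h'.1 (A * B) (by nlinarith)] with s hs
      rwa [le_div_iff₀ hB0]
    · refine (h'.2 (A * B) (by nlinarith)).mono fun s hs => ?_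
      rwa [div_le_iff₀ hB0]
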